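/- **Setting.** Let $\xi\sim\mathbb P_\xi$, let $\mathbb P_{\eta|\xi}$ be the conditional law of $\eta$ given $\xi$, and let $f(x,y;\eta,\xi)$, $g(x,y;\eta,\xi)$ be real-valued for $x\in\mathbb R^{d_x}$, $y\in\mathbb R^{d_y}$, measurable in $(\eta,\xi)$, with $f(x,y;\cdot)$ integrable under $\mathbb P_{(\eta,\xi)}$ and $g(x,y;\cdot,\xi)$ integrable under $\mathbb P_{\eta|\xi}$. Consider $$F(x)=\mathbb E_{(\eta,\xi)}\big[f(x,y^*(x;\xi);\eta,\xi)\big],\qquad y^*(x;\xi)=\arg\min_{y\in\mathbb R^{d_y}}\mathbb E_{\eta\sim\mathbb P_{\eta|\xi}}[g(x,y;\eta,\xi)].$$ Let $y_1^0:\mathbb R^{d_x}\to\mathbb R^{d_y}$ be a measurable choice of the initial lower-level iterate (for instance a constant), $x_1\in\mathbb R^{d_x}$, and $\mu_g,L_{g,1}>0$, $L_{f,0},L_{f,1},L_{g,0},L_{g,2},\sigma_f,\sigma_{g,1}\ge 0$. **Assumptions.** For all $\eta,\xi$: (i) $f$ is $C^1$ and $g$ is $C^2$ in $(x,y)$. (ii)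 $g$ is $\mu_g$-strongly convex in $y$ for every $x$. (iii) $f,\nabla f,\nabla g,\nabla^2 g$ are Lipschitz in $(x,y)$ with constants $L_{f,0},L_{f,1},L_{g,1},L_{g,2}$; moreover $\|\mathbb E_{\eta\sim\mathbb P_{\eta|\xi}}\nabla_2 g(x,y_1^0(x);\eta,\xi)\|\le L_{g,0}$ for all $x,\xi$. (iv) $\nabla f$ under $\mathbb P_{(\eta,\xi)}$ is an unbiased estimator of $\nabla\mathbb E[f]$ with variance at most $\sigma_f^2$ for all $(x,y)$; under $\mathbb P_{\eta|\xi}$, $\nabla g$ and $\nabla^2g$ are unbiased estimators of $\nabla\mathbb E_{\eta|\xi}[g]$ and $\nabla^2\mathbb E_{\eta|\xi}[g]$ with variance at most $\sigma_{g,1}^2$ for all $(x,y)$ and $\xi$ (operator norm for Hessians). (v) $F(x_1)-\inf_xF(x)\le\Delta<\infty$. **Algorithms.** *EpochSGD* with base stepsize $\beta_0$: for $k=1,2,\dots$ and $j=0,\dots,2^k-1$, draw a fresh $\eta_k^j\sim\mathbb P_{\eta|\xi}$, set $y_k^{j+1}=y_k^j-\beta_02^{-k}\nabla_2g(x,y_k^j;\eta_k^j,\xi)$,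 and set $y_{k+1}^0=2^{-k}\sum_{j=0}^{2^k-1}y_k^j$; it starts at $y_1^0=y_1^0(x)$. Given $\xi\sim\mathbb P_\xi$, independent $\eta',\eta'',\eta_1,\eta_2,\ldots\sim\mathbb P_{\eta|\xi}$ (also independent of the $\eta_k^j$ given $\xi$) and an independent $\hat N$ uniform on $\{0,\dots,N-1\}$, put $$h(y)=\nabla_1f(x,y;\eta'',\xi)-\nabla_{12}^2g(x,y;\eta',\xi)\,\frac{N}{2L_{g,1}}\prod_{n=1}^{\hat N}\Big(I-\tfrac1{2L_{g,1}}\nabla_{22}^2g(x,y;\eta_n,\xi)\Big)\nabla_2f(x,y;\eta'',\xi).$$ The *DL-SGD* estimator is $h(y_{K+1}^0)$, computed with $K$ epochs. The *RT-MLMC* estimator is $h(y_1^0)+p_{\hat k}^{-1}\big(h(y_{\hat k+1}^0)-h(y_{\hat k}^0)\big)$, computed with $\hat k$ epochs, where $\hat k$ is independent of everything else and $P(\hat k=k)=p_k\propto2^{-k}$ for $k=1,\dots,K$. The *SGD framework* performs $x_{t+1}=x_t-\alpha v(x_t)$ for $t=1,\dots,T$, with $v(x_t)$ one of these estimators built from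 fresh randomness, and outputs $\hat x_T$, uniform on $\{x_1,\dots,x_T\}$. **Theorem.** For all values of the constants above, all $\Delta$ and every $\beta_0\ge 4/\mu_g$ there are $C$, $q\in\mathbb N$ and parameters $N(\epsilon),K(\epsilon),T(\epsilon)\in\{1,2,\dots\}$ and $\alpha(\epsilon)>0$, depending only on these constants (not on $d_x$, $d_y$, the laws, $f$, $g$, $x_1$ or $y_1^0$), such that for all $0<\epsilon\le1/2$ $$N\le C\log\tfrac1\epsilon,\quad K\le C\log\tfrac1\epsilon,\quad\alpha\le C\epsilon^2,\quad T\le C\epsilon^{-4}\big(\log\tfrac1\epsilon\big)^q,$$ and such that for every problem satisfying (i)–(v): $y^*(x;\xi)$ exists and is unique, $F$ is well defined and differentiable, and for every $0<\epsilon\le 1/2$ the SGD framework with these parameters satisfies $\mathbb E\|\nabla F(\hat x_T)\|^2\le\epsilon^2$, both with the RT-MLMC and with the DL-SGD estimator. With RT-MLMC, the expected total numbers of samples of $\xi$, of samples of $\eta$, of gradient evaluations of $f$, and of gradient and Hessian-vector evaluations of $g$ are each at most $C\epsilon^{-4}(\log\frac1\epsilon)^q$. With DL-SGD, almost surely, the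 numbers of samples of $\xi$ and of gradient evaluations of $f$ are at most $C\epsilon^{-4}(\log\frac1\epsilon)^q$, and the numbers of samples of $\eta$ and of gradient and Hessian-vector evaluations of $g$ are at most $C\epsilon^{-6}(\log\frac1\epsilon)^q$. -/

import Mathlib

open MeasureTheory ProbabilityTheory
open scoped NNReal ENNReal

noncomputable section

namespace CSBO

/-! ### Contextual stochastic bilevel problems -/

/-- The Euclidean space `ℝ^d`. -/
abbrev E (d : ℕ) : Type := EuclideanSpace ℝ (Fin d)

/-- The space of pairs `(x, y)` with the Euclidean norm of `ℝ^(dx + dy)`. -/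
def XY (dx dy : ℕ) : Type := WithLp 2 (E dx × E dy)

namespace XY

variable {dx dy : ℕ}

instance : NormedAddCommGroup (XY dx dy) :=
  inferInstanceAs (NormedAddCommGroup (WithLp 2 (E dx × E dy)))
instance : InnerProductSpace ℝ (XY dx dy) :=
  inferInstanceAs (InnerProductSpace ℝ (WithLp 2 (E dx × E dy)))
instance : CompleteSpace (XY dx dy) :=
  inferInstanceAs (CompleteSpace (WithLp 2 (E dx × E dy)))

/-- The two parts `x` and `y` of a pair. -/
def fst (z : XY dx dy) : E dx := WithLp.fst (p := 2) z
def snd (z : XY dx dy) : E dy := WithLp.snd (p := 2) z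

end XY

/-- The data of a problem: the functions `f (x, y; η, ξ)` and `g (x, y; η, ξ)`, the law of the
context `ξ`, and the conditional law of `η` given `ξ`. -/
structure Problem (dx dy : ℕ) (Ξ H : Type*) [MeasurableSpace Ξ] [MeasurableSpace H] where
  f : E dx → E dy → H → Ξ → ℝ
  g : E dx → E dy → H → Ξ → ℝ
  lawXi : Measure Ξ
  lawEta : Kernel Ξ H
  isProb : IsProbabilityMeasure lawXi
  isMarkov : IsMarkovKernel lawEta

/-- The constants of the regularity assumptions. -/
structure Constants where
  μ : ℝ
  Lf0 : ℝ≥0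
  Lf1 : ℝ≥0
  Lg0 : ℝ≥0
  Lg1 : ℝ≥0
  Lg2 : ℝ≥0
  σf : ℝ≥0
  σg : ℝ≥0
  μ_pos : 0 < μ
  Lg1_pos : 0 < Lg1

namespace Problem

variable {dx dy : ℕ} {Ξ H : Type*} [MeasurableSpace Ξ] [MeasurableSpace H]

instance (P : Problem dx dy Ξ H) : IsProbabilityMeasure P.lawXi := P.isProb
instance (P : Problem dx dy Ξ H) : IsMarkovKernel P.lawEta := P.isMarkov

/-- The joint law of `(ξ, η)`. -/
def joint (P : Problem dx dy Ξ H) : Measure (Ξ × H) := P.lawXi ⊗ₘ P.lawEta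

/-- `f` and `g` as functions of the pair `z = (x, y)`. -/
def fz (P : Problem dx dy Ξ H) (η : H) (ξ : Ξ) (z : XY dx dy) : ℝ := P.f z.fst z.snd η ξ
def gz (P : Problem dx dy Ξ H) (η : H) (ξ : Ξ) (z : XY dx dy) : ℝ := P.g z.fst z.snd η ξ

/-- Gradients in `(x, y)`, and the Hessian of `g` in `(x, y)`. -/
def gradf (P : Problem dx dy Ξ H) (η : H) (ξ : Ξ) (z : XY dx dy) : XY dx dy :=
  gradient (P.fz η ξ) z
def gradg (P : Problem dx dy Ξ H) (η : H) (ξ : Ξ) (z : XY dx dy) : XY dx dy :=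
  gradient (P.gz η ξ) z
def hessg (P : Problem dx dy Ξ H) (η : H) (ξ : Ξ) (z : XY dx dy) : XY dx dy →L[ℝ] XY dx dy :=
  fderiv ℝ (P.gradg η ξ) z

/-- The expectation of `f (z; η, ξ)` over the joint law, and the conditional expectation
of `g (z; η, ξ)` given `ξ`. -/
def meanf (P : Problem dx dy Ξ H) (z : XY dx dy) : ℝ := ∫ p, P.fz p.2 p.1 z ∂P.joint
def meang (P : Problem dx dy Ξ H) (ξ : Ξ) (z : XY dx dy) : ℝ := ∫ η, P.gz η ξ z ∂P.lawEta ξ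

/-- Partial gradients `∇₁ f`, `∇₂ f`, `∇₂ g`. -/
def grad1f (P : Problem dx dy Ξ H) (x : E dx) (y : E dy) (η : H) (ξ : Ξ) : E dx :=
  gradient (fun x' => P.f x' y η ξ) x
def grad2f (P : Problem dx dy Ξ H) (x : E dx) (y : E dy) (η : H) (ξ : Ξ) : E dy :=
  gradient (fun y' => P.f x y' η ξ) y
def grad1g (P : Problem dx dy Ξ H) (x : E dx) (y : E dy) (η : H) (ξ : Ξ) : E dx :=
  gradient (fun x' => P.g x' y η ξ) x
def grad2g (P : Problem dx dy Ξ H) (x : E dx) (y : E dy) (η : H) (ξ : Ξ) : E dy :=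
  gradient (fun y' => P.g x y' η ξ) y

/-- The second derivatives `∇₂₂² g` (a `dy × dy` matrix) and `∇₁₂² g` (the `dx × dy` matrix with
entries `∂²g / ∂xᵢ ∂yⱼ`), as linear maps. -/
def hess22g (P : Problem dx dy Ξ H) (x : E dx) (y : E dy) (η : H) (ξ : Ξ) : E dy →L[ℝ] E dy :=
  fderiv ℝ (fun y' => P.grad2g x y' η ξ) y
def hess12g (P : Problem dx dy Ξ H) (x : E dx) (y : E dy) (η : H) (ξ : Ξ) : E dy →L[ℝ] E dx :=
  fderiv ℝ (fun y' => P.grad1g x y' η ξ) y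

/-- The lower-level objective `y ↦ 𝔼[g (x, y; η, ξ) | ξ]`. -/
def lower (P : Problem dx dy Ξ H) (x : E dx) (ξ : Ξ) (y : E dy) : ℝ :=
  ∫ η, P.g x y η ξ ∂P.lawEta ξ

/-- The lower-level solution `y*(x; ξ)`. -/
def yStar (P : Problem dx dy Ξ H) (x : E dx) (ξ : Ξ) : E dy :=
  Classical.epsilon fun y => IsMinOn (P.lower x ξ) Set.univ y

/-- The upper-level objective `F`. -/
def F (P : Problem dx dy Ξ H) (x : E dx) : ℝ :=
  ∫ p, P.f x (P.yStar x p.1) p.2 p.1 ∂P.joint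

/-- The problem is well defined: the lower level has exactly one minimizer, the expectation that
defines `F` exists, and `F` is differentiable. -/
structure WellDefined (P : Problem dx dy Ξ H) : Prop where
  existsUnique_lower : ∀ x ξ, ∃! y, IsMinOn (P.lower x ξ) Set.univ y
  integrable_upper : ∀ x, Integrable (fun p : Ξ × H => P.f x (P.yStar x p.1) p.2 p.1) P.joint
  differentiable_F : Differentiable ℝ P.F

/-- The regularity assumptions; `y₀ x` is the initial lower-level iterate used at `x`. -/
structure Regular (P : Problem dx dy Ξ H) (c : Constants) (y₀ : E dx → E dy) : Prop where
  /- the expectations in the problem make sense -/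
  f_measurable : ∀ x y, Measurable fun p : Ξ × H => P.f x y p.2 p.1
  g_measurable : ∀ x y, Measurable fun p : Ξ × H => P.g x y p.2 p.1
  f_integrable : ∀ x y, Integrable (fun p : Ξ × H => P.f x y p.2 p.1) P.joint
  g_integrable : ∀ x y ξ, Integrable (fun η => P.g x y η ξ) (P.lawEta ξ)
  /- smoothness -/
  f_contDiff : ∀ η ξ, ContDiff ℝ 1 (P.fz η ξ)
  g_contDiff : ∀ η ξ, ContDiff ℝ 2 (P.gz η ξ)
  /- strong convexity of `g` in `y` -/
  g_strong : ∀ x η ξ y y', c.μ / 2 * ‖y - y'‖ ^ 2 ≤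
    P.g x y η ξ - P.g x y' η ξ - inner ℝ (P.grad2g x y' η ξ) (y - y')
  /- Lipschitz conditions -/
  f_lipschitz : ∀ η ξ, LipschitzWith c.Lf0 (P.fz η ξ)
  gradf_lipschitz : ∀ η ξ, LipschitzWith c.Lf1 (P.gradf η ξ)
  gradg_lipschitz : ∀ η ξ, LipschitzWith c.Lg1 (P.gradg η ξ)
  hessg_lipschitz : ∀ η ξ, LipschitzWith c.Lg2 (P.hessg η ξ)
  /- The expected lower-level gradient at the initial iterate is bounded by `Lg0`. If `g` is
  `Lg0`-Lipschitz in `y`, this holds for every initial iterate; but a function that is strongly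
  convex on the whole space of positive dimension is never Lipschitz there, so only this
  consequence is required. -/
  initial_bound : ∀ x ξ, ‖∫ η, P.grad2g x (y₀ x) η ξ ∂P.lawEta ξ‖ ≤ c.Lg0
  y₀_measurable : Measurable y₀
  /- unbiased gradients with bounded variance -/
  gradf_unbiased : ∀ z, ∫ p, P.gradf p.2 p.1 z ∂P.joint = gradient P.meanf z
  gradf_variance : ∀ z,
    ∫⁻ p, ‖P.gradf p.2 p.1 z - gradient P.meanf z‖ₑ ^ 2 ∂P.joint ≤ (c.σf : ℝ≥0∞) ^ 2
  gradg_unbiased : ∀ z ξ, ∫ η, P.gradg η ξ z ∂P.lawEta ξ = gradient (P.meang ξ) z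
  gradg_variance : ∀ z ξ,
    ∫⁻ η, ‖P.gradg η ξ z - gradient (P.meang ξ) z‖ₑ ^ 2 ∂P.lawEta ξ ≤ (c.σg : ℝ≥0∞) ^ 2
  hessg_unbiased : ∀ z ξ,
    ∫ η, P.hessg η ξ z ∂P.lawEta ξ = fderiv ℝ (gradient (P.meang ξ)) z
  hessg_variance : ∀ z ξ,
    ∫⁻ η, ‖P.hessg η ξ z - fderiv ℝ (gradient (P.meang ξ)) z‖ₑ ^ 2 ∂P.lawEta ξ
      ≤ (c.σg : ℝ≥0∞) ^ 2

end Problem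

/-! ### Counting oracle calls -/

/-- Numbers of samples of `ξ`, samples of `η`, evaluations of `∇ f`, and evaluations of
derivatives of `g` (gradients and Hessian-vector products). -/
@[ext] structure Cost where
  xi : ℕ
  eta : ℕ
  gradF : ℕ
  gradG : ℕ

instance : Zero Cost := ⟨⟨0, 0, 0, 0⟩⟩
instance : Add Cost :=
  ⟨fun a b => ⟨a.xi + b.xi, a.eta + b.eta, a.gradF + b.gradF, a.gradG + b.gradG⟩⟩

/-- The result of a computation together with its cost. -/
structure Counted (α : Type*) where
  val : α
  cost : Cost

namespace Counted

variable {α β : Type*}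

/-- A computation without oracle calls. -/
def pure (a : α) : Counted α := ⟨a, 0⟩

/-- Sequential composition: the costs add up. -/
def bind (m : Counted α) (k : α → Counted β) : Counted β :=
  ⟨(k m.val).val, m.cost + (k m.val).cost⟩

/-- One sample of `ξ`. -/
def sampleXi (a : α) : Counted α := ⟨a, ⟨1, 0, 0, 0⟩⟩
/-- A batch of `n` samples of `η`. -/
def sampleEta (n : ℕ) (a : α) : Counted α := ⟨a, ⟨0, n, 0, 0⟩⟩
/-- One evaluation of the gradient of `f`. -/
def evalF (a : α) : Counted α := ⟨a, ⟨0, 0, 1, 0⟩⟩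
/-- One evaluation of a gradient, or of a Hessian-vector product, of `g`. -/
def evalG (a : α) : Counted α := ⟨a, ⟨0, 0, 0, 1⟩⟩

end Counted

/-! ### Randomness -/

/-- Names of the samples of `η` that one gradient estimator may draw: the sample `η_k^j` of
epoch `k`, the sample `η_n` of the Neumann product, `η'` and `η''`. -/
inductive EtaIdx where
  | epoch (k j : ℕ)
  | neumann (n : ℕ)
  | prime
  | dprime

/-- The randomness of one gradient estimator: `((ξ, samples of η), (N̂, k̂))`. -/
abbrev Tape (Ξ H : Type*) : Type _ := (Ξ × (EtaIdx → H)) × (ℕ × ℕ)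

/-- The uniform distribution on `{0, …, N - 1}`. -/
def unif (N : ℕ+) : Measure ℕ :=
  ∑ n ∈ Finset.range N, ((N : ℕ) : ℝ≥0∞)⁻¹ • Measure.dirac n

instance (N : ℕ+) : IsProbabilityMeasure (unif N) := by
  constructor
  simp only [unif, Measure.coe_finsetSum, Finset.sum_apply, Measure.smul_apply,
    measure_univ, smul_eq_mul, mul_one, Finset.sum_const, Finset.card_range, nsmul_eq_mul]
  exact ENNReal.mul_inv_cancel (by simp) (by simp)

/-- The weights `p_k ∝ 2^(-k)`, `k = 1, …, K`, of the truncated geometric distribution. -/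
def geomWeight (K : ℕ+) (k : ℕ) : ℝ :=
  (2 : ℝ)⁻¹ ^ k / ∑ j ∈ Finset.Icc 1 (K : ℕ), (2 : ℝ)⁻¹ ^ j

/-- The truncated geometric distribution on `{1, …, K}`. -/
def geom (K : ℕ+) : Measure ℕ :=
  ∑ k ∈ Finset.Icc 1 (K : ℕ), ENNReal.ofReal (geomWeight K k) • Measure.dirac k

instance (K : ℕ+) : IsProbabilityMeasure (geom K) := by
  constructor
  have hpos : 0 < ∑ j ∈ Finset.Icc 1 (K : ℕ), (2 : ℝ)⁻¹ ^ j :=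
    Finset.sum_pos (fun _ _ => by positivity) ⟨1, by simp [Nat.one_le_iff_ne_zero]⟩
  simp only [geom, Measure.coe_finsetSum, Finset.sum_apply, Measure.smul_apply,
    measure_univ, smul_eq_mul, mul_one]
  rw [← ENNReal.ofReal_sum_of_nonneg (fun k _ => by unfold geomWeight; positivity)]
  simp only [geomWeight]
  rw [← Finset.sum_div, div_self hpos.ne', ENNReal.ofReal_one]

namespace Problem

variable {dx dy : ℕ} {Ξ H : Type*} [MeasurableSpace Ξ] [MeasurableSpace H]

/-- The conditional law given `ξ` of the samples of `η`: they are i.i.d. from `lawEta ξ`. -/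
def etaLaw (P : Problem dx dy Ξ H) : Kernel Ξ (EtaIdx → H) where
  toFun ξ := Measure.infinitePi fun _ : EtaIdx => P.lawEta ξ
  measurable' := by
    refine Measurable.measure_of_isPiSystem_of_isProbabilityMeasure
      generateFrom_squareCylinders.symm
      (isPiSystem_squareCylinders (fun _ => MeasurableSpace.isPiSystem_measurableSet)
        (by simp)) ?_
    rintro S ⟨s, t, ht, rfl⟩
    have ht' : ∀ i ∈ s, MeasurableSet (t i) := fun i _ => ht i (Set.mem_univ i)
    simp_rw [Measure.infinitePi_pi _ ht']
    exact Finset.measurable_prod _ fun i hi => P.lawEta.measurable_coe (ht' i hi)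

instance (P : Problem dx dy Ξ H) : IsMarkovKernel P.etaLaw :=
  ⟨fun ξ => inferInstanceAs
    (IsProbabilityMeasure (Measure.infinitePi fun _ : EtaIdx => P.lawEta ξ))⟩

/-- The law of the randomness of one gradient estimator. -/
def tapeLaw (P : Problem dx dy Ξ H) (N K : ℕ+) : Measure (Tape Ξ H) :=
  (P.lawXi ⊗ₘ P.etaLaw).prod ((unif N).prod (geom K))

instance (P : Problem dx dy Ξ H) (N K : ℕ+) : IsProbabilityMeasure (P.tapeLaw N K) := by
  unfold tapeLaw; infer_instance

/-- The law of the randomness of the SGD framework: independent tapes, one per iteration, and an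
independent uniform output index. -/
def runLaw (P : Problem dx dy Ξ H) (N K T : ℕ+) : Measure ((ℕ → Tape Ξ H) × ℕ) :=
  (Measure.infinitePi fun _ : ℕ => P.tapeLaw N K).prod (unif T)

/-! ### The algorithms -/

/-- `j` steps of epoch `k` of EpochSGD, started at `y`: the iterate `y_k^j` and the sum of
`y_k^0, …, y_k^(j-1)`. -/
def epochSteps (P : Problem dx dy Ξ H) (β₀ : ℝ) (x : E dx) (ξ : Ξ) (η : EtaIdx → H) (k : ℕ)
    (y : E dy) : ℕ → Counted (E dy × E dy)
  | 0 => .pure (y, 0)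
  | j + 1 =>
    (P.epochSteps β₀ x ξ η k y j).bind fun s =>
    (Counted.sampleEta 1 (η (.epoch k j))).bind fun e =>
    (Counted.evalG (P.grad2g x s.1 e ξ)).bind fun v =>
    .pure (s.1 - (β₀ * (2 : ℝ)⁻¹ ^ k) • v, s.2 + s.1)

/-- EpochSGD with `K` epochs; the result is `(y_K^0, y_(K+1)^0)`. -/
def epochSGD (P : Problem dx dy Ξ H) (β₀ : ℝ) (x : E dx) (ξ : Ξ) (η : EtaIdx → H)
    (y : E dy) : ℕ → Counted (E dy × E dy)
  | 0 => .pure (y, y)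
  | K + 1 =>
    (P.epochSGD β₀ x ξ η y K).bind fun s =>
    (P.epochSteps β₀ x ξ η (K + 1) s.2 (2 ^ (K + 1))).bind fun r =>
    .pure (s.2, (2 : ℝ)⁻¹ ^ (K + 1) • r.2)

/-- The product `∏_{i=1}^n (I - (1 / 2L) ∇₂₂² g (x, y; η_i, ξ))` applied to a vector. -/
def neumann (P : Problem dx dy Ξ H) (L : ℝ) (x : E dx) (y : E dy) (ξ : Ξ) (η : EtaIdx → H) :
    ℕ → E dy → Counted (E dy)
  | 0, r => .pure r
  | n + 1, r =>
    (Counted.evalG (P.hess22g x y (η (.neumann (n + 1))) ξ r)).bind fun v =>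
    P.neumann L x y ξ η n (r - (1 / (2 * L)) • v)

/-- `∇₁ f (x, y; η'', ξ) - ∇₁₂² g (x, y; η', ξ) Λ̂ (x, y; ξ) ∇₂ f (x, y; η'', ξ)`, where `Λ̂` is
`N / (2L)` times the Neumann product with `Nhat` factors. -/
def component (P : Problem dx dy Ξ H) (L : ℝ) (N : ℕ+) (x : E dx) (y : E dy) (ξ : Ξ)
    (η : EtaIdx → H) (Nhat : ℕ) : Counted (E dx) :=
  (Counted.evalF (P.grad1f x y (η .dprime) ξ, P.grad2f x y (η .dprime) ξ)).bind fun d =>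
  (P.neumann L x y ξ η Nhat d.2).bind fun r =>
  (Counted.evalG (P.hess12g x y (η .prime) ξ ((((N : ℕ) : ℝ) / (2 * L)) • r))).bind fun v =>
  .pure (d.1 - v)

/-- The DL-SGD gradient estimator at `x`. -/
def dlsgd (P : Problem dx dy Ξ H) (L β₀ : ℝ) (y₀ : E dx → E dy) (N K : ℕ+) (x : E dx)
    (ω : Tape Ξ H) : Counted (E dx) :=
  (Counted.sampleXi ω.1.1).bind fun ξ =>
  (P.epochSGD β₀ x ξ ω.1.2 (y₀ x) K).bind fun s =>
  (Counted.sampleEta (ω.2.1 + 2) ω.1.2).bind fun η =>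
  P.component L N x s.2 ξ η ω.2.1

/-- The RT-MLMC gradient estimator at `x`:
`v̂¹ + p_k̂⁻¹ (v̂^(k̂+1) - v̂^k̂)`, where `v̂^k` is the component at `y_k^0`. -/
def rtmlmc (P : Problem dx dy Ξ H) (L β₀ : ℝ) (y₀ : E dx → E dy) (N K : ℕ+) (x : E dx)
    (ω : Tape Ξ H) : Counted (E dx) :=
  (Counted.sampleXi ω.1.1).bind fun ξ =>
  (P.epochSGD β₀ x ξ ω.1.2 (y₀ x) ω.2.2).bind fun s =>
  (Counted.sampleEta (ω.2.1 + 2) ω.1.2).bind fun η =>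
  (P.component L N x s.2 ξ η ω.2.1).bind fun vNext =>
  (P.component L N x s.1 ξ η ω.2.1).bind fun vCur =>
  (P.component L N x (y₀ x) ξ η ω.2.1).bind fun vOne =>
  .pure (vOne + (geomWeight K ω.2.2)⁻¹ • (vNext - vCur))

/-- The SGD framework with constant stepsize `α`: the iterate `x_(t+1)`, obtained from `x₁` by
`t` steps, with the cost so far. -/
def sgd {α' : Type*} (v : E dx → α' → Counted (E dx)) (α : ℝ) (x₁ : E dx) (ω : ℕ → α') :
    ℕ → Counted (E dx)
  | 0 => .pure x₁
  | t + 1 =>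
    (sgd v α x₁ ω t).bind fun x =>
    (v x (ω t)).bind fun d =>
    .pure (x - α • d)

/-- The output `x̂_T`: a uniformly random one among `x₁, …, x_T`. -/
def output {α' : Type*} (v : E dx → α' → Counted (E dx)) (α : ℝ) (x₁ : E dx)
    (ω : (ℕ → α') × ℕ) : E dx :=
  (sgd v α x₁ ω.1 ω.2).val

/-- The total cost of `T` iterations. -/
def totalCost {α' : Type*} (v : E dx → α' → Counted (E dx)) (α : ℝ) (x₁ : E dx) (T : ℕ+)
    (ω : (ℕ → α') × ℕ) : Cost :=
  (sgd v α x₁ ω.1 T).cost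

end Problem

end CSBO

end

noncomputable section

namespace CSBO

/-! ### Calculus in pairs -/

namespace XY

variable {dx dy : ℕ}

/-! Write G for the conditional mean of g given ξ. Its y-gradient is strongly monotone and
Lipschitz, so the lower level has exactly one solution y*, Lipschitz in x. Expanding ∇₂G = 0 to
first order along (x, y*(x)) gives Dy* = -(∇₂₂²G)⁻¹ ∂ₓ∇₂G, hence ∇F = 𝔼[∇₁f - ∇₁₂²G (∇₂₂²G)⁻¹ ∇₂f]
at y* (`hasGradientAt_F`, `gradient_F`), a Lipschitz map with constant `Constants.LF`.

For such an F, SGD with an oracle of bias at most B and second moment at most W at every point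
satisfies 𝔼‖∇F(x̂_T)‖² ≤ 2Δ/(αT) + B² + 2·LF·α·W (`lintegral_gradient_output_le`). If B is of order
ε and W is polylogarithmic, then α of order ε²/W and T of order ε⁻⁴W suffice. What remains is to
control bias, second moment and cost of the two estimators.

The bias has two sources. Averaging over N̂ turns the random Neumann product into a partial sum of
the Neumann series of the inverse Hessian, with remainder ρ^N, ρ < 1
(`norm_mean_component_sub_hyper_le`). Replacing y* by an EpochSGD iterate costs N² times the error
of that iterate (`norm_component_sub_le`), whose mean square decays like 2^(-k)
(`exists_epochError_bound`): within an epoch of small stepsize b the one-step inequalities telescope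
to bμ Σ_j err_j ≤ err_start + 2^k b²σ², and since 2^k bμ = β₀μ ≥ 4, averaging divides the error by
four up to noise of order 2^(-k). The finitely many early epochs with a large stepsize only affect
the constant. So N of order log(1/ε) and 2^K of order ε⁻² up to logarithms are enough.

DL-SGD has bounded components, so W is of order N², but each step costs about 2^K samples. RT-MLMC
has the same mean, because p_k cancels p_k⁻¹ and the levels telescope (`integral_rtmlmc`). Level k
adds at most a multiple of p_k⁻¹ N⁴ 2^(-k), that is of N⁴, to its second moment, and p_k 2^(k+1) ≤ 4
to its expected cost; both sums over k are polylogarithmic. This saves the factor ε⁻². All constants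
are chosen from `c`, Δ and β₀ before the problem is given. -/

instance : FiniteDimensional ℝ (XY dx dy) :=
  inferInstanceAs (FiniteDimensional ℝ (WithLp 2 (E dx × E dy)))

/-- The pair `(x, y)`. -/
def pair (x : E dx) (y : E dy) : XY dx dy := WithLp.toLp 2 (x, y)

@[simp] lemma fst_pair (x : E dx) (y : E dy) : (pair x y).fst = x := rfl
@[simp] lemma snd_pair (x : E dx) (y : E dy) : (pair x y).snd = y := rfl

lemma inner_eq (z w : XY dx dy) :
    inner ℝ z w = inner ℝ z.fst w.fst + inner ℝ z.snd w.snd :=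
  WithLp.prod_inner_apply (𝕜 := ℝ) (E := E dx) (F := E dy) z w

lemma norm_sq_eq (z : XY dx dy) : ‖z‖ ^ 2 = ‖z.fst‖ ^ 2 + ‖z.snd‖ ^ 2 := by
  rw [← real_inner_self_eq_norm_sq, inner_eq, real_inner_self_eq_norm_sq,
    real_inner_self_eq_norm_sq]

lemma norm_fst_le (z : XY dx dy) : ‖z.fst‖ ≤ ‖z‖ :=
  abs_le_of_sq_le_sq' (by rw [norm_sq_eq]; nlinarith [sq_nonneg ‖z.snd‖]) (norm_nonneg _) |>.2

lemma norm_snd_le (z : XY dx dy) : ‖z.snd‖ ≤ ‖z‖ :=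
  abs_le_of_sq_le_sq' (by rw [norm_sq_eq]; nlinarith [sq_nonneg ‖z.fst‖]) (norm_nonneg _) |>.2

lemma norm_pair_le (x : E dx) (y : E dy) : ‖pair x y‖ ≤ ‖x‖ + ‖y‖ :=
  abs_le_of_sq_le_sq' (by
    rw [norm_sq_eq]; simp only [fst_pair, snd_pair]
    nlinarith [norm_nonneg x, norm_nonneg y]) (by positivity) |>.2

lemma norm_pair_zero_right (x : E dx) : ‖pair x (0 : E dy)‖ = ‖x‖ :=
  le_antisymm (by simpa using norm_pair_le x (0 : E dy)) (norm_fst_le (pair x (0 : E dy)))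

lemma norm_pair_zero_left (y : E dy) : ‖pair (0 : E dx) y‖ = ‖y‖ :=
  le_antisymm (by simpa using norm_pair_le (0 : E dx) y) (norm_snd_le (pair (0 : E dx) y))

lemma pair_sub_pair (x x' : E dx) (y y' : E dy) : pair x y - pair x' y' = pair (x - x') (y - y') := rfl
lemma pair_add_pair (x x' : E dx) (y y' : E dy) : pair x y + pair x' y' = pair (x + x') (y + y') := rfl

/-- The projections and the inclusions, as continuous linear maps. -/
def fstL : XY dx dy →L[ℝ] E dx :=
  LinearMap.mkContinuous ⟨⟨fst, fun _ _ => rfl⟩, fun _ _ => rfl⟩ 1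
    fun z => by rw [one_mul]; exact norm_fst_le z
def sndL : XY dx dy →L[ℝ] E dy :=
  LinearMap.mkContinuous ⟨⟨snd, fun _ _ => rfl⟩, fun _ _ => rfl⟩ 1
    fun z => by rw [one_mul]; exact norm_snd_le z
def inlL : E dx →L[ℝ] XY dx dy :=
  LinearMap.mkContinuous
    ⟨⟨fun x => pair x 0, fun x x' => by rw [pair_add_pair, add_zero]⟩,
      fun r x => show pair (r • x) 0 = pair (r • x) (r • 0) by rw [smul_zero]⟩ 1
    fun x => by rw [one_mul]; exact (norm_pair_zero_right x).le
def inrL : E dy →L[ℝ] XY dx dy :=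
  LinearMap.mkContinuous
    ⟨⟨fun y => pair 0 y, fun y y' => by rw [pair_add_pair, add_zero]⟩,
      fun r y => show pair 0 (r • y) = pair (r • 0) (r • y) by rw [smul_zero]⟩ 1
    fun y => by rw [one_mul]; exact (norm_pair_zero_left y).le

@[simp] lemma fstL_apply (z : XY dx dy) : fstL z = z.fst := rfl
@[simp] lemma sndL_apply (z : XY dx dy) : sndL z = z.snd := rfl
@[simp] lemma inlL_apply (x : E dx) : (inlL x : XY dx dy) = pair x 0 := rfl
@[simp] lemma inrL_apply (y : E dy) : (inrL y : XY dx dy) = pair 0 y := rfl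

lemma norm_fstL_le : ‖(fstL : XY dx dy →L[ℝ] E dx)‖ ≤ 1 :=
  LinearMap.mkContinuous_norm_le _ zero_le_one _
lemma norm_sndL_le : ‖(sndL : XY dx dy →L[ℝ] E dy)‖ ≤ 1 :=
  LinearMap.mkContinuous_norm_le _ zero_le_one _
lemma norm_inrL_le : ‖(inrL : E dy →L[ℝ] XY dx dy)‖ ≤ 1 :=
  LinearMap.mkContinuous_norm_le _ zero_le_one _

lemma hasFDerivAt_pair_left (x : E dx) (y : E dy) :
    HasFDerivAt (fun x' => pair x' y) (inlL : E dx →L[ℝ] XY dx dy) x := by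
  have h : (fun x' => pair x' y) = fun x' : E dx => (inlL x' : XY dx dy) + pair 0 y := by
    funext x'; simp [pair_add_pair]
  rw [h]; exact inlL.hasFDerivAt.add_const _

lemma hasFDerivAt_pair_right (x : E dx) (y : E dy) :
    HasFDerivAt (fun y' => pair x y') (inrL : E dy →L[ℝ] XY dx dy) y := by
  have h : (fun y' => pair x y') = fun y' : E dy => (inrL y' : XY dx dy) + pair x 0 := by
    funext x'; simp [pair_add_pair]
  rw [h]; exact inrL.hasFDerivAt.add_const _

lemma continuous_pair : Continuous fun p : E dx × E dy => pair p.1 p.2 := by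
  have h : (fun p : E dx × E dy => pair p.1 p.2) =
      fun p : E dx × E dy => (inlL p.1 : XY dx dy) + inrL p.2 := by
    funext p; simp [pair_add_pair]
  rw [h]; fun_prop

lemma hasGradientAt_left {φ : XY dx dy → ℝ} {x : E dx} {y : E dy} {v : XY dx dy}
    (h : HasGradientAt φ v (pair x y)) : HasGradientAt (fun x' => φ (pair x' y)) v.fst x := by
  rw [hasGradientAt_iff_hasFDerivAt] at h ⊢
  refine (h.comp x (hasFDerivAt_pair_left x y)).congr_fderiv ?_
  ext u; simp [inner_eq]

lemma hasGradientAt_right {φ : XY dx dy → ℝ} {x : E dx} {y : E dy} {v : XY dx dy}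
    (h : HasGradientAt φ v (pair x y)) : HasGradientAt (fun y' => φ (pair x y')) v.snd y := by
  rw [hasGradientAt_iff_hasFDerivAt] at h ⊢
  refine (h.comp y (hasFDerivAt_pair_right x y)).congr_fderiv ?_
  ext u; simp [inner_eq]

end XY

/-! ### Measurability of derivatives with respect to a parameter -/

/-- In finite dimension A = Σ bᵢ* ⊗ A bᵢ for a basis b, a continuous function of finitely many
values of A. -/
lemma stronglyMeasurable_of_forall_apply {Ω V W : Type*} [MeasurableSpace Ω]
    [NormedAddCommGroup V] [NormedSpace ℝ V] [FiniteDimensional ℝ V]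
    [NormedAddCommGroup W] [NormedSpace ℝ W] {A : Ω → V →L[ℝ] W}
    (h : ∀ v, StronglyMeasurable fun ω => A ω v) : StronglyMeasurable A := by
  let b := Module.finBasis ℝ V
  have hA : A = fun ω => ∑ i,
      ContinuousLinearMap.smulRightL ℝ V W (LinearMap.toContinuousLinearMap (b.coord i))
        (A ω (b i)) := by
    funext ω
    refine ContinuousLinearMap.coe_injective (b.ext fun j => ?_)
    simp [Finsupp.single_apply]
  rw [hA]
  refine Finset.stronglyMeasurable_fun_sum _ fun i _ => ?_
  exact (ContinuousLinearMap.continuous _).comp_stronglyMeasurable (h (b i))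

/-- Each directional derivative is a pointwise limit of difference quotients with increment 1/n, and
these are measurable in the parameter. -/
lemma stronglyMeasurable_fderiv_param {Ω V W : Type*} [MeasurableSpace Ω]
    [NormedAddCommGroup V] [NormedSpace ℝ V] [FiniteDimensional ℝ V]
    [NormedAddCommGroup W] [NormedSpace ℝ W] {φ : Ω → V → W} {z : V}
    (hm : ∀ z, StronglyMeasurable fun ω => φ ω z) (hd : ∀ ω, DifferentiableAt ℝ (φ ω) z) :
    StronglyMeasurable fun ω => fderiv ℝ (φ ω) z := by
  refine stronglyMeasurable_of_forall_apply fun v => ?_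
  refine stronglyMeasurable_of_tendsto Filter.atTop
    (f := fun (n : ℕ) ω => (n : ℝ) • (φ ω (z + (n : ℝ)⁻¹ • v) - φ ω z)) (fun n => ?_) ?_
  · exact ((hm _).sub (hm _)).const_smul (n : ℝ)
  · rw [tendsto_pi_nhds]
    intro ω
    exact ((hd ω).hasFDerivAt.lim_real v).comp tendsto_natCast_atTop_atTop

end CSBO
end

noncomputable section

namespace CSBO

/-! ### Consequences of the regularity assumptions for fixed `η`, `ξ` -/

namespace Problem.Regular

variable {dx dy : ℕ} {Ξ H : Type*} [MeasurableSpace Ξ] [MeasurableSpace H]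
  {P : Problem dx dy Ξ H} {c : Constants} {y₀ : E dx → E dy}

open XY

lemma hasGradientAt_fz (hP : P.Regular c y₀) (η : H) (ξ : Ξ) (z : XY dx dy) :
    HasGradientAt (P.fz η ξ) (P.gradf η ξ z) z :=
  ((hP.f_contDiff η ξ).differentiable one_ne_zero z).hasGradientAt

lemma hasGradientAt_gz (hP : P.Regular c y₀) (η : H) (ξ : Ξ) (z : XY dx dy) :
    HasGradientAt (P.gz η ξ) (P.gradg η ξ z) z :=
  ((hP.g_contDiff η ξ).differentiable two_ne_zero z).hasGradientAt

lemma grad1f_eq (hP : P.Regular c y₀) (x : E dx) (y : E dy) (η : H) (ξ : Ξ) :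
    P.grad1f x y η ξ = (P.gradf η ξ (pair x y)).fst :=
  (hasGradientAt_left (hP.hasGradientAt_fz η ξ (pair x y))).gradient

lemma grad2f_eq (hP : P.Regular c y₀) (x : E dx) (y : E dy) (η : H) (ξ : Ξ) :
    P.grad2f x y η ξ = (P.gradf η ξ (pair x y)).snd :=
  (hasGradientAt_right (hP.hasGradientAt_fz η ξ (pair x y))).gradient

lemma grad1g_eq (hP : P.Regular c y₀) (x : E dx) (y : E dy) (η : H) (ξ : Ξ) :
    P.grad1g x y η ξ = (P.gradg η ξ (pair x y)).fst :=
  (hasGradientAt_left (hP.hasGradientAt_gz η ξ (pair x y))).gradient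

lemma grad2g_eq (hP : P.Regular c y₀) (x : E dx) (y : E dy) (η : H) (ξ : Ξ) :
    P.grad2g x y η ξ = (P.gradg η ξ (pair x y)).snd :=
  (hasGradientAt_right (hP.hasGradientAt_gz η ξ (pair x y))).gradient

lemma contDiff_gradg (hP : P.Regular c y₀) (η : H) (ξ : Ξ) : ContDiff ℝ 1 (P.gradg η ξ) := by
  have h : ContDiff ℝ 1 (fderiv ℝ (P.gz η ξ)) :=
    (hP.g_contDiff η ξ).fderiv_right (by norm_num [one_add_one_eq_two])
  exact (InnerProductSpace.toDual ℝ (XY dx dy)).symm.toContinuousLinearEquiv.contDiff.comp h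

lemma hasFDerivAt_gradg (hP : P.Regular c y₀) (η : H) (ξ : Ξ) (z : XY dx dy) :
    HasFDerivAt (P.gradg η ξ) (P.hessg η ξ z) z :=
  ((hP.contDiff_gradg η ξ).differentiable one_ne_zero z).hasFDerivAt

lemma hessg_symm (hP : P.Regular c y₀) (η : H) (ξ : Ξ) (z u v : XY dx dy) :
    inner ℝ (P.hessg η ξ z u) v = inner ℝ u (P.hessg η ξ z v) := by
  -- The derivative of the gradient represents the second derivative as a bilinear form; the
  -- symmetry of the latter is that of a C² function.
  have key : ∀ u v, fderiv ℝ (fderiv ℝ (P.gz η ξ)) z u v = inner ℝ (P.hessg η ξ z u) v := by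
    intro u v
    have h1 : (fun z => inner ℝ (P.gradg η ξ z) v) = fun z => fderiv ℝ (P.gz η ξ) z v := by
      funext z
      rw [(hP.hasGradientAt_gz η ξ z).hasFDerivAt.fderiv]; simp
    have h2 : HasFDerivAt (fun z => fderiv ℝ (P.gz η ξ) z v)
        ((fderiv ℝ (fderiv ℝ (P.gz η ξ)) z).flip v) z := by
      have hd : ContDiff ℝ 1 (fderiv ℝ (P.gz η ξ)) :=
        (hP.g_contDiff η ξ).fderiv_right (by norm_num [one_add_one_eq_two])
      have := (hd.differentiable one_ne_zero z).hasFDerivAt.clm_apply (hasFDerivAt_const v z)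
      simpa using this
    have h3 := (hP.hasFDerivAt_gradg η ξ z).inner ℝ (hasFDerivAt_const v z)
    rw [h1] at h3
    simpa using congrArg (fun T => T u) (h2.unique h3)
  have hs : IsSymmSndFDerivAt ℝ (P.gz η ξ) z :=
    ((hP.g_contDiff η ξ).contDiffAt).isSymmSndFDerivAt (by simp)
  rw [← key, hs.eq u v, key, real_inner_comm]

lemma hasFDerivAt_grad2g_right (hP : P.Regular c y₀) (x : E dx) (y : E dy) (η : H) (ξ : Ξ) :
    HasFDerivAt (fun y' => P.grad2g x y' η ξ) (sndL ∘L P.hessg η ξ (pair x y) ∘L inrL) y := by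
  simp_rw [hP.grad2g_eq]
  exact sndL.hasFDerivAt.comp y
    ((hP.hasFDerivAt_gradg η ξ (pair x y)).comp y (hasFDerivAt_pair_right x y))

lemma hess22g_eq (hP : P.Regular c y₀) (x : E dx) (y : E dy) (η : H) (ξ : Ξ) :
    P.hess22g x y η ξ = sndL ∘L P.hessg η ξ (pair x y) ∘L inrL :=
  (hP.hasFDerivAt_grad2g_right x y η ξ).fderiv

lemma hess12g_eq (hP : P.Regular c y₀) (x : E dx) (y : E dy) (η : H) (ξ : Ξ) :
    P.hess12g x y η ξ = fstL ∘L P.hessg η ξ (pair x y) ∘L inrL := by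
  unfold hess12g
  simp_rw [hP.grad1g_eq]
  exact (fstL.hasFDerivAt.comp y
    ((hP.hasFDerivAt_gradg η ξ (pair x y)).comp y (hasFDerivAt_pair_right x y))).fderiv

/-! Bounds and Lipschitz estimates -/

lemma norm_gradf_le (hP : P.Regular c y₀) (η : H) (ξ : Ξ) (z : XY dx dy) :
    ‖P.gradf η ξ z‖ ≤ c.Lf0 := by
  rw [gradf, gradient, LinearIsometryEquiv.norm_map]
  exact norm_fderiv_le_of_lipschitz ℝ (hP.f_lipschitz η ξ)

lemma norm_hessg_le (hP : P.Regular c y₀) (η : H) (ξ : Ξ) (z : XY dx dy) :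
    ‖P.hessg η ξ z‖ ≤ c.Lg1 :=
  norm_fderiv_le_of_lipschitz ℝ (hP.gradg_lipschitz η ξ)

lemma norm_grad1f_le (hP : P.Regular c y₀) (x : E dx) (y : E dy) (η : H) (ξ : Ξ) :
    ‖P.grad1f x y η ξ‖ ≤ c.Lf0 := by
  rw [hP.grad1f_eq]; exact (norm_fst_le _).trans (hP.norm_gradf_le _ _ _)

lemma norm_grad2f_le (hP : P.Regular c y₀) (x : E dx) (y : E dy) (η : H) (ξ : Ξ) :
    ‖P.grad2f x y η ξ‖ ≤ c.Lf0 := by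
  rw [hP.grad2f_eq]; exact (norm_snd_le _).trans (hP.norm_gradf_le _ _ _)

lemma norm_sub_pair_le (x x' : E dx) (y y' : E dy) :
    ‖pair x y - pair x' y'‖ ≤ ‖x - x'‖ + ‖y - y'‖ := by
  rw [pair_sub_pair]; exact norm_pair_le _ _

lemma norm_gradf_sub_le (hP : P.Regular c y₀) (x x' : E dx) (y y' : E dy) (η : H) (ξ : Ξ) :
    ‖P.gradf η ξ (pair x y) - P.gradf η ξ (pair x' y')‖ ≤ c.Lf1 * (‖x - x'‖ + ‖y - y'‖) :=
  ((hP.gradf_lipschitz η ξ).norm_sub_le _ _).trans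
    (mul_le_mul_of_nonneg_left (norm_sub_pair_le _ _ _ _) c.Lf1.2)

lemma norm_grad1f_sub_le (hP : P.Regular c y₀) (x x' : E dx) (y y' : E dy) (η : H) (ξ : Ξ) :
    ‖P.grad1f x y η ξ - P.grad1f x' y' η ξ‖ ≤ c.Lf1 * (‖x - x'‖ + ‖y - y'‖) := by
  rw [hP.grad1f_eq, hP.grad1f_eq]
  exact (norm_fst_le (P.gradf η ξ (pair x y) - P.gradf η ξ (pair x' y'))).trans
    (hP.norm_gradf_sub_le _ _ _ _ _ _)

lemma norm_grad2f_sub_le (hP : P.Regular c y₀) (x x' : E dx) (y y' : E dy) (η : H) (ξ : Ξ) :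
    ‖P.grad2f x y η ξ - P.grad2f x' y' η ξ‖ ≤ c.Lf1 * (‖x - x'‖ + ‖y - y'‖) := by
  rw [hP.grad2f_eq, hP.grad2f_eq]
  exact (norm_snd_le (P.gradf η ξ (pair x y) - P.gradf η ξ (pair x' y'))).trans
    (hP.norm_gradf_sub_le _ _ _ _ _ _)

lemma norm_grad2g_sub_le (hP : P.Regular c y₀) (x x' : E dx) (y y' : E dy) (η : H) (ξ : Ξ) :
    ‖P.grad2g x y η ξ - P.grad2g x' y' η ξ‖ ≤ c.Lg1 * (‖x - x'‖ + ‖y - y'‖) := by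
  rw [hP.grad2g_eq, hP.grad2g_eq]
  exact (norm_snd_le (P.gradg η ξ (pair x y) - P.gradg η ξ (pair x' y'))).trans
    (((hP.gradg_lipschitz η ξ).norm_sub_le _ _).trans
    (mul_le_mul_of_nonneg_left (norm_sub_pair_le _ _ _ _) c.Lg1.2))

/-- A block of an operator is no larger than the operator; this serves both ∇₂₂²g and ∇₁₂²g. -/
lemma norm_fst_snd_comp_le {V W : Type*} [NormedAddCommGroup V] [NormedSpace ℝ V]
    [NormedAddCommGroup W] [NormedSpace ℝ W] {a : XY dx dy →L[ℝ] W} {b : V →L[ℝ] XY dx dy}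
    (ha : ‖a‖ ≤ 1) (hb : ‖b‖ ≤ 1) (A : XY dx dy →L[ℝ] XY dx dy) : ‖a ∘L A ∘L b‖ ≤ ‖A‖ :=
  calc ‖a ∘L A ∘L b‖ ≤ ‖a‖ * (‖A‖ * ‖b‖) :=
        (ContinuousLinearMap.opNorm_comp_le _ _).trans
          (mul_le_mul_of_nonneg_left (ContinuousLinearMap.opNorm_comp_le _ _) (norm_nonneg _))
    _ ≤ 1 * (‖A‖ * 1) := by gcongr
    _ = ‖A‖ := by ring

lemma norm_hess22g_le (hP : P.Regular c y₀) (x : E dx) (y : E dy) (η : H) (ξ : Ξ) :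
    ‖P.hess22g x y η ξ‖ ≤ c.Lg1 := by
  rw [hP.hess22g_eq]
  exact (norm_fst_snd_comp_le norm_sndL_le norm_inrL_le _).trans (hP.norm_hessg_le _ _ _)

lemma norm_hess12g_le (hP : P.Regular c y₀) (x : E dx) (y : E dy) (η : H) (ξ : Ξ) :
    ‖P.hess12g x y η ξ‖ ≤ c.Lg1 := by
  rw [hP.hess12g_eq]
  exact (norm_fst_snd_comp_le norm_fstL_le norm_inrL_le _).trans (hP.norm_hessg_le _ _ _)

lemma norm_hessg_sub_le (hP : P.Regular c y₀) (x x' : E dx) (y y' : E dy) (η : H) (ξ : Ξ) :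
    ‖P.hessg η ξ (pair x y) - P.hessg η ξ (pair x' y')‖ ≤ c.Lg2 * (‖x - x'‖ + ‖y - y'‖) :=
  ((hP.hessg_lipschitz η ξ).norm_sub_le _ _).trans
    (mul_le_mul_of_nonneg_left (norm_sub_pair_le _ _ _ _) c.Lg2.2)

lemma norm_hess22g_sub_le (hP : P.Regular c y₀) (x x' : E dx) (y y' : E dy) (η : H) (ξ : Ξ) :
    ‖P.hess22g x y η ξ - P.hess22g x' y' η ξ‖ ≤ c.Lg2 * (‖x - x'‖ + ‖y - y'‖) := by
  rw [hP.hess22g_eq, hP.hess22g_eq]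
  have := norm_fst_snd_comp_le norm_sndL_le norm_inrL_le
    (P.hessg η ξ (pair x y) - P.hessg η ξ (pair x' y'))
  rw [ContinuousLinearMap.sub_comp, ContinuousLinearMap.comp_sub] at this
  exact this.trans (hP.norm_hessg_sub_le _ _ _ _ _ _)

lemma norm_hess12g_sub_le (hP : P.Regular c y₀) (x x' : E dx) (y y' : E dy) (η : H) (ξ : Ξ) :
    ‖P.hess12g x y η ξ - P.hess12g x' y' η ξ‖ ≤ c.Lg2 * (‖x - x'‖ + ‖y - y'‖) := by
  rw [hP.hess12g_eq, hP.hess12g_eq]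
  have := norm_fst_snd_comp_le norm_fstL_le norm_inrL_le
    (P.hessg η ξ (pair x y) - P.hessg η ξ (pair x' y'))
  rw [ContinuousLinearMap.sub_comp, ContinuousLinearMap.comp_sub] at this
  exact this.trans (hP.norm_hessg_sub_le _ _ _ _ _ _)

/-! Strong convexity -/

lemma grad2g_monotone (hP : P.Regular c y₀) (x : E dx) (y y' : E dy) (η : H) (ξ : Ξ) :
    c.μ * ‖y - y'‖ ^ 2 ≤ inner ℝ (P.grad2g x y η ξ - P.grad2g x y' η ξ) (y - y') := by
  have h1 := hP.g_strong x η ξ y y'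
  have h2 := hP.g_strong x η ξ y' y
  rw [norm_sub_rev, ← neg_sub y y', inner_neg_right] at h2
  rw [inner_sub_left]
  linarith

lemma hess22g_coercive (hP : P.Regular c y₀) (x : E dx) (y : E dy) (η : H) (ξ : Ξ) (v : E dy) :
    c.μ * ‖v‖ ^ 2 ≤ inner ℝ (P.hess22g x y η ξ v) v := by
  have h := (hP.hasFDerivAt_grad2g_right x y η ξ).lim_real v
  rw [← hP.hess22g_eq] at h
  -- Strong monotonicity passes to the limit of the difference quotients with increment v/t, t → ∞.
  refine ge_of_tendsto (h.inner tendsto_const_nhds) ?_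
  filter_upwards [Filter.eventually_gt_atTop (0 : ℝ)] with t ht
  have := hP.grad2g_monotone x (y + t⁻¹ • v) y η ξ
  rw [add_sub_cancel_left, norm_smul, inner_smul_right, Real.norm_of_nonneg (by positivity)] at this
  rw [inner_smul_left]
  simp only [conj_trivial]
  have h2 := mul_le_mul_of_nonneg_left this (sq_nonneg t)
  field_simp at h2 ⊢
  linarith

lemma hess22g_symm (hP : P.Regular c y₀) (x : E dx) (y : E dy) (η : H) (ξ : Ξ) (u v : E dy) :
    inner ℝ (P.hess22g x y η ξ u) v = inner ℝ u (P.hess22g x y η ξ v) := by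
  have := hP.hessg_symm η ξ (pair x y) (pair 0 u) (pair 0 v)
  rw [inner_eq, inner_eq] at this
  simpa [hP.hess22g_eq] using this

/-- The mixed derivative of `∇₂ g` in `x` is the adjoint of `∇₁₂² g`. -/
lemma inner_hess12g (hP : P.Regular c y₀) (x : E dx) (y : E dy) (η : H) (ξ : Ξ) (u : E dx)
    (v : E dy) :
    inner ℝ ((P.hessg η ξ (pair x y) (pair u 0)).snd) v = inner ℝ u (P.hess12g x y η ξ v) := by
  have := hP.hessg_symm η ξ (pair x y) (pair u 0) (pair 0 v)
  rw [inner_eq, inner_eq] at this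
  simpa [hP.hess12g_eq] using this

end Problem.Regular

/-! ### Coercive symmetric operators -/

section Operator

variable {V : Type*} [NormedAddCommGroup V] [InnerProductSpace ℝ V]

/-- Positivity of A tested at v - Av/L gives ⟨Av, v⟩ - (2/L)‖Av‖² + (1/L²)⟨A(Av), Av⟩ ≥ 0, and the
last term is at most ‖Av‖²/L. No spectral decomposition is needed. -/
lemma norm_sq_le_of_symm_of_coercive {A : V →L[ℝ] V} {L : ℝ} (hL : 0 < L)
    (hs : ∀ u v, inner ℝ (A u) v = inner ℝ u (A v)) (hp : ∀ v, 0 ≤ inner ℝ (A v) v)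
    (hA : ‖A‖ ≤ L) (v : V) : ‖A v‖ ^ 2 ≤ L * inner ℝ (A v) v := by
  have h := hp (v - (1 / L) • A v)
  have h2 : inner ℝ (A (A v)) (A v) ≤ L * ‖A v‖ ^ 2 := by
    calc inner ℝ (A (A v)) (A v) ≤ ‖A (A v)‖ * ‖A v‖ := real_inner_le_norm _ _
      _ ≤ (L * ‖A v‖) * ‖A v‖ := by gcongr; exact A.le_of_opNorm_le hA _
      _ = L * ‖A v‖ ^ 2 := by ring
  have h3 : inner ℝ (A (A v)) v = ‖A v‖ ^ 2 := by
    rw [hs, real_inner_self_eq_norm_sq]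
  simp only [map_sub, map_smul, inner_sub_left, inner_sub_right, inner_smul_left,
    inner_smul_right, conj_trivial, real_inner_self_eq_norm_sq, h3] at h
  have h4 : 1 / L * (1 / L * inner ℝ (A (A v)) (A v)) ≤ 1 / L * ‖A v‖ ^ 2 := by
    calc 1 / L * (1 / L * inner ℝ (A (A v)) (A v)) ≤ 1 / L * (1 / L * (L * ‖A v‖ ^ 2)) := by gcongr
      _ = 1 / L * ‖A v‖ ^ 2 := by field_simp
  have h5 : 1 / L * ‖A v‖ ^ 2 ≤ inner ℝ (A v) v := by linarith
  calc ‖A v‖ ^ 2 = L * (1 / L * ‖A v‖ ^ 2) := by field_simp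
    _ ≤ _ := by gcongr

/-- `I - A / (2L)` is a contraction if `A` is symmetric, `A ≥ μ` and `‖A‖ ≤ L`. -/
lemma norm_sub_smul_apply_le {A : V →L[ℝ] V} {L μ : ℝ} (hL : 0 < L) (hμ : 0 < μ)
    (hs : ∀ u v, inner ℝ (A u) v = inner ℝ u (A v)) (hp : ∀ v, μ * ‖v‖ ^ 2 ≤ inner ℝ (A v) v)
    (hA : ‖A‖ ≤ L) (v : V) :
    ‖v - (1 / (2 * L)) • A v‖ ≤ √(1 - min μ L / (2 * L)) * ‖v‖ := by
  have h1 := norm_sq_le_of_symm_of_coercive hL hs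
    (fun v => (by positivity : 0 ≤ μ * ‖v‖ ^ 2).trans (hp v)) hA v
  have h2 := hp v
  -- μ ≤ L may fail on the zero space; the minimum keeps the radicand nonnegative in every case.
  have hm : min μ L * ‖v‖ ^ 2 ≤ inner ℝ (A v) v :=
    (mul_le_mul_of_nonneg_right (min_le_left _ _) (sq_nonneg _)).trans h2
  have hnn : 0 ≤ 1 - min μ L / (2 * L) := by
    rw [sub_nonneg, div_le_one (by positivity)]
    linarith [min_le_right μ L]
  refine abs_le_of_sq_le_sq' ?_ (by positivity) |>.2
  rw [mul_pow, Real.sq_sqrt hnn, norm_sub_sq_real, inner_smul_right, norm_smul,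
    Real.norm_of_nonneg (by positivity), real_inner_comm, mul_pow]
  have h3 : (1 / (2 * L)) ^ 2 * ‖A v‖ ^ 2 ≤ (1 / (2 * L)) ^ 2 * (L * inner ℝ (A v) v) := by gcongr
  have h4 : (1 / (2 * L)) ^ 2 * (L * inner ℝ (A v) v) = inner ℝ (A v) v / (4 * L) := by
    field_simp; ring
  have h5 : min μ L / (2 * L) * ‖v‖ ^ 2 ≤ inner ℝ (A v) v / (2 * L) := by
    rw [div_mul_eq_mul_div]; gcongr
  have h6 : 2 * (1 / (2 * L) * inner ℝ (A v) v) = 2 * (inner ℝ (A v) v / (2 * L)) := by ring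
  have h7 : inner ℝ (A v) v / (4 * L) = (inner ℝ (A v) v / (2 * L)) / 2 := by field_simp; norm_num
  have h8 : 0 ≤ inner ℝ (A v) v / (2 * L) := by
    apply div_nonneg _ (by positivity)
    exact (by positivity : 0 ≤ μ * ‖v‖ ^ 2).trans h2
  nlinarith

lemma norm_le_of_coercive {A : V →L[ℝ] V} {μ : ℝ}
    (hp : ∀ v, μ * ‖v‖ ^ 2 ≤ inner ℝ (A v) v) (v : V) : μ * ‖v‖ ≤ ‖A v‖ := by
  rcases eq_or_ne v 0 with rfl | hv
  · simp
  · have h := (hp v).trans (real_inner_le_norm _ _)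
    rw [pow_two, ← mul_assoc] at h
    exact le_of_mul_le_mul_right h (norm_pos_iff.mpr hv)

end Operator

end CSBO
end

noncomputable section

namespace CSBO

lemma norm_integral_sub_integral_le {Ω V : Type*} [MeasurableSpace Ω] [NormedAddCommGroup V]
    [NormedSpace ℝ V] {ν : Measure Ω} [IsProbabilityMeasure ν] {u v : Ω → V} {C : ℝ}
    (hu : Integrable u ν) (hv : Integrable v ν) (h : ∀ ω, ‖u ω - v ω‖ ≤ C) :
    ‖∫ ω, u ω ∂ν - ∫ ω, v ω ∂ν‖ ≤ C := by
  rw [← integral_sub hu hv]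
  simpa using norm_integral_le_of_norm_le_const (μ := ν) (ae_of_all _ h)

lemma norm_integral_le_of_forall {Ω V : Type*} [MeasurableSpace Ω] [NormedAddCommGroup V]
    [NormedSpace ℝ V] {ν : Measure Ω} [IsProbabilityMeasure ν] {u : Ω → V} {C : ℝ}
    (h : ∀ ω, ‖u ω‖ ≤ C) : ‖∫ ω, u ω ∂ν‖ ≤ C := by
  simpa using norm_integral_le_of_norm_le_const (μ := ν) (ae_of_all _ h)

/-! ### Conditional means given `ξ` -/

namespace Problem

variable {dx dy : ℕ} {Ξ H : Type*} [MeasurableSpace Ξ] [MeasurableSpace H]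

/-- Conditional means given `ξ` of the partial derivatives of `f` and `g`. -/
def mean1f (P : Problem dx dy Ξ H) (x : E dx) (y : E dy) (ξ : Ξ) : E dx :=
  ∫ η, P.grad1f x y η ξ ∂P.lawEta ξ
def mean2f (P : Problem dx dy Ξ H) (x : E dx) (y : E dy) (ξ : Ξ) : E dy :=
  ∫ η, P.grad2f x y η ξ ∂P.lawEta ξ
def mean2g (P : Problem dx dy Ξ H) (x : E dx) (y : E dy) (ξ : Ξ) : E dy :=
  ∫ η, P.grad2g x y η ξ ∂P.lawEta ξ
def mean22g (P : Problem dx dy Ξ H) (x : E dx) (y : E dy) (ξ : Ξ) : E dy →L[ℝ] E dy :=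
  ∫ η, P.hess22g x y η ξ ∂P.lawEta ξ
def mean12g (P : Problem dx dy Ξ H) (x : E dx) (y : E dy) (ξ : Ξ) : E dy →L[ℝ] E dx :=
  ∫ η, P.hess12g x y η ξ ∂P.lawEta ξ

namespace Regular

variable {P : Problem dx dy Ξ H} {c : Constants} {y₀ : E dx → E dy}

open XY

/-! Measurability in `(ξ, η)` -/

lemma stronglyMeasurable_gradf (hP : P.Regular c y₀) (z : XY dx dy) :
    StronglyMeasurable fun p : Ξ × H => P.gradf p.2 p.1 z :=
  (InnerProductSpace.toDual ℝ (XY dx dy)).symm.continuous.comp_stronglyMeasurable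
    (stronglyMeasurable_fderiv_param (φ := fun p : Ξ × H => P.fz p.2 p.1)
      (fun z => (hP.f_measurable z.fst z.snd).stronglyMeasurable)
      fun p => (hP.f_contDiff p.2 p.1).differentiable one_ne_zero z)

lemma stronglyMeasurable_gradg (hP : P.Regular c y₀) (z : XY dx dy) :
    StronglyMeasurable fun p : Ξ × H => P.gradg p.2 p.1 z :=
  (InnerProductSpace.toDual ℝ (XY dx dy)).symm.continuous.comp_stronglyMeasurable
    (stronglyMeasurable_fderiv_param (φ := fun p : Ξ × H => P.gz p.2 p.1)
      (fun z => (hP.g_measurable z.fst z.snd).stronglyMeasurable)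
      fun p => (hP.g_contDiff p.2 p.1).differentiable two_ne_zero z)

lemma stronglyMeasurable_hessg (hP : P.Regular c y₀) (z : XY dx dy) :
    StronglyMeasurable fun p : Ξ × H => P.hessg p.2 p.1 z :=
  stronglyMeasurable_fderiv_param (φ := fun p : Ξ × H => P.gradg p.2 p.1)
    hP.stronglyMeasurable_gradg fun p => (hP.hasFDerivAt_gradg p.2 p.1 z).differentiableAt

lemma stronglyMeasurable_grad1f (hP : P.Regular c y₀) (x : E dx) (y : E dy) :
    StronglyMeasurable fun p : Ξ × H => P.grad1f x y p.2 p.1 := by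
  simp_rw [hP.grad1f_eq]
  exact fstL.continuous.comp_stronglyMeasurable (hP.stronglyMeasurable_gradf _)

lemma stronglyMeasurable_grad2f (hP : P.Regular c y₀) (x : E dx) (y : E dy) :
    StronglyMeasurable fun p : Ξ × H => P.grad2f x y p.2 p.1 := by
  simp_rw [hP.grad2f_eq]
  exact sndL.continuous.comp_stronglyMeasurable (hP.stronglyMeasurable_gradf _)

lemma stronglyMeasurable_grad2g (hP : P.Regular c y₀) (x : E dx) (y : E dy) :
    StronglyMeasurable fun p : Ξ × H => P.grad2g x y p.2 p.1 := by
  simp_rw [hP.grad2g_eq]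
  exact sndL.continuous.comp_stronglyMeasurable (hP.stronglyMeasurable_gradg _)

lemma stronglyMeasurable_hess22g (hP : P.Regular c y₀) (x : E dx) (y : E dy) :
    StronglyMeasurable fun p : Ξ × H => P.hess22g x y p.2 p.1 := by
  simp_rw [hP.hess22g_eq]
  exact (by fun_prop : Continuous fun A : XY dx dy →L[ℝ] XY dx dy =>
    (sndL : XY dx dy →L[ℝ] E dy) ∘L A ∘L inrL).comp_stronglyMeasurable
      (hP.stronglyMeasurable_hessg _)

lemma stronglyMeasurable_hess12g (hP : P.Regular c y₀) (x : E dx) (y : E dy) :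
    StronglyMeasurable fun p : Ξ × H => P.hess12g x y p.2 p.1 := by
  simp_rw [hP.hess12g_eq]
  exact (by fun_prop : Continuous fun A : XY dx dy →L[ℝ] XY dx dy =>
    (fstL : XY dx dy →L[ℝ] E dx) ∘L A ∘L inrL).comp_stronglyMeasurable
      (hP.stronglyMeasurable_hessg _)

/-! Continuity in `(x, y)` and joint measurability -/

lemma continuous_grad1f (hP : P.Regular c y₀) (η : H) (ξ : Ξ) :
    Continuous fun q : E dx × E dy => P.grad1f q.1 q.2 η ξ := by
  simp_rw [hP.grad1f_eq]
  exact fstL.continuous.comp ((hP.gradf_lipschitz η ξ).continuous.comp continuous_pair)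

lemma continuous_grad2f (hP : P.Regular c y₀) (η : H) (ξ : Ξ) :
    Continuous fun q : E dx × E dy => P.grad2f q.1 q.2 η ξ := by
  simp_rw [hP.grad2f_eq]
  exact sndL.continuous.comp ((hP.gradf_lipschitz η ξ).continuous.comp continuous_pair)

lemma continuous_grad2g (hP : P.Regular c y₀) (η : H) (ξ : Ξ) :
    Continuous fun q : E dx × E dy => P.grad2g q.1 q.2 η ξ := by
  simp_rw [hP.grad2g_eq]
  exact sndL.continuous.comp ((hP.gradg_lipschitz η ξ).continuous.comp continuous_pair)

lemma continuous_hess22g (hP : P.Regular c y₀) (η : H) (ξ : Ξ) :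
    Continuous fun q : E dx × E dy => P.hess22g q.1 q.2 η ξ := by
  simp_rw [hP.hess22g_eq]
  exact (by fun_prop : Continuous fun A : XY dx dy →L[ℝ] XY dx dy =>
    (sndL : XY dx dy →L[ℝ] E dy) ∘L A ∘L inrL).comp
      ((hP.hessg_lipschitz η ξ).continuous.comp continuous_pair)

lemma continuous_hess12g (hP : P.Regular c y₀) (η : H) (ξ : Ξ) :
    Continuous fun q : E dx × E dy => P.hess12g q.1 q.2 η ξ := by
  simp_rw [hP.hess12g_eq]
  exact (by fun_prop : Continuous fun A : XY dx dy →L[ℝ] XY dx dy =>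
    (fstL : XY dx dy →L[ℝ] E dx) ∘L A ∘L inrL).comp
      ((hP.hessg_lipschitz η ξ).continuous.comp continuous_pair)

/-- Carathéodory functions, continuous in (x, y) and measurable in (ξ, η), are jointly measurable.
The joint form is needed because random iterates are substituted for (x, y). -/
lemma measurable_grad1f (hP : P.Regular c y₀) :
    Measurable fun q : (E dx × E dy) × (Ξ × H) => P.grad1f q.1.1 q.1.2 q.2.2 q.2.1 :=
  (stronglyMeasurable_uncurry_of_continuous_of_stronglyMeasurable
    (u := fun (q : E dx × E dy) (p : Ξ × H) => P.grad1f q.1 q.2 p.2 p.1)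
    (fun p => hP.continuous_grad1f p.2 p.1)
    fun q => hP.stronglyMeasurable_grad1f q.1 q.2).measurable

lemma measurable_grad2f (hP : P.Regular c y₀) :
    Measurable fun q : (E dx × E dy) × (Ξ × H) => P.grad2f q.1.1 q.1.2 q.2.2 q.2.1 :=
  (stronglyMeasurable_uncurry_of_continuous_of_stronglyMeasurable
    (u := fun (q : E dx × E dy) (p : Ξ × H) => P.grad2f q.1 q.2 p.2 p.1)
    (fun p => hP.continuous_grad2f p.2 p.1)
    fun q => hP.stronglyMeasurable_grad2f q.1 q.2).measurable

lemma measurable_grad2g (hP : P.Regular c y₀) :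
    Measurable fun q : (E dx × E dy) × (Ξ × H) => P.grad2g q.1.1 q.1.2 q.2.2 q.2.1 :=
  (stronglyMeasurable_uncurry_of_continuous_of_stronglyMeasurable
    (u := fun (q : E dx × E dy) (p : Ξ × H) => P.grad2g q.1 q.2 p.2 p.1)
    (fun p => hP.continuous_grad2g p.2 p.1)
    fun q => hP.stronglyMeasurable_grad2g q.1 q.2).measurable

lemma measurable_hess22g_apply (hP : P.Regular c y₀) :
    Measurable fun q : ((E dx × E dy) × E dy) × (Ξ × H) =>
      P.hess22g q.1.1.1 q.1.1.2 q.2.2 q.2.1 q.1.2 :=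
  (stronglyMeasurable_uncurry_of_continuous_of_stronglyMeasurable
    (u := fun (q : (E dx × E dy) × E dy) (p : Ξ × H) => P.hess22g q.1.1 q.1.2 p.2 p.1 q.2)
    (fun p => ((hP.continuous_hess22g p.2 p.1).comp continuous_fst).clm_apply continuous_snd)
    fun q => (ContinuousLinearMap.apply ℝ (E dy) q.2).continuous.comp_stronglyMeasurable
      (hP.stronglyMeasurable_hess22g q.1.1 q.1.2)).measurable

lemma measurable_hess12g_apply (hP : P.Regular c y₀) :
    Measurable fun q : ((E dx × E dy) × E dy) × (Ξ × H) =>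
      P.hess12g q.1.1.1 q.1.1.2 q.2.2 q.2.1 q.1.2 :=
  (stronglyMeasurable_uncurry_of_continuous_of_stronglyMeasurable
    (u := fun (q : (E dx × E dy) × E dy) (p : Ξ × H) => P.hess12g q.1.1 q.1.2 p.2 p.1 q.2)
    (fun p => ((hP.continuous_hess12g p.2 p.1).comp continuous_fst).clm_apply continuous_snd)
    fun q => (ContinuousLinearMap.apply ℝ (E dx) q.2).continuous.comp_stronglyMeasurable
      (hP.stronglyMeasurable_hess12g q.1.1 q.1.2)).measurable

/-! Integrability under the conditional law -/

lemma integrable_of_bound_param {V : Type*} [NormedAddCommGroup V] {u : Ξ × H → V} {C : ℝ}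
    (hu : StronglyMeasurable u) (hC : ∀ p, ‖u p‖ ≤ C) (ξ : Ξ) :
    Integrable (fun η => u (ξ, η)) (P.lawEta ξ) :=
  Integrable.of_bound (hu.comp_measurable measurable_prodMk_left).aestronglyMeasurable C
    (ae_of_all _ fun η => hC (ξ, η))

lemma integrable_grad1f (hP : P.Regular c y₀) (x : E dx) (y : E dy) (ξ : Ξ) :
    Integrable (fun η => P.grad1f x y η ξ) (P.lawEta ξ) :=
  integrable_of_bound_param (hP.stronglyMeasurable_grad1f x y)
    (fun p => hP.norm_grad1f_le x y p.2 p.1) ξ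

lemma integrable_grad2f (hP : P.Regular c y₀) (x : E dx) (y : E dy) (ξ : Ξ) :
    Integrable (fun η => P.grad2f x y η ξ) (P.lawEta ξ) :=
  integrable_of_bound_param (hP.stronglyMeasurable_grad2f x y)
    (fun p => hP.norm_grad2f_le x y p.2 p.1) ξ

lemma integrable_hessg (hP : P.Regular c y₀) (z : XY dx dy) (ξ : Ξ) :
    Integrable (fun η => P.hessg η ξ z) (P.lawEta ξ) :=
  integrable_of_bound_param (hP.stronglyMeasurable_hessg z)
    (fun p => hP.norm_hessg_le p.2 p.1 z) ξ

lemma integrable_hess22g (hP : P.Regular c y₀) (x : E dx) (y : E dy) (ξ : Ξ) :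
    Integrable (fun η => P.hess22g x y η ξ) (P.lawEta ξ) :=
  integrable_of_bound_param (hP.stronglyMeasurable_hess22g x y)
    (fun p => hP.norm_hess22g_le x y p.2 p.1) ξ

lemma integrable_hess12g (hP : P.Regular c y₀) (x : E dx) (y : E dy) (ξ : Ξ) :
    Integrable (fun η => P.hess12g x y η ξ) (P.lawEta ξ) :=
  integrable_of_bound_param (hP.stronglyMeasurable_hess12g x y)
    (fun p => hP.norm_hess12g_le x y p.2 p.1) ξ

/-- The gradient of g is unbounded, but finite variance puts the centred gradient in L², hence in
L¹. -/
lemma integrable_gradg (hP : P.Regular c y₀) (z : XY dx dy) (ξ : Ξ) :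
    Integrable (fun η => P.gradg η ξ z) (P.lawEta ξ) := by
  have hm : AEStronglyMeasurable (fun η => P.gradg η ξ z - gradient (P.meang ξ) z) (P.lawEta ξ) :=
    (((hP.stronglyMeasurable_gradg z).comp_measurable
      (measurable_prodMk_left (x := ξ))).sub stronglyMeasurable_const).aestronglyMeasurable
  have h : MemLp (fun η => P.gradg η ξ z - gradient (P.meang ξ) z) 2 (P.lawEta ξ) := by
    refine ⟨hm, ?_⟩
    rw [eLpNorm_lt_top_iff_lintegral_rpow_enorm_lt_top two_ne_zero ENNReal.ofNat_ne_top]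
    simpa using (hP.gradg_variance z ξ).trans_lt (by simp)
  have := (h.integrable one_le_two).add (integrable_const (gradient (P.meang ξ) z))
  exact this.congr (ae_of_all _ fun η => by simp)

lemma integrable_grad2g (hP : P.Regular c y₀) (x : E dx) (y : E dy) (ξ : Ξ) :
    Integrable (fun η => P.grad2g x y η ξ) (P.lawEta ξ) := by
  simp_rw [hP.grad2g_eq]
  exact sndL.integrable_comp (hP.integrable_gradg _ ξ)

/-- Unbiasedness identifies the y-part of the centre in the variance bound with `mean2g`, and
projecting to y does not increase norms. -/
lemma variance_grad2g_le (hP : P.Regular c y₀) (x : E dx) (y : E dy) (ξ : Ξ) :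
    ∫⁻ η, ‖P.grad2g x y η ξ - P.mean2g x y ξ‖ₑ ^ 2 ∂P.lawEta ξ ≤ (c.σg : ℝ≥0∞) ^ 2 := by
  refine le_trans (lintegral_mono fun η => ?_) (hP.gradg_variance (pair x y) ξ)
  have h1 : P.mean2g x y ξ = sndL (gradient (P.meang ξ) (pair x y)) := by
    rw [← hP.gradg_unbiased, ← sndL.integral_comp_comm (hP.integrable_gradg _ ξ)]
    simp only [mean2g, hP.grad2g_eq, sndL_apply]
  rw [h1, hP.grad2g_eq, ← sndL_apply, ← map_sub]
  gcongr
  exact enorm_le_iff_norm_le.mpr (norm_snd_le _)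

/-! Bounds on the conditional means -/

lemma norm_mean2f_le (hP : P.Regular c y₀) (x : E dx) (y : E dy) (ξ : Ξ) :
    ‖P.mean2f x y ξ‖ ≤ c.Lf0 :=
  norm_integral_le_of_forall fun η => hP.norm_grad2f_le x y η ξ

lemma norm_mean22g_le (hP : P.Regular c y₀) (x : E dx) (y : E dy) (ξ : Ξ) :
    ‖P.mean22g x y ξ‖ ≤ c.Lg1 :=
  norm_integral_le_of_forall fun η => hP.norm_hess22g_le x y η ξ

lemma norm_mean12g_le (hP : P.Regular c y₀) (x : E dx) (y : E dy) (ξ : Ξ) :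
    ‖P.mean12g x y ξ‖ ≤ c.Lg1 :=
  norm_integral_le_of_forall fun η => hP.norm_hess12g_le x y η ξ

lemma norm_mean1f_sub_le (hP : P.Regular c y₀) (x x' : E dx) (y y' : E dy) (ξ : Ξ) :
    ‖P.mean1f x y ξ - P.mean1f x' y' ξ‖ ≤ c.Lf1 * (‖x - x'‖ + ‖y - y'‖) :=
  norm_integral_sub_integral_le (hP.integrable_grad1f _ _ _) (hP.integrable_grad1f _ _ _)
    fun η => hP.norm_grad1f_sub_le x x' y y' η ξ

lemma norm_mean2f_sub_le (hP : P.Regular c y₀) (x x' : E dx) (y y' : E dy) (ξ : Ξ) :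
    ‖P.mean2f x y ξ - P.mean2f x' y' ξ‖ ≤ c.Lf1 * (‖x - x'‖ + ‖y - y'‖) :=
  norm_integral_sub_integral_le (hP.integrable_grad2f _ _ _) (hP.integrable_grad2f _ _ _)
    fun η => hP.norm_grad2f_sub_le x x' y y' η ξ

lemma norm_mean2g_sub_le (hP : P.Regular c y₀) (x x' : E dx) (y y' : E dy) (ξ : Ξ) :
    ‖P.mean2g x y ξ - P.mean2g x' y' ξ‖ ≤ c.Lg1 * (‖x - x'‖ + ‖y - y'‖) :=
  norm_integral_sub_integral_le (hP.integrable_grad2g _ _ _) (hP.integrable_grad2g _ _ _)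
    fun η => hP.norm_grad2g_sub_le x x' y y' η ξ

lemma norm_mean22g_sub_le (hP : P.Regular c y₀) (x x' : E dx) (y y' : E dy) (ξ : Ξ) :
    ‖P.mean22g x y ξ - P.mean22g x' y' ξ‖ ≤ c.Lg2 * (‖x - x'‖ + ‖y - y'‖) :=
  norm_integral_sub_integral_le (hP.integrable_hess22g _ _ _) (hP.integrable_hess22g _ _ _)
    fun η => hP.norm_hess22g_sub_le x x' y y' η ξ

lemma norm_mean12g_sub_le (hP : P.Regular c y₀) (x x' : E dx) (y y' : E dy) (ξ : Ξ) :
    ‖P.mean12g x y ξ - P.mean12g x' y' ξ‖ ≤ c.Lg2 * (‖x - x'‖ + ‖y - y'‖) :=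
  norm_integral_sub_integral_le (hP.integrable_hess12g _ _ _) (hP.integrable_hess12g _ _ _)
    fun η => hP.norm_hess12g_sub_le x x' y y' η ξ

lemma mean22g_apply (hP : P.Regular c y₀) (x : E dx) (y : E dy) (ξ : Ξ) (v : E dy) :
    P.mean22g x y ξ v = ∫ η, P.hess22g x y η ξ v ∂P.lawEta ξ :=
  ContinuousLinearMap.integral_apply (hP.integrable_hess22g x y ξ) v

lemma mean12g_apply (hP : P.Regular c y₀) (x : E dx) (y : E dy) (ξ : Ξ) (v : E dy) :
    P.mean12g x y ξ v = ∫ η, P.hess12g x y η ξ v ∂P.lawEta ξ :=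
  ContinuousLinearMap.integral_apply (hP.integrable_hess12g x y ξ) v

lemma integral_inner_right {Ω V : Type*} [MeasurableSpace Ω] [NormedAddCommGroup V]
    [InnerProductSpace ℝ V] [CompleteSpace V] {ν : Measure Ω} {u : Ω → V} (hu : Integrable u ν)
    (v : V) : inner ℝ (∫ ω, u ω ∂ν) v = ∫ ω, inner ℝ (u ω) v ∂ν := by
  rw [real_inner_comm, ← integral_inner hu]
  simp_rw [real_inner_comm]

lemma mean22g_symm (hP : P.Regular c y₀) (x : E dx) (y : E dy) (ξ : Ξ) (u v : E dy) :
    inner ℝ (P.mean22g x y ξ u) v = inner ℝ u (P.mean22g x y ξ v) := by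
  rw [hP.mean22g_apply, hP.mean22g_apply,
    integral_inner_right ((hP.integrable_hess22g x y ξ).apply_continuousLinearMap u),
    ← integral_inner ((hP.integrable_hess22g x y ξ).apply_continuousLinearMap v)]
  simp_rw [hP.hess22g_symm]

lemma mean22g_coercive (hP : P.Regular c y₀) (x : E dx) (y : E dy) (ξ : Ξ) (v : E dy) :
    c.μ * ‖v‖ ^ 2 ≤ inner ℝ (P.mean22g x y ξ v) v := by
  have hi := (hP.integrable_hess22g x y ξ).apply_continuousLinearMap v
  rw [hP.mean22g_apply, integral_inner_right hi]
  have := integral_mono (μ := P.lawEta ξ) (integrable_const (c.μ * ‖v‖ ^ 2))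
    (hi.inner_const v) fun η => hP.hess22g_coercive x y η ξ v
  simpa using this

lemma mean2g_monotone (hP : P.Regular c y₀) (x : E dx) (y y' : E dy) (ξ : Ξ) :
    c.μ * ‖y - y'‖ ^ 2 ≤ inner ℝ (P.mean2g x y ξ - P.mean2g x y' ξ) (y - y') := by
  have hi : Integrable (fun η => P.grad2g x y η ξ - P.grad2g x y' η ξ) (P.lawEta ξ) :=
    (hP.integrable_grad2g x y ξ).sub (hP.integrable_grad2g x y' ξ)
  rw [mean2g, mean2g, ← integral_sub (hP.integrable_grad2g x y ξ) (hP.integrable_grad2g x y' ξ),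
    integral_inner_right hi]
  have := integral_mono (μ := P.lawEta ξ) (integrable_const (c.μ * ‖y - y'‖ ^ 2))
    (hi.inner_const (y - y')) fun η => hP.grad2g_monotone x y y' η ξ
  simpa using this

end Regular

end Problem

end CSBO
end

noncomputable section

namespace CSBO

/-! ### Inverses of coercive operators -/

section Inverse

variable {V : Type*} [NormedAddCommGroup V] [InnerProductSpace ℝ V]

lemma isUnit_of_coercive [FiniteDimensional ℝ V] {A : V →L[ℝ] V} {μ : ℝ} (hμ : 0 < μ)
    (hp : ∀ v, μ * ‖v‖ ^ 2 ≤ inner ℝ (A v) v) : IsUnit A := by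
  have := FiniteDimensional.complete ℝ V
  rw [ContinuousLinearMap.isUnit_iff_bijective]
  have hinj : Function.Injective A := by
    rw [injective_iff_map_eq_zero]
    intro v hv
    have := norm_le_of_coercive hp v
    rw [hv, norm_zero] at this
    exact norm_le_zero_iff.mp (nonpos_of_mul_nonpos_right this hμ)
  exact ⟨hinj, (LinearMap.injective_iff_surjective (f := (A : V →ₗ[ℝ] V))).mp hinj⟩

lemma norm_inverse_le_of_coercive [FiniteDimensional ℝ V] {A : V →L[ℝ] V} {μ : ℝ} (hμ : 0 < μ)
    (hp : ∀ v, μ * ‖v‖ ^ 2 ≤ inner ℝ (A v) v) : ‖Ring.inverse A‖ ≤ 1 / μ := by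
  refine ContinuousLinearMap.opNorm_le_bound _ (by positivity) fun v => ?_
  have h := norm_le_of_coercive hp (Ring.inverse A v)
  have h1 : A (Ring.inverse A v) = v :=
    congrArg (fun T : V →L[ℝ] V => T v) (Ring.mul_inverse_cancel A (isUnit_of_coercive hμ hp))
  rw [h1] at h
  rw [div_mul_eq_mul_div, one_mul, le_div_iff₀ hμ]
  linarith

/-- Resolvent identity A⁻¹ - B⁻¹ = A⁻¹(B - A)B⁻¹. -/
lemma norm_inverse_sub_inverse_le [FiniteDimensional ℝ V] {A B : V →L[ℝ] V} {μ : ℝ} (hμ : 0 < μ)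
    (hA : ∀ v, μ * ‖v‖ ^ 2 ≤ inner ℝ (A v) v) (hB : ∀ v, μ * ‖v‖ ^ 2 ≤ inner ℝ (B v) v) :
    ‖Ring.inverse A - Ring.inverse B‖ ≤ 1 / μ * ‖A - B‖ * (1 / μ) := by
  have h : Ring.inverse A - Ring.inverse B = Ring.inverse A * (B - A) * Ring.inverse B := by
    rw [mul_sub, sub_mul, mul_assoc, Ring.mul_inverse_cancel B (isUnit_of_coercive hμ hB),
      Ring.inverse_mul_cancel A (isUnit_of_coercive hμ hA), mul_one, one_mul]
  rw [h]
  calc _ ≤ ‖Ring.inverse A‖ * ‖B - A‖ * ‖Ring.inverse B‖ :=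
        (norm_mul_le _ _).trans (mul_le_mul_of_nonneg_right (norm_mul_le _ _) (norm_nonneg _))
    _ ≤ _ := by
      rw [norm_sub_rev B A]
      gcongr
      · exact norm_inverse_le_of_coercive hμ hA
      · exact norm_inverse_le_of_coercive hμ hB

lemma inverse_symm [FiniteDimensional ℝ V] {A : V →L[ℝ] V} {μ : ℝ} (hμ : 0 < μ)
    (hp : ∀ v, μ * ‖v‖ ^ 2 ≤ inner ℝ (A v) v)
    (hs : ∀ u v, inner ℝ (A u) v = inner ℝ u (A v)) (u v : V) :
    inner ℝ (Ring.inverse A u) v = inner ℝ u (Ring.inverse A v) := by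
  have h1 : ∀ v, A (Ring.inverse A v) = v := fun v =>
    congrArg (fun T : V →L[ℝ] V => T v) (Ring.mul_inverse_cancel A (isUnit_of_coercive hμ hp))
  calc inner ℝ (Ring.inverse A u) v = inner ℝ (Ring.inverse A u) (A (Ring.inverse A v)) := by
        rw [h1]
    _ = inner ℝ u (Ring.inverse A v) := by rw [← hs, h1]

/-- A contraction obtained from a gradient step for a strongly monotone Lipschitz map. -/
lemma contractingWith_gradient_step {p : V → V} {μ L : ℝ} (hμ : 0 < μ) (hL : 0 < L)
    (hm : ∀ y y', μ * ‖y - y'‖ ^ 2 ≤ inner ℝ (p y - p y') (y - y'))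
    (hl : ∀ y y', ‖p y - p y'‖ ≤ L * ‖y - y'‖) :
    ContractingWith (Real.toNNReal √(max 0 (1 - μ ^ 2 / L ^ 2)))
      fun y => y - (μ / L ^ 2) • p y := by
  -- The stepsize μ/L² minimizes 1 - 2bμ + b²L², with value 1 - μ²/L². The maximum with 0 covers μ >
  -- L, which is possible only on the zero space.
  constructor
  · rw [← NNReal.coe_lt_coe, Real.coe_toNNReal _ (Real.sqrt_nonneg _), NNReal.coe_one,
      Real.sqrt_lt' one_pos, one_pow]
    exact max_lt one_pos (by linarith [show 0 < μ ^ 2 / L ^ 2 by positivity])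
  · refine LipschitzWith.of_dist_le_mul fun y y' => ?_
    rw [Real.coe_toNNReal _ (Real.sqrt_nonneg _), dist_eq_norm, dist_eq_norm]
    refine abs_le_of_sq_le_sq' ?_ (by positivity) |>.2
    rw [mul_pow, Real.sq_sqrt (le_max_left _ _)]
    have h0 : y - (μ / L ^ 2) • p y - (y' - (μ / L ^ 2) • p y') =
        (y - y') - (μ / L ^ 2) • (p y - p y') := by rw [smul_sub]; abel
    have hsq : ‖p y - p y'‖ ^ 2 ≤ L ^ 2 * ‖y - y'‖ ^ 2 := by
      rw [← mul_pow]; gcongr; exact hl y y'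
    rw [h0, norm_sub_sq_real, inner_smul_right, real_inner_comm, norm_smul, mul_pow,
      Real.norm_of_nonneg (by positivity)]
    have e1 : μ / L ^ 2 * (μ * ‖y - y'‖ ^ 2) ≤ μ / L ^ 2 * inner ℝ (p y - p y') (y - y') := by
      gcongr; exact hm y y'
    have e2 : (μ / L ^ 2) ^ 2 * ‖p y - p y'‖ ^ 2 ≤ (μ / L ^ 2) ^ 2 * (L ^ 2 * ‖y - y'‖ ^ 2) := by
      gcongr
    have e3 : (μ / L ^ 2) ^ 2 * (L ^ 2 * ‖y - y'‖ ^ 2) = μ ^ 2 / L ^ 2 * ‖y - y'‖ ^ 2 := by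
      field_simp
    have e4 : μ / L ^ 2 * (μ * ‖y - y'‖ ^ 2) = μ ^ 2 / L ^ 2 * ‖y - y'‖ ^ 2 := by ring
    have e5 : (1 - μ ^ 2 / L ^ 2) * ‖y - y'‖ ^ 2 ≤
        max 0 (1 - μ ^ 2 / L ^ 2) * ‖y - y'‖ ^ 2 := by gcongr; exact le_max_right _ _
    linarith

end Inverse

namespace Problem.Regular

variable {dx dy : ℕ} {Ξ H : Type*} [MeasurableSpace Ξ] [MeasurableSpace H]
  {P : Problem dx dy Ξ H} {c : Constants} {y₀ : E dx → E dy}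

open XY

/-! ### The lower-level solution -/

lemma Lg1_pos' (c : Constants) : (0 : ℝ) < c.Lg1 := c.Lg1_pos

lemma contracting_step (hP : P.Regular c y₀) (x : E dx) (ξ : Ξ) :
    ContractingWith (Real.toNNReal √(max 0 (1 - c.μ ^ 2 / (c.Lg1 : ℝ) ^ 2)))
      fun y => y - (c.μ / (c.Lg1 : ℝ) ^ 2) • P.mean2g x y ξ :=
  contractingWith_gradient_step c.μ_pos c.Lg1_pos (fun y y' => hP.mean2g_monotone x y y' ξ)
    fun y y' => by simpa using hP.norm_mean2g_sub_le x x y y' ξ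

lemma lower_strong (hP : P.Regular c y₀) (x : E dx) (ξ : Ξ) (y y' : E dy) :
    c.μ / 2 * ‖y - y'‖ ^ 2 ≤
      P.lower x ξ y - P.lower x ξ y' - inner ℝ (P.mean2g x y' ξ) (y - y') := by
  have h1 := hP.g_integrable x y ξ
  have h2 := hP.g_integrable x y' ξ
  have h3 : Integrable (fun η => inner ℝ (P.grad2g x y' η ξ) (y - y')) (P.lawEta ξ) :=
    (hP.integrable_grad2g x y' ξ).inner_const (y - y')
  have h12 : Integrable (fun η => P.g x y η ξ - P.g x y' η ξ) (P.lawEta ξ) := h1.sub h2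
  rw [lower, lower, mean2g, integral_inner_right (hP.integrable_grad2g x y' ξ),
    ← integral_sub h1 h2, ← integral_sub h12 h3]
  have := integral_mono (μ := P.lawEta ξ) (integrable_const (c.μ / 2 * ‖y - y'‖ ^ 2))
    (h12.sub h3) fun η => hP.g_strong x η ξ y y'
  simpa using this

/-- The zero is the fixed point of a contracting gradient step. The convergent iteration is recorded
as well, since it later exhibits y* as a limit of functions measurable in ξ. -/
lemma exists_mean2g_eq_zero (hP : P.Regular c y₀) (x : E dx) (ξ : Ξ) :
    ∃ y, P.mean2g x y ξ = 0 ∧ Filter.Tendsto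
      (fun n => (fun y => y - (c.μ / (c.Lg1 : ℝ) ^ 2) • P.mean2g x y ξ)^[n] 0)
      Filter.atTop (nhds y) := by
  have hc := hP.contracting_step x ξ
  refine ⟨hc.fixedPoint _, ?_, hc.tendsto_iterate_fixedPoint 0⟩
  have h : _ - _ = _ := hc.fixedPoint_isFixedPt
  rw [sub_eq_self, smul_eq_zero] at h
  exact h.resolve_left (div_pos c.μ_pos (pow_pos (Lg1_pos' c) 2)).ne'

/-- Strong convexity expanded at a zero of the mean gradient makes that zero the strict minimizer. A
minimizer is compared with the zero already constructed, so the expected objective need not be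
differentiated. -/
lemma isMinOn_lower_iff (hP : P.Regular c y₀) (x : E dx) (ξ : Ξ) (y : E dy) :
    IsMinOn (P.lower x ξ) Set.univ y ↔ P.mean2g x y ξ = 0 := by
  constructor
  · intro h
    obtain ⟨y', hy', -⟩ := hP.exists_mean2g_eq_zero x ξ
    have h1 := hP.lower_strong x ξ y y'
    rw [hy', inner_zero_left, sub_zero] at h1
    have h2 : P.lower x ξ y ≤ P.lower x ξ y' := h (Set.mem_univ y')
    have h3 : ‖y - y'‖ ^ 2 ≤ 0 := by
      have := c.μ_pos
      by_contra hlt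
      push Not at hlt
      nlinarith
    have h4 : y = y' := by
      rw [← sub_eq_zero, ← norm_eq_zero]
      exact pow_eq_zero_iff two_ne_zero |>.mp (le_antisymm h3 (sq_nonneg _))
    rw [h4, hy']
  · intro h y' _
    have h1 := hP.lower_strong x ξ y' y
    rw [h, inner_zero_left, sub_zero] at h1
    have : 0 ≤ c.μ / 2 * ‖y' - y‖ ^ 2 := mul_nonneg (by linarith [c.μ_pos]) (sq_nonneg _)
    change P.lower x ξ y ≤ P.lower x ξ y'
    linarith

lemma norm_sub_le_of_mean2g (hP : P.Regular c y₀) (x : E dx) (ξ : Ξ) (y y' : E dy) :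
    c.μ * ‖y - y'‖ ≤ ‖P.mean2g x y ξ - P.mean2g x y' ξ‖ := by
  rcases eq_or_ne y y' with rfl | hne
  · simp
  · have h := (hP.mean2g_monotone x y y' ξ).trans (real_inner_le_norm _ _)
    rw [pow_two, ← mul_assoc] at h
    exact le_of_mul_le_mul_right h (norm_pos_iff.mpr (sub_ne_zero.mpr hne))

lemma existsUnique_lower (hP : P.Regular c y₀) (x : E dx) (ξ : Ξ) :
    ∃! y, IsMinOn (P.lower x ξ) Set.univ y := by
  simp_rw [hP.isMinOn_lower_iff]
  obtain ⟨y', hy', -⟩ := hP.exists_mean2g_eq_zero x ξ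
  refine ⟨y', hy', fun y hy => ?_⟩
  have h := hP.norm_sub_le_of_mean2g x ξ y y'
  rw [hy, hy', sub_zero, norm_zero] at h
  exact sub_eq_zero.mp (norm_le_zero_iff.mp (nonpos_of_mul_nonpos_right h c.μ_pos))

lemma mean2g_yStar (hP : P.Regular c y₀) (x : E dx) (ξ : Ξ) :
    P.mean2g x (P.yStar x ξ) ξ = 0 :=
  (hP.isMinOn_lower_iff x ξ _).mp
    (Classical.epsilon_spec (hP.existsUnique_lower x ξ).exists)

lemma yStar_eq (hP : P.Regular c y₀) {x : E dx} {ξ : Ξ} {y : E dy} (h : P.mean2g x y ξ = 0) :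
    P.yStar x ξ = y := by
  have h' := hP.norm_sub_le_of_mean2g x ξ (P.yStar x ξ) y
  rw [h, hP.mean2g_yStar, sub_zero, norm_zero] at h'
  exact sub_eq_zero.mp (norm_le_zero_iff.mp (nonpos_of_mul_nonpos_right h' c.μ_pos))

/-- By monotonicity at x, μ‖y*(x) - y*(x')‖ is at most the norm of the mean gradient at (x, y*(x')),
which vanishes when x is replaced by x'. -/
lemma norm_yStar_sub_le (hP : P.Regular c y₀) (x x' : E dx) (ξ : Ξ) :
    ‖P.yStar x ξ - P.yStar x' ξ‖ ≤ c.Lg1 / c.μ * ‖x - x'‖ := by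
  have h := hP.norm_sub_le_of_mean2g x ξ (P.yStar x ξ) (P.yStar x' ξ)
  have h2 := hP.norm_mean2g_sub_le x' x (P.yStar x' ξ) (P.yStar x' ξ) ξ
  rw [hP.mean2g_yStar] at h h2
  rw [sub_self, norm_zero, add_zero, norm_sub_rev x' x] at h2
  rw [div_mul_eq_mul_div, le_div_iff₀ c.μ_pos, mul_comm]
  exact h.trans h2

/-- Strong monotonicity converts the gradient bound at the initial iterate into a distance, uniform
in x and ξ. -/
lemma norm_init_sub_yStar_le (hP : P.Regular c y₀) (x : E dx) (ξ : Ξ) :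
    ‖y₀ x - P.yStar x ξ‖ ≤ c.Lg0 / c.μ := by
  have h := hP.norm_sub_le_of_mean2g x ξ (y₀ x) (P.yStar x ξ)
  rw [hP.mean2g_yStar, sub_zero] at h
  rw [le_div_iff₀ c.μ_pos, mul_comm]
  exact h.trans (hP.initial_bound x ξ)

lemma continuous_yStar (hP : P.Regular c y₀) (ξ : Ξ) : Continuous fun x => P.yStar x ξ := by
  have hK : (0 : ℝ) ≤ c.Lg1 / c.μ := div_nonneg c.Lg1.2 c.μ_pos.le
  refine (LipschitzWith.of_dist_le_mul (K := ⟨_, hK⟩) fun x x' => ?_).continuous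
  rw [dist_eq_norm, dist_eq_norm]
  exact hP.norm_yStar_sub_le x x' ξ

lemma measurable_mean2g (hP : P.Regular c y₀) :
    Measurable fun q : (E dx × E dy) × Ξ => P.mean2g q.1.1 q.1.2 q.2 := by
  refine (stronglyMeasurable_uncurry_of_continuous_of_stronglyMeasurable
    (u := fun (q : E dx × E dy) ξ => P.mean2g q.1 q.2 ξ) (fun ξ => ?_) fun q => ?_).measurable
  · refine (LipschitzWith.of_dist_le_mul (K := c.Lg1 * 2) fun q q' => ?_).continuous
    rw [dist_eq_norm]
    refine (hP.norm_mean2g_sub_le _ _ _ _ ξ).trans ?_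
    push_cast
    rw [mul_assoc, ← dist_eq_norm, ← dist_eq_norm]
    gcongr
    rw [Prod.dist_eq]
    linarith [le_max_left (dist q.1 q'.1) (dist q.2 q'.2),
      le_max_right (dist q.1 q'.1) (dist q.2 q'.2)]
  · exact (hP.stronglyMeasurable_grad2g q.1 q.2).integral_kernel_prod_right'

lemma measurable_yStar (hP : P.Regular c y₀) (x : E dx) : Measurable fun ξ => P.yStar x ξ := by
  refine measurable_of_tendsto_metrizable (f := fun n ξ =>
    (fun y => y - (c.μ / (c.Lg1 : ℝ) ^ 2) • P.mean2g x y ξ)^[n] 0) (fun n => ?_) ?_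
  · induction n with
    | zero => exact measurable_const
    | succ n ih =>
      simp_rw [Function.iterate_succ_apply']
      have h : Measurable fun ξ => P.mean2g x
          ((fun y => y - (c.μ / (c.Lg1 : ℝ) ^ 2) • P.mean2g x y ξ)^[n] 0) ξ :=
        hP.measurable_mean2g.comp ((measurable_const.prodMk ih).prodMk measurable_id)
      exact ih.sub (h.const_smul (c.μ / (c.Lg1 : ℝ) ^ 2))
  · rw [tendsto_pi_nhds]
    intro ξ
    obtain ⟨y, hy, ht⟩ := hP.exists_mean2g_eq_zero x ξ
    rwa [hP.yStar_eq hy]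

/-! ### Implicit differentiation of the lower-level solution -/

lemma hasFDerivAt_integral_gradg (hP : P.Regular c y₀) (ξ : Ξ) (z : XY dx dy) :
    HasFDerivAt (fun z => ∫ η, P.gradg η ξ z ∂P.lawEta ξ)
      (∫ η, P.hessg η ξ z ∂P.lawEta ξ) z :=
  hasFDerivAt_integral_of_dominated_of_fderiv_le (F := fun z η => P.gradg η ξ z)
    (F' := fun z η => P.hessg η ξ z) (bound := fun _ => c.Lg1) Filter.univ_mem
    (.of_forall fun z => (hP.integrable_gradg z ξ).aestronglyMeasurable) (hP.integrable_gradg z ξ)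
    (hP.integrable_hessg z ξ).aestronglyMeasurable
    (ae_of_all _ fun η z _ => hP.norm_hessg_le η ξ z) (integrable_const _)
    (ae_of_all _ fun η z _ => hP.hasFDerivAt_gradg η ξ z)

/-- The inverse of the mean lower-level Hessian at `y*`. -/
def invHess (P : Problem dx dy Ξ H) (x : E dx) (ξ : Ξ) : E dy →L[ℝ] E dy :=
  Ring.inverse (P.mean22g x (P.yStar x ξ) ξ)

lemma invHess_mean22g (hP : P.Regular c y₀) (x : E dx) (ξ : Ξ) (v : E dy) :
    invHess P x ξ (P.mean22g x (P.yStar x ξ) ξ v) = v :=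
  congrArg (fun T : E dy →L[ℝ] E dy => T v) (Ring.inverse_mul_cancel _
    (isUnit_of_coercive c.μ_pos (hP.mean22g_coercive x (P.yStar x ξ) ξ)))

lemma norm_invHess_le (hP : P.Regular c y₀) (x : E dx) (ξ : Ξ) : ‖invHess P x ξ‖ ≤ 1 / c.μ :=
  norm_inverse_le_of_coercive c.μ_pos (hP.mean22g_coercive x (P.yStar x ξ) ξ)

/-- The mean mixed derivative `∂ₓ ∇₂ g` at `y*`. -/
def crossHess (P : Problem dx dy Ξ H) (x : E dx) (ξ : Ξ) : E dx →L[ℝ] E dy :=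
  sndL ∘L (∫ η, P.hessg η ξ (pair x (P.yStar x ξ)) ∂P.lawEta ξ) ∘L inlL

/-- The mean gradient is differentiable in z = (x, y) and its y-part vanishes along the curve z(x) =
(x, y*(x)). Since y* is Lipschitz, the remainder o(‖z(x') - z(x)‖) is o(‖x' - x‖), and the
linearized equation is solved by the inverse Hessian. -/
lemma hasFDerivAt_yStar (hP : P.Regular c y₀) (x : E dx) (ξ : Ξ) :
    HasFDerivAt (fun x => P.yStar x ξ) (-(invHess P x ξ ∘L crossHess P x ξ)) x := by
  have hz : (fun x' => pair x' (P.yStar x' ξ) - pair x (P.yStar x ξ)) =O[nhds x]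
      fun x' => x' - x := by
    refine Asymptotics.IsBigO.of_bound (1 + c.Lg1 / c.μ) (.of_forall fun x' => ?_)
    refine (norm_sub_pair_le _ _ _ _).trans ?_
    linarith [hP.norm_yStar_sub_le x' x ξ]
  have hcont : Filter.Tendsto (fun x' => pair x' (P.yStar x' ξ)) (nhds x)
      (nhds (pair x (P.yStar x ξ))) :=
    (continuous_pair.comp (continuous_id.prodMk (hP.continuous_yStar ξ))).tendsto x
  have h1 := ((hP.hasFDerivAt_integral_gradg ξ (pair x (P.yStar x ξ))).isLittleO.comp_tendsto
    hcont).trans_isBigO hz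
  -- Applied to the y-part of the remainder, the inverse Hessian yields, up to sign, the remainder
  -- of y* itself.
  have h2 := ((invHess P x ξ ∘L sndL).isBigO_comp _ (nhds x)).trans_isLittleO h1
  refine HasFDerivAt.of_isLittleO (h2.neg_left.congr_left fun x' => ?_)
  have hs : ∀ x', (∫ η, P.gradg η ξ (pair x' (P.yStar x' ξ)) ∂P.lawEta ξ).snd = 0 := by
    intro x'
    rw [← hP.mean2g_yStar x' ξ, ← sndL_apply, ← sndL.integral_comp_comm (hP.integrable_gradg _ ξ)]
    simp only [mean2g, hP.grad2g_eq, sndL_apply]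
  have hm : ((∫ η, P.hessg η ξ (pair x (P.yStar x ξ)) ∂P.lawEta ξ)
      (pair x' (P.yStar x' ξ) - pair x (P.yStar x ξ))).snd =
      crossHess P x ξ (x' - x) +
        P.mean22g x (P.yStar x ξ) ξ (P.yStar x' ξ - P.yStar x ξ) := by
    have e : pair x' (P.yStar x' ξ) - pair x (P.yStar x ξ) =
        inlL (x' - x) + inrL (P.yStar x' ξ - P.yStar x ξ) := by
      simp [pair_sub_pair, pair_add_pair]
    have e2 : P.mean22g x (P.yStar x ξ) ξ = sndL ∘L
        (∫ η, P.hessg η ξ (pair x (P.yStar x ξ)) ∂P.lawEta ξ) ∘L inrL := by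
      ext1 v
      rw [hP.mean22g_apply, ContinuousLinearMap.comp_apply, ContinuousLinearMap.comp_apply,
        ContinuousLinearMap.integral_apply (hP.integrable_hessg _ ξ),
        ← sndL.integral_comp_comm ((hP.integrable_hessg _ ξ).apply_continuousLinearMap _)]
      simp [hP.hess22g_eq]
    rw [e, map_add, e2, crossHess, ← sndL_apply, map_add]
    rfl
  have hsub : ∀ u v w : XY dx dy, (sndL (u - v - w) : E dy) = u.snd - v.snd - w.snd :=
    fun _ _ _ => rfl
  simp only [Function.comp_apply]
  rw [ContinuousLinearMap.comp_apply, hsub, hs, hs, hm, sub_zero, zero_sub, map_neg, map_add,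
    hP.invHess_mean22g, neg_neg]
  change _ = P.yStar x' ξ - P.yStar x ξ - -(invHess P x ξ (crossHess P x ξ (x' - x)))
  abel

lemma inner_crossHess (hP : P.Regular c y₀) (x u : E dx) (ξ : Ξ) (v : E dy) :
    inner ℝ (crossHess P x ξ u) v = inner ℝ u (P.mean12g x (P.yStar x ξ) ξ v) := by
  have hi := hP.integrable_hessg (pair x (P.yStar x ξ)) ξ
  have hi' := hi.apply_continuousLinearMap (inlL u)
  rw [crossHess, ContinuousLinearMap.comp_apply, ContinuousLinearMap.comp_apply,
    ContinuousLinearMap.integral_apply hi, ← sndL.integral_comp_comm hi',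
    integral_inner_right (sndL.integrable_comp hi'), hP.mean12g_apply,
    ← integral_inner ((hP.integrable_hess12g _ _ ξ).apply_continuousLinearMap v)]
  simp only [sndL_apply, inlL_apply, hP.inner_hess12g]

end Problem.Regular

end CSBO
end

noncomputable section

namespace CSBO

/-- The Lipschitz constant of the hypergradient. -/
def Constants.LF (c : Constants) : ℝ :=
  (c.Lf1 + (c.Lg2 * (1 / c.μ * c.Lf0) + c.Lg1 * (1 / c.μ * c.Lg2 * (1 / c.μ) * c.Lf0)
    + c.Lg1 * (1 / c.μ * c.Lf1))) * (1 + c.Lg1 / c.μ)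

namespace Problem

variable {dx dy : ℕ} {Ξ H : Type*} [MeasurableSpace Ξ] [MeasurableSpace H]

instance (P : Problem dx dy Ξ H) : IsProbabilityMeasure P.joint := by
  unfold joint; infer_instance

namespace Regular

variable {P : Problem dx dy Ξ H} {c : Constants} {y₀ : E dx → E dy}

open XY

/-! ### The hypergradient -/

/-- The conditional mean of the hypergradient given `ξ`. -/
def hyper (P : Problem dx dy Ξ H) (x : E dx) (ξ : Ξ) : E dx :=
  P.mean1f x (P.yStar x ξ) ξ -
    P.mean12g x (P.yStar x ξ) ξ (invHess P x ξ (P.mean2f x (P.yStar x ξ) ξ))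

/-- The hypergradient at the sample `(ξ, η)` of `f`. -/
def hyperSample (P : Problem dx dy Ξ H) (x : E dx) (p : Ξ × H) : E dx :=
  P.grad1f x (P.yStar x p.1) p.2 p.1 -
    P.mean12g x (P.yStar x p.1) p.1 (invHess P x p.1 (P.grad2f x (P.yStar x p.1) p.2 p.1))

lemma inner_invHess (hP : P.Regular c y₀) (x : E dx) (ξ : Ξ) (u v : E dy) :
    inner ℝ (invHess P x ξ u) v = inner ℝ u (invHess P x ξ v) :=
  inverse_symm c.μ_pos (hP.mean22g_coercive x (P.yStar x ξ) ξ)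
    (hP.mean22g_symm x (P.yStar x ξ) ξ) u v

/-- Chain rule through (x, y*(x)); symmetry of the inverse Hessian and the adjoint relation
`inner_crossHess` move the derivative of y* onto ∇₂f. -/
lemma hasGradientAt_f_yStar (hP : P.Regular c y₀) (x : E dx) (p : Ξ × H) :
    HasGradientAt (fun x => P.f x (P.yStar x p.1) p.2 p.1) (hyperSample P x p) x := by
  have hD : HasFDerivAt (fun x' => pair x' (P.yStar x' p.1))
      (inlL + inrL ∘L (-(invHess P x p.1 ∘L crossHess P x p.1))) x := by
    have h : (fun x' => pair x' (P.yStar x' p.1)) =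
        fun x' => (inlL x' : XY dx dy) + inrL (P.yStar x' p.1) := by
      funext x'; simp [pair_add_pair]
    rw [h]
    exact inlL.hasFDerivAt.add (inrL.hasFDerivAt.comp x (hP.hasFDerivAt_yStar x p.1))
  have h1 := (hP.hasGradientAt_fz p.2 p.1 (pair x (P.yStar x p.1))).hasFDerivAt
  rw [hasGradientAt_iff_hasFDerivAt]
  refine (h1.comp x hD).congr_fderiv ?_
  ext1 u
  rw [ContinuousLinearMap.comp_apply, InnerProductSpace.toDual_apply_apply,
    InnerProductSpace.toDual_apply_apply]
  have e : (inlL + inrL ∘L (-(invHess P x p.1 ∘L crossHess P x p.1)) : E dx →L[ℝ] XY dx dy) u =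
      pair u (-(invHess P x p.1 (crossHess P x p.1 u))) := by
    change pair u 0 + pair 0 _ = _
    rw [pair_add_pair, add_zero, zero_add]
    rfl
  rw [e, inner_eq, fst_pair, snd_pair, ← hP.grad1f_eq, ← hP.grad2f_eq, inner_neg_right,
    ← hP.inner_invHess, real_inner_comm, real_inner_comm (crossHess P x p.1 u),
    hP.inner_crossHess, hyperSample, inner_sub_left, real_inner_comm u, real_inner_comm u]
  ring

lemma measurable_f_yStar (hP : P.Regular c y₀) (x : E dx) :
    Measurable fun p : Ξ × H => P.f x (P.yStar x p.1) p.2 p.1 := by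
  have h := (stronglyMeasurable_uncurry_of_continuous_of_stronglyMeasurable
    (u := fun (y : E dy) (p : Ξ × H) => P.f x y p.2 p.1)
    (fun p => (hP.f_lipschitz p.2 p.1).continuous.comp
      (continuous_pair.comp (continuous_const.prodMk continuous_id)))
    fun y => (hP.f_measurable x y).stronglyMeasurable).measurable
  exact h.comp (((hP.measurable_yStar x).comp measurable_fst).prodMk measurable_id)

/-- Comparison with the integrable value at the initial iterate, which lies within Lg0/μ of y*. -/
lemma integrable_f_yStar (hP : P.Regular c y₀) (x : E dx) :
    Integrable (fun p : Ξ × H => P.f x (P.yStar x p.1) p.2 p.1) P.joint := by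
  refine ((hP.f_integrable x (y₀ x)).norm.add (integrable_const (c.Lf0 * (c.Lg0 / c.μ) : ℝ))).mono'
    (hP.measurable_f_yStar x).aestronglyMeasurable (ae_of_all _ fun p => ?_)
  have h1 := (hP.f_lipschitz p.2 p.1).norm_sub_le (pair x (P.yStar x p.1)) (pair x (y₀ x))
  have h2 : ‖pair x (P.yStar x p.1) - pair x (y₀ x)‖ ≤ c.Lg0 / c.μ := by
    refine (norm_sub_pair_le _ _ _ _).trans ?_
    rw [sub_self, norm_zero, zero_add, norm_sub_rev]
    exact hP.norm_init_sub_yStar_le x p.1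
  have h3 := mul_le_mul_of_nonneg_left h2 c.Lf0.2
  have h4 := norm_le_norm_add_norm_sub' (P.f x (P.yStar x p.1) p.2 p.1) (P.f x (y₀ x) p.2 p.1)
  exact h4.trans (add_le_add_right (h1.trans h3) _)

lemma norm_hyperSample_le (hP : P.Regular c y₀) (x : E dx) (p : Ξ × H) :
    ‖hyperSample P x p‖ ≤ c.Lf0 + c.Lg1 * (1 / c.μ * c.Lf0) := by
  refine (norm_sub_le _ _).trans (add_le_add (hP.norm_grad1f_le _ _ _ _) ?_)
  have := c.μ_pos
  exact ContinuousLinearMap.le_of_opNorm_le_of_le _ (hP.norm_mean12g_le _ _ _)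
    (ContinuousLinearMap.le_of_opNorm_le_of_le _ (hP.norm_invHess_le _ _)
      (hP.norm_grad2f_le _ _ _ _))

/-- It is the gradient in x of a function measurable in (ξ, η), so measurability of the inverse
Hessian in ξ need not be proved. -/
lemma stronglyMeasurable_hyperSample (hP : P.Regular c y₀) (x : E dx) :
    StronglyMeasurable (hyperSample P x) := by
  have h : hyperSample P x = fun p : Ξ × H => (InnerProductSpace.toDual ℝ (E dx)).symm
      (fderiv ℝ (fun x => P.f x (P.yStar x p.1) p.2 p.1) x) := by
    funext p; exact (hP.hasGradientAt_f_yStar x p).gradient.symm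
  rw [h]
  exact (InnerProductSpace.toDual ℝ (E dx)).symm.continuous.comp_stronglyMeasurable
    (stronglyMeasurable_fderiv_param
      (φ := fun (p : Ξ × H) x => P.f x (P.yStar x p.1) p.2 p.1)
      (fun x => (hP.measurable_f_yStar x).stronglyMeasurable)
      fun p => (hP.hasGradientAt_f_yStar x p).differentiableAt)

lemma integrable_hyperSample (hP : P.Regular c y₀) (x : E dx) :
    Integrable (hyperSample P x) P.joint :=
  Integrable.of_bound (hP.stronglyMeasurable_hyperSample x).aestronglyMeasurable _
    (ae_of_all _ (hP.norm_hyperSample_le x))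

/-- Differentiation under the integral: x ↦ f(x, y*(x)) has the Lipschitz constant Lf0 (1 + Lg1/μ)
for every sample, and this constant is the dominating function. -/
lemma hasGradientAt_F (hP : P.Regular c y₀) (x : E dx) :
    HasGradientAt P.F (∫ p, hyperSample P x p ∂P.joint) x := by
  rw [hasGradientAt_iff_hasFDerivAt]
  have hC : (0 : ℝ) ≤ c.Lf0 * (1 + c.Lg1 / c.μ) := by have := c.μ_pos; positivity
  have hF' : StronglyMeasurable fun p => InnerProductSpace.toDual ℝ (E dx) (hyperSample P x p) :=
    (InnerProductSpace.toDual ℝ (E dx)).continuous.comp_stronglyMeasurable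
      (hP.stronglyMeasurable_hyperSample x)
  have h := hasFDerivAt_integral_of_dominated_loc_of_lip (μ := P.joint)
    (F := fun x p => P.f x (P.yStar x p.1) p.2 p.1)
    (F' := fun p => InnerProductSpace.toDual ℝ (E dx) (hyperSample P x p))
    (bound := fun _ => c.Lf0 * (1 + c.Lg1 / c.μ)) (x₀ := x) Filter.univ_mem
    (.of_forall fun x => (hP.measurable_f_yStar x).aestronglyMeasurable)
    (hP.integrable_f_yStar x) hF'.aestronglyMeasurable
    (ae_of_all _ fun p => ?_) (integrable_const _)
    (ae_of_all _ fun p => (hP.hasGradientAt_f_yStar x p).hasFDerivAt)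
  · refine h.2.congr_fderiv ?_
    ext1 u
    rw [ContinuousLinearMap.integral_apply h.1, InnerProductSpace.toDual_apply_apply,
      integral_inner_right (hP.integrable_hyperSample x)]
    simp
  · refine (LipschitzWith.of_dist_le_mul fun x x' => ?_).lipschitzOnWith
    rw [Real.coe_nnabs, abs_of_nonneg hC, dist_eq_norm, dist_eq_norm]
    refine ((hP.f_lipschitz p.2 p.1).norm_sub_le (pair x (P.yStar x p.1))
      (pair x' (P.yStar x' p.1))).trans ?_
    rw [mul_assoc]
    refine mul_le_mul_of_nonneg_left ((norm_sub_pair_le _ _ _ _).trans ?_) c.Lf0.2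
    linarith [hP.norm_yStar_sub_le x x' p.1]

lemma wellDefined (hP : P.Regular c y₀) : P.WellDefined where
  existsUnique_lower := hP.existsUnique_lower
  integrable_upper := hP.integrable_f_yStar
  differentiable_F := fun x => (hP.hasGradientAt_F x).differentiableAt

lemma integral_hyperSample_eta (hP : P.Regular c y₀) (x : E dx) (ξ : Ξ) :
    ∫ η, hyperSample P x (ξ, η) ∂P.lawEta ξ = hyper P x ξ := by
  have h2 := hP.integrable_grad2f x (P.yStar x ξ) ξ
  have h3 : Integrable (fun η => P.mean12g x (P.yStar x ξ) ξ (invHess P x ξ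
      (P.grad2f x (P.yStar x ξ) η ξ))) (P.lawEta ξ) :=
    ((P.mean12g x (P.yStar x ξ) ξ) ∘L invHess P x ξ).integrable_comp h2
  simp only [hyperSample]
  rw [integral_sub (hP.integrable_grad1f _ _ _) h3, hyper, mean1f, mean2f]
  congr 1
  exact ((P.mean12g x (P.yStar x ξ) ξ) ∘L invHess P x ξ).integral_comp_comm h2

lemma gradient_F (hP : P.Regular c y₀) (x : E dx) :
    gradient P.F x = ∫ ξ, hyper P x ξ ∂P.lawXi := by
  rw [(hP.hasGradientAt_F x).gradient]
  have := Measure.integral_compProd (μ := P.lawXi) (κ := P.lawEta) (hP.integrable_hyperSample x)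
  rw [joint, this]
  simp only [hP.integral_hyperSample_eta]

lemma integrable_hyper (hP : P.Regular c y₀) (x : E dx) : Integrable (hyper P x) P.lawXi := by
  have hm := (hP.stronglyMeasurable_hyperSample x).integral_kernel_prod_right' (κ := P.lawEta)
  have h := Integrable.of_bound (μ := P.lawXi) hm.aestronglyMeasurable _
    (ae_of_all _ fun ξ => norm_integral_le_of_forall (ν := P.lawEta ξ)
      fun η => hP.norm_hyperSample_le x (ξ, η))
  simpa only [hP.integral_hyperSample_eta] using h

lemma norm_hyper_sub_le (hP : P.Regular c y₀) (x x' : E dx) (ξ : Ξ) :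
    ‖hyper P x ξ - hyper P x' ξ‖ ≤ c.LF * ‖x - x'‖ := by
  have hμ := c.μ_pos
  set d := ‖x - x'‖ + ‖P.yStar x ξ - P.yStar x' ξ‖ with hd
  have hd' : d ≤ (1 + c.Lg1 / c.μ) * ‖x - x'‖ := by
    rw [hd]; linarith [hP.norm_yStar_sub_le x x' ξ]
  have ha := hP.norm_mean1f_sub_le x x' (P.yStar x ξ) (P.yStar x' ξ) ξ
  have hb := hP.norm_mean2f_sub_le x x' (P.yStar x ξ) (P.yStar x' ξ) ξ
  have hA := hP.norm_mean22g_sub_le x x' (P.yStar x ξ) (P.yStar x' ξ) ξ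
  have hB := hP.norm_mean12g_sub_le x x' (P.yStar x ξ) (P.yStar x' ξ) ξ
  have hR : ‖invHess P x ξ - invHess P x' ξ‖ ≤ 1 / c.μ * (c.Lg2 * d) * (1 / c.μ) :=
    (norm_inverse_sub_inverse_le hμ (hP.mean22g_coercive x (P.yStar x ξ) ξ)
      (hP.mean22g_coercive x' (P.yStar x' ξ) ξ)).trans (by gcongr)
  have hRn := hP.norm_invHess_le x ξ
  have hRn' := hP.norm_invHess_le x' ξ
  have hbn := hP.norm_mean2f_le x (P.yStar x ξ) ξ
  have hBn' := hP.norm_mean12g_le x' (P.yStar x' ξ) ξ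
  unfold hyper
  set a := P.mean1f x (P.yStar x ξ) ξ
  set a' := P.mean1f x' (P.yStar x' ξ) ξ
  set b := P.mean2f x (P.yStar x ξ) ξ
  set b' := P.mean2f x' (P.yStar x' ξ) ξ
  set B := P.mean12g x (P.yStar x ξ) ξ
  set B' := P.mean12g x' (P.yStar x' ξ) ξ
  set R := invHess P x ξ
  set R' := invHess P x' ξ
  -- The three factors of the product are exchanged one at a time.
  have e : a - B (R b) - (a' - B' (R' b')) =
      (a - a') - ((B - B') (R b) + B' ((R - R') b) + B' (R' (b - b'))) := by
    simp only [sub_apply, map_sub]; abel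
  rw [e]
  have h1 : ‖(B - B') (R b)‖ ≤ c.Lg2 * d * (1 / c.μ * c.Lf0) :=
    ContinuousLinearMap.le_of_opNorm_le_of_le _ hB
      (ContinuousLinearMap.le_of_opNorm_le_of_le _ hRn hbn)
  have h2 : ‖B' ((R - R') b)‖ ≤ c.Lg1 * (1 / c.μ * (c.Lg2 * d) * (1 / c.μ) * c.Lf0) :=
    ContinuousLinearMap.le_of_opNorm_le_of_le _ hBn'
      (ContinuousLinearMap.le_of_opNorm_le_of_le _ hR hbn)
  have h3 : ‖B' (R' (b - b'))‖ ≤ c.Lg1 * (1 / c.μ * (c.Lf1 * d)) :=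
    ContinuousLinearMap.le_of_opNorm_le_of_le _ hBn'
      (ContinuousLinearMap.le_of_opNorm_le_of_le _ hRn' hb)
  calc _ ≤ ‖a - a'‖ + (‖(B - B') (R b)‖ + ‖B' ((R - R') b)‖ + ‖B' (R' (b - b'))‖) :=
        (norm_sub_le _ _).trans (add_le_add_right (norm_add₃_le) _)
    _ ≤ c.Lf1 * d + (c.Lg2 * d * (1 / c.μ * c.Lf0) +
        c.Lg1 * (1 / c.μ * (c.Lg2 * d) * (1 / c.μ) * c.Lf0) +
        c.Lg1 * (1 / c.μ * (c.Lf1 * d))) := by gcongr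
    _ = (c.Lf1 + (c.Lg2 * (1 / c.μ * c.Lf0) + c.Lg1 * (1 / c.μ * c.Lg2 * (1 / c.μ) * c.Lf0)
        + c.Lg1 * (1 / c.μ * c.Lf1))) * d := by ring
    _ ≤ _ := by
      rw [Constants.LF, mul_assoc _ (1 + (c.Lg1 : ℝ) / c.μ)]
      refine mul_le_mul_of_nonneg_left hd' ?_
      positivity

lemma norm_gradient_F_sub_le (hP : P.Regular c y₀) (x x' : E dx) :
    ‖gradient P.F x - gradient P.F x'‖ ≤ c.LF * ‖x - x'‖ := by
  rw [hP.gradient_F, hP.gradient_F]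
  exact norm_integral_sub_integral_le (hP.integrable_hyper x) (hP.integrable_hyper x')
    (hP.norm_hyper_sub_le x x')

end Regular

end Problem

lemma Constants.LF_nonneg (c : Constants) : 0 ≤ c.LF := by
  have := c.μ_pos
  unfold LF; positivity

end CSBO
end

noncomputable section

namespace CSBO

/-! ### Resampling one coordinate of an i.i.d. family -/

section Resample

variable {ι X α : Type*} [DecidableEq ι] [MeasurableSpace X] [MeasurableSpace α]
  (ν : Measure X) [IsProbabilityMeasure ν] (j : ι)

lemma measurable_update_pair :
    Measurable fun q : (ι → X) × X => Function.update q.1 j q.2 := by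
  refine measurable_pi_iff.mpr fun i => ?_
  by_cases h : i = j
  · subst h; simpa using measurable_snd
  · simp only [Function.update_of_ne h]
    exact (measurable_pi_apply i).comp measurable_fst

/-- Overwriting one coordinate by a fresh sample preserves the product law; it is enough to check
finite boxes, where the factor of j splits off. -/
lemma measurePreserving_update :
    MeasurePreserving (fun q : (ι → X) × X => Function.update q.1 j q.2)
      ((Measure.infinitePi fun _ : ι => ν).prod ν) (Measure.infinitePi fun _ : ι => ν) := by
  refine ⟨measurable_update_pair j, ?_⟩
  refine Measure.eq_infinitePi _ fun s t ht => ?_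
  rw [Measure.map_apply (measurable_update_pair j)
    (.pi s.countable_toSet fun i _ => ht i)]
  have h : (fun q : (ι → X) × X => Function.update q.1 j q.2) ⁻¹' (s : Set ι).pi t =
      ((s.erase j : Finset ι) : Set ι).pi t ×ˢ (if j ∈ s then t j else Set.univ) := by
    ext q
    simp only [Set.mem_preimage, Set.mem_pi, Finset.mem_coe, Set.mem_prod, Finset.mem_erase]
    constructor
    · intro hq
      refine ⟨fun i hi => by simpa [Function.update_of_ne hi.1] using hq i hi.2, ?_⟩
      split_ifs with hj
      · simpa using hq j hj
      · trivial
    · rintro ⟨h1, h2⟩ i hi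
      by_cases hij : i = j
      · subst hij; simpa [hi] using h2
      · simpa [Function.update_of_ne hij] using h1 i ⟨hij, hi⟩
  rw [h, Measure.prod_prod, Measure.infinitePi_pi _ fun i _ => ht i]
  split_ifs with hj
  · rw [mul_comm, Finset.mul_prod_erase s (fun i => ν (t i)) hj]
  · rw [measure_univ, mul_one, Finset.erase_eq_of_notMem hj]

/-- The coordinate `j` is independent of a quantity that does not depend on it. -/
lemma lintegral_resample {A : (ι → X) → α} {φ : α → X → ℝ≥0∞} (hA : Measurable A)
    (hφ : Measurable fun q : α × X => φ q.1 q.2)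
    (hj : ∀ ω e, A (Function.update ω j e) = A ω) :
    ∫⁻ ω, φ (A ω) (ω j) ∂Measure.infinitePi (fun _ : ι => ν) =
      ∫⁻ ω, ∫⁻ e, φ (A ω) e ∂ν ∂Measure.infinitePi (fun _ : ι => ν) := by
  have hm : Measurable fun ω : ι → X => φ (A ω) (ω j) :=
    hφ.comp (hA.prodMk (measurable_pi_apply j))
  rw [← (measurePreserving_update ν j).lintegral_comp hm,
    lintegral_prod (fun q : (ι → X) × X =>
      φ (A (Function.update q.1 j q.2)) (Function.update q.1 j q.2 j))
      (hm.comp (measurable_update_pair j)).aemeasurable]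
  simp [hj]

/-- Fubini after resampling: the coordinate j becomes the outer variable, and the inner integral
sees it as a constant. -/
lemma integral_eq_integral_update {V : Type*} [NormedAddCommGroup V] [NormedSpace ℝ V]
    [MeasurableSpace V] [BorelSpace V] [SecondCountableTopology V] {Φ : (ι → X) → V} {C : ℝ}
    (hΦ : Measurable Φ) (hC : ∀ ω, ‖Φ ω‖ ≤ C) :
    ∫ ω, Φ ω ∂Measure.infinitePi (fun _ : ι => ν) =
      ∫ e, ∫ ω, Φ (Function.update ω j e) ∂Measure.infinitePi (fun _ : ι => ν) ∂ν := by
  have hm := hΦ.comp (measurable_update_pair (X := X) j)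
  conv_lhs => rw [← (measurePreserving_update ν j).map_eq]
  rw [integral_map (measurable_update_pair j).aemeasurable hΦ.aestronglyMeasurable,
    integral_prod_symm (fun q : (ι → X) × X => Φ (Function.update q.1 j q.2))
      (Integrable.of_bound hm.aestronglyMeasurable C (ae_of_all _ fun q => hC _))]

end Resample

/-! ### Uniform distribution -/

lemma lintegral_unif (N : ℕ+) (φ : ℕ → ℝ≥0∞) :
    ∫⁻ n, φ n ∂unif N = ∑ n ∈ Finset.range N, ((N : ℕ) : ℝ≥0∞)⁻¹ * φ n := by
  simp [unif, lintegral_finsetSum_measure]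

/-! ### Stochastic gradient descent with a biased oracle -/

section SGD

variable {V : Type*} [NormedAddCommGroup V] [InnerProductSpace ℝ V] [CompleteSpace V]

/-- Mean value inequality on the ball of radius ‖u‖ about x, where ∇F varies by at most L‖u‖. The
constant L instead of L/2 only affects constants. -/
lemma descent_le {F : V → ℝ} {L : ℝ} (hF : Differentiable ℝ F)
    (hL : ∀ x x', ‖gradient F x - gradient F x'‖ ≤ L * ‖x - x'‖) (x u : V) (hL0 : 0 ≤ L) :
    F (x + u) ≤ F x + inner ℝ (gradient F x) u + L * ‖u‖ ^ 2 := by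
  have h := (convex_closedBall x ‖u‖).norm_image_sub_le_of_norm_fderiv_le' (𝕜 := ℝ) (f := F)
    (φ := fderiv ℝ F x) (C := L * ‖u‖) (x := x) (y := x + u) (fun z _ => hF z) (fun z hz => ?_)
    (by simp) (by simp)
  · rw [add_sub_cancel_left] at h
    have e : fderiv ℝ F x u = inner ℝ (gradient F x) u := by
      rw [(hF x).hasGradientAt.hasFDerivAt.fderiv, InnerProductSpace.toDual_apply_apply]
    rw [e] at h
    have := (abs_le.mp (Real.norm_eq_abs _ ▸ h)).2
    nlinarith
  · have e : ‖fderiv ℝ F z - fderiv ℝ F x‖ = ‖gradient F z - gradient F x‖ := by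
      rw [gradient, gradient, ← map_sub, LinearIsometryEquiv.norm_map]
    rw [e]
    refine (hL z x).trans (mul_le_mul_of_nonneg_left ?_ hL0)
    simpa [dist_eq_norm] using hz

variable {α' : Type*} [MeasurableSpace α'] {ρ : Measure α'} [IsProbabilityMeasure ρ]

/-- The mean of the linear term is -a⟨∇F, ∇F + bias⟩; Young's inequality on the bias part leaves
-(a/2)‖∇F‖² + (a/2)B². Subtracting the lower bound m makes the objective gap nonnegative, so
`ENNReal` integrals avoid any integrability question along the trajectory. -/
lemma lintegral_step_le {F : V → ℝ} {L : ℝ} (hF : Differentiable ℝ F)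
    (hL : ∀ x x', ‖gradient F x - gradient F x'‖ ≤ L * ‖x - x'‖) (hL0 : 0 ≤ L)
    {m : ℝ} (hm : ∀ x, m ≤ F x) {x : V} {w : α' → V} {B W a : ℝ} (ha : 0 < a) (hW : 0 ≤ W)
    (hw : AEStronglyMeasurable w ρ)
    (hB : ‖∫ e, w e ∂ρ - gradient F x‖ ≤ B)
    (hw2 : ∫⁻ e, ‖w e‖ₑ ^ 2 ∂ρ ≤ ENNReal.ofReal W) :
    ∫⁻ e, ENNReal.ofReal (F (x - a • w e) - m) ∂ρ + ENNReal.ofReal (a / 2 * ‖gradient F x‖ ^ 2)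
      ≤ ENNReal.ofReal (F x - m) + ENNReal.ofReal (a / 2 * B ^ 2 + L * a ^ 2 * W) := by
  have hL2 : MemLp w 2 ρ := by
    refine ⟨hw, ?_⟩
    rw [eLpNorm_lt_top_iff_lintegral_rpow_enorm_lt_top two_ne_zero ENNReal.ofNat_ne_top]
    simpa using hw2.trans_lt ENNReal.ofReal_lt_top
  have hi := hL2.integrable one_le_two
  have hi2 : Integrable (fun e => ‖w e‖ ^ 2) ρ := hL2.integrable_norm_pow two_ne_zero
  have hsq : ∫ e, ‖w e‖ ^ 2 ∂ρ ≤ W := by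
    rw [← ENNReal.ofReal_le_ofReal_iff hW, ofReal_integral_eq_lintegral_ofReal hi2
      (ae_of_all _ fun e => sq_nonneg _)]
    refine le_trans (le_of_eq (lintegral_congr fun e => ?_)) hw2
    rw [ENNReal.ofReal_pow (norm_nonneg _), ofReal_norm]
  set G := gradient F x with hG
  have hinner : Integrable (fun e => inner ℝ G (w e)) ρ := hi.const_inner G
  have hup : ∀ e, F (x - a • w e) - m ≤
      F x - m - a * inner ℝ G (w e) + L * a ^ 2 * ‖w e‖ ^ 2 := by
    intro e
    have h := descent_le hF hL x (-(a • w e)) hL0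
    rw [← sub_eq_add_neg, inner_neg_right, inner_smul_right, norm_neg, norm_smul, mul_pow,
      Real.norm_eq_abs, sq_abs] at h
    linarith
  have hgi0 : Integrable (fun e => F x - m - a * inner ℝ G (w e)) ρ :=
    (integrable_const _).sub (hinner.const_mul a)
  have hgi : Integrable (fun e => F x - m - a * inner ℝ G (w e) + L * a ^ 2 * ‖w e‖ ^ 2) ρ :=
    hgi0.add (hi2.const_mul _)
  have hg0 : ∀ e, 0 ≤ F x - m - a * inner ℝ G (w e) + L * a ^ 2 * ‖w e‖ ^ 2 := fun e =>
    (sub_nonneg.mpr (hm _)).trans (hup e)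
  have hval : ∫ e, (F x - m - a * inner ℝ G (w e) + L * a ^ 2 * ‖w e‖ ^ 2) ∂ρ =
      F x - m - a * inner ℝ G (∫ e, w e ∂ρ) + L * a ^ 2 * ∫ e, ‖w e‖ ^ 2 ∂ρ := by
    rw [integral_add hgi0 (hi2.const_mul _),
      integral_sub (integrable_const _) (hinner.const_mul a), integral_const_mul,
      integral_const_mul, integral_inner hi]
    simp
  have hbias : -(a * inner ℝ G (∫ e, w e ∂ρ)) ≤ -(a / 2 * ‖G‖ ^ 2) + a / 2 * B ^ 2 := by
    have h1 : ‖∫ e, w e ∂ρ - G‖ ^ 2 ≤ B ^ 2 := by gcongr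
    have h2 : ∫ e, w e ∂ρ = G + (∫ e, w e ∂ρ - G) := by abel
    rw [h2, inner_add_right, real_inner_self_eq_norm_sq]
    have h3 := real_inner_le_norm G (-(∫ e, w e ∂ρ - G))
    rw [inner_neg_right, norm_neg] at h3
    have h4 := two_mul_le_add_sq ‖G‖ ‖∫ e, w e ∂ρ - G‖
    have h5 := mul_le_mul_of_nonneg_left
      (show -inner ℝ G (∫ e, w e ∂ρ - G) ≤ (‖G‖ ^ 2 + B ^ 2) / 2 by linarith) ha.le
    linarith
  have hnn : 0 ≤ ∫ e, (F x - m - a * inner ℝ G (w e) + L * a ^ 2 * ‖w e‖ ^ 2) ∂ρ :=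
    integral_nonneg hg0
  have hR : 0 ≤ a / 2 * B ^ 2 + L * a ^ 2 * W := by positivity
  calc _ ≤ ∫⁻ e, ENNReal.ofReal (F x - m - a * inner ℝ G (w e) + L * a ^ 2 * ‖w e‖ ^ 2) ∂ρ +
        ENNReal.ofReal (a / 2 * ‖G‖ ^ 2) := by
        gcongr with e; exact hup e
    _ ≤ _ := by
      rw [← ofReal_integral_eq_lintegral_ofReal hgi (ae_of_all _ hg0),
        ← ENNReal.ofReal_add hnn (by positivity),
        ← ENNReal.ofReal_add (sub_nonneg.mpr (hm x)) hR, hval]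
      apply ENNReal.ofReal_le_ofReal
      have := mul_le_mul_of_nonneg_left hsq (show 0 ≤ L * a ^ 2 by positivity)
      linarith

end SGD

/-! ### The SGD framework with a random output index -/

namespace Problem

variable {d : ℕ} {α' : Type*}

lemma sgd_congr (v : E d → α' → Counted (E d)) (a : ℝ) (x₁ : E d) {ω ω' : ℕ → α'} {t : ℕ}
    (h : ∀ i < t, ω i = ω' i) : sgd v a x₁ ω t = sgd v a x₁ ω' t := by
  induction t with
  | zero => rfl
  | succ t ih => rw [sgd, sgd, ih fun i hi => h i (by omega), h t (by omega)]

lemma sgd_val_succ (v : E d → α' → Counted (E d)) (a : ℝ) (x₁ : E d) (ω : ℕ → α') (t : ℕ) :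
    (sgd v a x₁ ω (t + 1)).val =
      (sgd v a x₁ ω t).val - a • (v (sgd v a x₁ ω t).val (ω t)).val := rfl

variable [MeasurableSpace α'] {ρ : Measure α'} [IsProbabilityMeasure ρ]

lemma measurable_sgd {v : E d → α' → Counted (E d)}
    (hv : Measurable fun q : E d × α' => (v q.1 q.2).val) (a : ℝ) (x₁ : E d) (t : ℕ) :
    Measurable fun ω => (sgd v a x₁ ω t).val := by
  induction t with
  | zero => exact measurable_const
  | succ t ih =>
    simp_rw [sgd_val_succ]
    exact ih.sub ((hv.comp (ih.prodMk (measurable_pi_apply t))).const_smul a)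

/-- The expected one-step decrease holds conditionally on the past because the bounds on the oracle
are uniform in x. Telescoping bounds Σ_t (a/2) 𝔼‖∇F‖² by Δ + T·R, and the uniform output index turns
the sum into an average. -/
theorem lintegral_gradient_output_le {F : E d → ℝ} {L : ℝ} (hF : Differentiable ℝ F)
    (hL : ∀ x x', ‖gradient F x - gradient F x'‖ ≤ L * ‖x - x'‖) (hL0 : 0 ≤ L)
    {Δ : ℝ} {x₁ : E d} (hΔ : ∀ x, F x₁ - F x ≤ Δ) {v : E d → α' → Counted (E d)}
    (hv : Measurable fun q : E d × α' => (v q.1 q.2).val) {B W a : ℝ} (ha : 0 < a) (hW : 0 ≤ W)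
    (hB : ∀ x, ‖∫ e, (v x e).val ∂ρ - gradient F x‖ ≤ B)
    (hv2 : ∀ x, ∫⁻ e, ‖(v x e).val‖ₑ ^ 2 ∂ρ ≤ ENNReal.ofReal W) (T : ℕ+) :
    ∫⁻ ω, ‖gradient F (output v a x₁ ω)‖ₑ ^ 2
        ∂(Measure.infinitePi fun _ : ℕ => ρ).prod (unif T)
      ≤ ENNReal.ofReal (2 * Δ / (a * (T : ℕ)) + B ^ 2 + 2 * L * a * W) := by
  set Pi := Measure.infinitePi fun _ : ℕ => ρ
  have hgc : Continuous (gradient F) := by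
    refine (LipschitzWith.of_dist_le_mul (K := ⟨L, hL0⟩) fun x x' => ?_).continuous
    rw [dist_eq_norm, dist_eq_norm]; exact hL x x'
  have hx := measurable_sgd hv a x₁
  have hΔ0 : 0 ≤ Δ := by simpa using hΔ x₁
  set m := F x₁ - Δ
  have hm : ∀ x, m ≤ F x := fun x => by linarith [hΔ x]
  set R := a / 2 * B ^ 2 + L * a ^ 2 * W with hRdef
  have hR : 0 ≤ R := by positivity
  have hstep : ∀ t, ∫⁻ ω, ENNReal.ofReal (F (sgd v a x₁ ω (t + 1)).val - m) ∂Pi +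
      ∫⁻ ω, ENNReal.ofReal (a / 2 * ‖gradient F (sgd v a x₁ ω t).val‖ ^ 2) ∂Pi ≤
      ∫⁻ ω, ENNReal.ofReal (F (sgd v a x₁ ω t).val - m) ∂Pi + ENNReal.ofReal R := by
    intro t
    have hφ : Measurable fun q : E d × α' =>
        ENNReal.ofReal (F (q.1 - a • (v q.1 q.2).val) - m) := by
      have : Measurable F := hF.continuous.measurable
      exact ((this.comp (measurable_fst.sub (hv.const_smul a))).sub_const m).ennreal_ofReal
    -- The iterate after t steps reads only the tapes with index below t, so tape t is integrated
    -- with the iterate frozen.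
    have h := lintegral_resample ρ t (A := fun ω => (sgd v a x₁ ω t).val)
      (φ := fun x e => ENNReal.ofReal (F (x - a • (v x e).val) - m)) (hx t) hφ fun ω e => by
        rw [sgd_congr]
        intro i hi
        rw [Function.update_of_ne hi.ne]
    have hgm : Measurable fun ω =>
        ENNReal.ofReal (a / 2 * ‖gradient F (sgd v a x₁ ω t).val‖ ^ 2) :=
      (((hgc.measurable.comp (hx t)).norm.pow_const 2).const_mul (a / 2)).ennreal_ofReal
    simp_rw [sgd_val_succ]
    rw [h, ← lintegral_add_right _ hgm]
    calc _ ≤ ∫⁻ ω, (ENNReal.ofReal (F (sgd v a x₁ ω t).val - m) + ENNReal.ofReal R) ∂Pi := by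
          refine lintegral_mono fun ω => ?_
          exact lintegral_step_le hF hL hL0 hm ha hW
            (hv.comp measurable_prodMk_left).aestronglyMeasurable (hB _) (hv2 _)
      _ = _ := by
          rw [lintegral_add_right _ measurable_const, lintegral_const, measure_univ, mul_one]
  have hsum : ∀ n : ℕ, ∫⁻ ω, ENNReal.ofReal (F (sgd v a x₁ ω n).val - m) ∂Pi +
      ∑ t ∈ Finset.range n,
        ∫⁻ ω, ENNReal.ofReal (a / 2 * ‖gradient F (sgd v a x₁ ω t).val‖ ^ 2) ∂Pi ≤
      ENNReal.ofReal Δ + n * ENNReal.ofReal R := by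
    intro n
    induction n with
    | zero => simp [sgd, Counted.pure, m, Pi]
    | succ n ih =>
      rw [Finset.sum_range_succ]
      calc _ = (∫⁻ ω, ENNReal.ofReal (F (sgd v a x₁ ω (n + 1)).val - m) ∂Pi +
            ∫⁻ ω, ENNReal.ofReal (a / 2 * ‖gradient F (sgd v a x₁ ω n).val‖ ^ 2) ∂Pi) +
            ∑ t ∈ Finset.range n,
              ∫⁻ ω, ENNReal.ofReal (a / 2 * ‖gradient F (sgd v a x₁ ω t).val‖ ^ 2) ∂Pi := by ring
        _ ≤ _ := add_le_add_left (hstep n) _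
        _ = (∫⁻ ω, ENNReal.ofReal (F (sgd v a x₁ ω n).val - m) ∂Pi + ∑ t ∈ Finset.range n,
              ∫⁻ ω, ENNReal.ofReal (a / 2 * ‖gradient F (sgd v a x₁ ω t).val‖ ^ 2) ∂Pi) +
              ENNReal.ofReal R := by ring
        _ ≤ _ := add_le_add_left ih _
        _ = _ := by push_cast; ring
  have hjoint : Measurable fun q : (ℕ → α') × ℕ => ‖gradient F (output v a x₁ q)‖ₑ ^ 2 := by
    refine measurable_from_prod_countable_left fun t => ?_
    exact (hgc.measurable.comp (hx t)).enorm.pow_const 2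
  rw [lintegral_prod_symm _ hjoint.aemeasurable, lintegral_unif, ← Finset.mul_sum]
  have hT : (0 : ℝ) < (T : ℕ) := by exact_mod_cast T.pos
  have hconv : ∀ t, ∫⁻ ω, ‖gradient F (output v a x₁ (ω, t))‖ₑ ^ 2 ∂Pi =
      ENNReal.ofReal (2 / a) *
        ∫⁻ ω, ENNReal.ofReal (a / 2 * ‖gradient F (sgd v a x₁ ω t).val‖ ^ 2) ∂Pi := by
    intro t
    rw [← lintegral_const_mul' _ _ ENNReal.ofReal_ne_top]
    refine lintegral_congr fun ω => ?_
    rw [← ENNReal.ofReal_mul (by positivity), ← mul_assoc, div_mul_div_comm, mul_comm 2 a,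
      div_self (by positivity), one_mul, ENNReal.ofReal_pow (norm_nonneg _), ofReal_norm]
    rfl
  simp_rw [hconv]
  rw [← Finset.mul_sum]
  calc _ ≤ ((T : ℕ) : ℝ≥0∞)⁻¹ * (ENNReal.ofReal (2 / a) *
        (ENNReal.ofReal Δ + (T : ℕ) * ENNReal.ofReal R)) := by
        gcongr
        exact le_add_self.trans (hsum T)
    _ = ENNReal.ofReal (((T : ℕ) : ℝ)⁻¹ * (2 / a * (Δ + (T : ℕ) * R))) := by
        rw [ENNReal.ofReal_mul (by positivity), ENNReal.ofReal_mul (by positivity),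
          ENNReal.ofReal_add hΔ0 (by positivity), ENNReal.ofReal_mul (by positivity),
          ENNReal.ofReal_inv_of_pos hT, ENNReal.ofReal_natCast]
    _ = _ := by
        congr 1
        rw [hRdef]
        field_simp
        ring

end Problem

end CSBO
end

noncomputable section

namespace CSBO

instance : DecidableEq EtaIdx := Classical.decEq _

/-- The cross term integrates to zero because w is centred. -/
lemma lintegral_enorm_sub_smul_sq_le {Ω V : Type*} [MeasurableSpace Ω] [NormedAddCommGroup V]
    [InnerProductSpace ℝ V] [CompleteSpace V] {ν : Measure Ω} [IsProbabilityMeasure ν] {w : Ω → V}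
    (hw : AEStronglyMeasurable w ν) (hfin : ∫⁻ ω, ‖w ω‖ₑ ^ 2 ∂ν ≠ ∞) (h0 : ∫ ω, w ω ∂ν = 0)
    (u : V) (b : ℝ) :
    ∫⁻ ω, ‖u - b • w ω‖ₑ ^ 2 ∂ν ≤
      ENNReal.ofReal (‖u‖ ^ 2) + ENNReal.ofReal (b ^ 2) * ∫⁻ ω, ‖w ω‖ₑ ^ 2 ∂ν := by
  have hL2 : MemLp w 2 ν := by
    refine ⟨hw, ?_⟩
    rw [eLpNorm_lt_top_iff_lintegral_rpow_enorm_lt_top two_ne_zero ENNReal.ofNat_ne_top]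
    simpa using lt_top_iff_ne_top.mpr hfin
  have hi := hL2.integrable one_le_two
  have hi2 : Integrable (fun e => ‖w e‖ ^ 2) ν := hL2.integrable_norm_pow two_ne_zero
  have hii : Integrable (fun e => inner ℝ u (w e)) ν := hi.const_inner u
  have hexp : ∀ e, ‖u - b • w e‖ ^ 2 = ‖u‖ ^ 2 - 2 * b * inner ℝ u (w e) + b ^ 2 * ‖w e‖ ^ 2 := by
    intro e
    rw [norm_sub_sq_real, inner_smul_right, norm_smul, mul_pow, Real.norm_eq_abs, sq_abs]
    ring
  have hi1 : Integrable (fun e => ‖u‖ ^ 2 - 2 * b * inner ℝ u (w e)) ν :=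
    (integrable_const _).sub (hii.const_mul _)
  have hi3 : Integrable (fun e => ‖u‖ ^ 2 - 2 * b * inner ℝ u (w e) + b ^ 2 * ‖w e‖ ^ 2) ν :=
    hi1.add (hi2.const_mul _)
  have hconv : ∀ v : V, ‖v‖ₑ ^ 2 = ENNReal.ofReal (‖v‖ ^ 2) := fun v => by
    rw [ENNReal.ofReal_pow (norm_nonneg _), ofReal_norm]
  simp_rw [hconv, hexp]
  rw [← ofReal_integral_eq_lintegral_ofReal hi3 (ae_of_all _ fun e =>
      (sq_nonneg _).trans_eq (hexp e)), ← ofReal_integral_eq_lintegral_ofReal hi2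
      (ae_of_all _ fun e => sq_nonneg _), ← ENNReal.ofReal_mul (sq_nonneg _),
    ← ENNReal.ofReal_add (sq_nonneg _) (mul_nonneg (sq_nonneg _)
      (integral_nonneg fun e => sq_nonneg _)),
    integral_add hi1 (hi2.const_mul _), integral_sub (integrable_const _) (hii.const_mul _),
    integral_const_mul, integral_const_mul, integral_inner hi, h0]
  simp

namespace Problem

variable {dx dy : ℕ} {Ξ H : Type*} [MeasurableSpace Ξ] [MeasurableSpace H]

/-! ### EpochSGD -/

section Epoch

variable (P : Problem dx dy Ξ H) (β₀ : ℝ) (x : E dx) (ξ : Ξ)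

lemma epochSteps_val_succ (η : EtaIdx → H) (k : ℕ) (y : E dy) (j : ℕ) :
    (P.epochSteps β₀ x ξ η k y (j + 1)).val =
      ((P.epochSteps β₀ x ξ η k y j).val.1 - (β₀ * (2 : ℝ)⁻¹ ^ k) •
        P.grad2g x (P.epochSteps β₀ x ξ η k y j).val.1 (η (.epoch k j)) ξ,
      (P.epochSteps β₀ x ξ η k y j).val.2 + (P.epochSteps β₀ x ξ η k y j).val.1) := rfl

lemma epochSGD_val_succ (η : EtaIdx → H) (y : E dy) (K : ℕ) :
    (P.epochSGD β₀ x ξ η y (K + 1)).val =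
      ((P.epochSGD β₀ x ξ η y K).val.2, (2 : ℝ)⁻¹ ^ (K + 1) •
        (P.epochSteps β₀ x ξ η (K + 1) (P.epochSGD β₀ x ξ η y K).val.2 (2 ^ (K + 1))).val.2) := rfl

/-- Independence enters through such locality statements: an iterate does not see the sample used in
the next step, so that sample may be resampled. -/
lemma epochSteps_congr {η η' : EtaIdx → H} {k : ℕ} (y : E dy) {j : ℕ}
    (h : ∀ i < j, η (.epoch k i) = η' (.epoch k i)) :
    P.epochSteps β₀ x ξ η k y j = P.epochSteps β₀ x ξ η' k y j := by
  induction j with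
  | zero => rfl
  | succ j ih => rw [epochSteps, epochSteps, ih fun i hi => h i (by omega), h j (by omega)]

lemma epochSGD_congr {η η' : EtaIdx → H} (y : E dy) {K : ℕ}
    (h : ∀ k ≤ K, ∀ i, η (.epoch k i) = η' (.epoch k i)) :
    P.epochSGD β₀ x ξ η y K = P.epochSGD β₀ x ξ η' y K := by
  induction K with
  | zero => rfl
  | succ K ih =>
    rw [epochSGD, epochSGD, ih fun k hk => h k (by omega)]
    congr 1
    funext s
    rw [P.epochSteps_congr β₀ x ξ s.2 fun i _ => h (K + 1) le_rfl i]

lemma epochSteps_sum (η : EtaIdx → H) (k : ℕ) (y : E dy) (n : ℕ) :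
    (P.epochSteps β₀ x ξ η k y n).val.2 =
      ∑ j ∈ Finset.range n, (P.epochSteps β₀ x ξ η k y j).val.1 := by
  induction n with
  | zero => rfl
  | succ n ih => rw [Finset.sum_range_succ, ← ih, epochSteps_val_succ]

end Epoch

namespace Regular

variable {P : Problem dx dy Ξ H} {c : Constants} {y₀ : E dx → E dy}

lemma measurable_epochSteps (hP : P.Regular c y₀) (β₀ : ℝ) (k j : ℕ) {Ω : Type*}
    [MeasurableSpace Ω] {X : Ω → E dx} {Z : Ω → Ξ} {η : Ω → EtaIdx → H} {Y : Ω → E dy}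
    (hX : Measurable X) (hZ : Measurable Z) (hη : Measurable η) (hY : Measurable Y) :
    Measurable fun ω => (P.epochSteps β₀ (X ω) (Z ω) (η ω) k (Y ω) j).val := by
  induction j with
  | zero => exact hY.prodMk measurable_const
  | succ j ih =>
    simp_rw [epochSteps_val_succ]
    have hg : Measurable fun ω => P.grad2g (X ω)
        (P.epochSteps β₀ (X ω) (Z ω) (η ω) k (Y ω) j).val.1 (η ω (.epoch k j)) (Z ω) :=
      hP.measurable_grad2g.comp ((hX.prodMk ih.fst).prodMk
        (hZ.prodMk ((measurable_pi_apply _).comp hη)))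
    exact (ih.fst.sub (hg.const_smul (β₀ * (2 : ℝ)⁻¹ ^ k))).prodMk (ih.snd.add ih.fst)

lemma measurable_epochSGD (hP : P.Regular c y₀) (β₀ : ℝ) (K : ℕ) {Ω : Type*}
    [MeasurableSpace Ω] {X : Ω → E dx} {Z : Ω → Ξ} {η : Ω → EtaIdx → H} {Y : Ω → E dy}
    (hX : Measurable X) (hZ : Measurable Z) (hη : Measurable η) (hY : Measurable Y) :
    Measurable fun ω => (P.epochSGD β₀ (X ω) (Z ω) (η ω) (Y ω) K).val := by
  induction K with
  | zero => exact hY.prodMk hY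
  | succ K ih =>
    simp_rw [epochSGD_val_succ]
    exact ih.snd.prodMk
      ((hP.measurable_epochSteps β₀ (K + 1) (2 ^ (K + 1)) hX hZ hη ih.snd).snd.const_smul
        ((2 : ℝ)⁻¹ ^ (K + 1)))

/-- The step is the mean gradient step plus centred noise. As the mean gradient vanishes at y*,
strong monotonicity gives -2bμ and the Lipschitz bound gives b²Lg1². -/
lemma lintegral_step_sq_le (hP : P.Regular c y₀) (x : E dx) (ξ : Ξ) (y : E dy) {b : ℝ}
    (hb : 0 ≤ b) :
    ∫⁻ e, ‖y - b • P.grad2g x y e ξ - P.yStar x ξ‖ₑ ^ 2 ∂P.lawEta ξ ≤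
      ENNReal.ofReal ((1 - 2 * b * c.μ + b ^ 2 * c.Lg1 ^ 2) * ‖y - P.yStar x ξ‖ ^ 2) +
        ENNReal.ofReal (b ^ 2 * c.σg ^ 2) := by
  set m := P.mean2g x y ξ with hm
  have hi := hP.integrable_grad2g x y ξ
  have h := lintegral_enorm_sub_smul_sq_le (ν := P.lawEta ξ)
    (w := fun e => P.grad2g x y e ξ - m) (hi.aestronglyMeasurable.sub aestronglyMeasurable_const)
    ((hP.variance_grad2g_le x y ξ).trans_lt (by simp)).ne
    (by rw [integral_sub hi (integrable_const _)]; simp [hm, mean2g])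
    (y - P.yStar x ξ - b • m) b
  have e1 : ∀ e, y - P.yStar x ξ - b • m - b • (P.grad2g x y e ξ - m) =
      y - b • P.grad2g x y e ξ - P.yStar x ξ := fun e => by rw [smul_sub]; abel
  simp_rw [e1] at h
  refine h.trans (add_le_add (ENNReal.ofReal_le_ofReal ?_) ?_)
  · have h1 := hP.mean2g_monotone x y (P.yStar x ξ) ξ
    have h2 := hP.norm_mean2g_sub_le x x y (P.yStar x ξ) ξ
    rw [hP.mean2g_yStar, sub_zero, ← hm] at h1 h2
    rw [sub_self, norm_zero, zero_add] at h2
    have h3 : ‖m‖ ^ 2 ≤ (c.Lg1 * ‖y - P.yStar x ξ‖) ^ 2 := by gcongr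
    rw [norm_sub_sq_real, inner_smul_right, norm_smul, mul_pow, Real.norm_of_nonneg hb,
      real_inner_comm]
    have h4 := mul_le_mul_of_nonneg_left h1 hb
    have h5 := mul_le_mul_of_nonneg_left h3 (sq_nonneg b)
    linarith
  · rw [ENNReal.ofReal_mul (sq_nonneg _)]
    gcongr
    refine (hP.variance_grad2g_le x y ξ).trans_eq ?_
    rw [ENNReal.ofReal_pow (NNReal.coe_nonneg _), ENNReal.ofReal_coe_nnreal]

/-- The mean squared error of the iterate `y_k^j`, where epoch `k` starts at `Y`. -/
def stepError (P : Problem dx dy Ξ H) (β₀ : ℝ) (x : E dx) (ξ : Ξ) (k : ℕ)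
    (Y : (EtaIdx → H) → E dy) (j : ℕ) : ℝ≥0∞ :=
  ∫⁻ η, ‖(P.epochSteps β₀ x ξ η k (Y η) j).val.1 - P.yStar x ξ‖ₑ ^ 2 ∂P.etaLaw ξ

/-- The sample of step j is resampled; `hYk` says that the starting point of the epoch ignores the
samples of that epoch. The factor stays inside the integral because it could be negative on the zero
space, where μ ≤ Lg1 may fail. -/
lemma stepError_succ_le (hP : P.Regular c y₀) {β₀ : ℝ} (hβ : 0 ≤ β₀) (x : E dx) (ξ : Ξ) (k : ℕ)
    {Y : (EtaIdx → H) → E dy} (hY : Measurable Y)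
    (hYk : ∀ η j e, Y (Function.update η (.epoch k j) e) = Y η) (j : ℕ) :
    stepError P β₀ x ξ k Y (j + 1) ≤
      ∫⁻ η, ENNReal.ofReal ((1 - 2 * (β₀ * (2 : ℝ)⁻¹ ^ k) * c.μ +
        (β₀ * (2 : ℝ)⁻¹ ^ k) ^ 2 * c.Lg1 ^ 2) *
          ‖(P.epochSteps β₀ x ξ η k (Y η) j).val.1 - P.yStar x ξ‖ ^ 2) ∂P.etaLaw ξ +
        ENNReal.ofReal ((β₀ * (2 : ℝ)⁻¹ ^ k) ^ 2 * c.σg ^ 2) := by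
  set b := β₀ * (2 : ℝ)⁻¹ ^ k
  have hb : 0 ≤ b := by positivity
  have hA : Measurable fun η => (P.epochSteps β₀ x ξ η k (Y η) j).val.1 :=
    (hP.measurable_epochSteps β₀ k j measurable_const measurable_const measurable_id hY).fst
  have hφ : Measurable fun q : E dy × H => ‖q.1 - b • P.grad2g x q.1 q.2 ξ - P.yStar x ξ‖ₑ ^ 2 := by
    have hg : Measurable fun q : E dy × H => P.grad2g x q.1 q.2 ξ :=
      hP.measurable_grad2g.comp ((measurable_const.prodMk measurable_fst).prodMk
        (measurable_const.prodMk measurable_snd))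
    exact ((measurable_fst.sub (hg.const_smul b)).sub_const _).enorm.pow_const 2
  have h := lintegral_resample (P.lawEta ξ) (.epoch k j)
    (A := fun η => (P.epochSteps β₀ x ξ η k (Y η) j).val.1)
    (φ := fun y e => ‖y - b • P.grad2g x y e ξ - P.yStar x ξ‖ₑ ^ 2) hA hφ fun η e => by
      rw [hYk, P.epochSteps_congr β₀ x ξ (Y η) (η' := η)]
      intro i hi
      exact Function.update_of_ne (by simpa using hi.ne) _ _
  unfold stepError
  simp_rw [epochSteps_val_succ]
  change ∫⁻ η, _ ∂(Measure.infinitePi fun _ : EtaIdx => P.lawEta ξ) ≤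
    ∫⁻ η, _ ∂(Measure.infinitePi fun _ : EtaIdx => P.lawEta ξ) + _
  rw [h]
  refine (lintegral_mono fun η => hP.lintegral_step_sq_le x ξ _ hb).trans_eq ?_
  rw [lintegral_add_right _ measurable_const, lintegral_const, measure_univ, mul_one]

lemma lintegral_ofReal_mul_norm_sq {Ω V : Type*} [MeasurableSpace Ω] [NormedAddCommGroup V]
    {ν : Measure Ω} {a : ℝ} (ha : 0 ≤ a) (u : Ω → V) :
    ∫⁻ ω, ENNReal.ofReal (a * ‖u ω‖ ^ 2) ∂ν = ENNReal.ofReal a * ∫⁻ ω, ‖u ω‖ₑ ^ 2 ∂ν := by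
  rw [← lintegral_const_mul' _ _ ENNReal.ofReal_ne_top]
  refine lintegral_congr fun ω => ?_
  rw [ENNReal.ofReal_mul ha, ENNReal.ofReal_pow (norm_nonneg _), ofReal_norm]

/-- One step with an arbitrary stepsize. -/
lemma stepError_succ_le_mul (hP : P.Regular c y₀) {β₀ : ℝ} (hβ : 0 ≤ β₀) (x : E dx) (ξ : Ξ)
    (k : ℕ) {Y : (EtaIdx → H) → E dy} (hY : Measurable Y)
    (hYk : ∀ η j e, Y (Function.update η (.epoch k j) e) = Y η) (j : ℕ) :
    stepError P β₀ x ξ k Y (j + 1) ≤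
      ENNReal.ofReal (1 + β₀ ^ 2 * c.Lg1 ^ 2) * stepError P β₀ x ξ k Y j +
        ENNReal.ofReal (β₀ ^ 2 * c.σg ^ 2) := by
  have hμ := c.μ_pos
  have hb : β₀ * (2 : ℝ)⁻¹ ^ k ≤ β₀ :=
    mul_le_of_le_one_right hβ (pow_le_one₀ (by norm_num) (by norm_num))
  have hb0 : 0 ≤ β₀ * (2 : ℝ)⁻¹ ^ k := by positivity
  refine (hP.stepError_succ_le hβ x ξ k hY hYk j).trans (add_le_add ?_ ?_)
  · rw [stepError, ← lintegral_ofReal_mul_norm_sq (by positivity)]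
    refine lintegral_mono fun η => ENNReal.ofReal_le_ofReal ?_
    gcongr
    have h1 : (β₀ * (2 : ℝ)⁻¹ ^ k) ^ 2 * (c.Lg1 : ℝ) ^ 2 ≤ β₀ ^ 2 * (c.Lg1 : ℝ) ^ 2 := by gcongr
    have h2 : 0 ≤ 2 * (β₀ * (2 : ℝ)⁻¹ ^ k) * c.μ := by positivity
    linarith
  · apply ENNReal.ofReal_le_ofReal
    gcongr

/-- One step with a small stepsize. -/
lemma stepError_succ_add_le (hP : P.Regular c y₀) {β₀ : ℝ} (hβ : 0 ≤ β₀) (x : E dx) (ξ : Ξ)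
    (k : ℕ) (hk : β₀ * (2 : ℝ)⁻¹ ^ k * c.Lg1 ^ 2 ≤ c.μ)
    {Y : (EtaIdx → H) → E dy} (hY : Measurable Y)
    (hYk : ∀ η j e, Y (Function.update η (.epoch k j) e) = Y η) (j : ℕ) :
    stepError P β₀ x ξ k Y (j + 1) +
      ENNReal.ofReal (β₀ * (2 : ℝ)⁻¹ ^ k * c.μ) * stepError P β₀ x ξ k Y j ≤
      stepError P β₀ x ξ k Y j + ENNReal.ofReal ((β₀ * (2 : ℝ)⁻¹ ^ k) ^ 2 * c.σg ^ 2) := by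
  have hμ := c.μ_pos
  set b := β₀ * (2 : ℝ)⁻¹ ^ k with hbdef
  have hb : 0 ≤ b := by positivity
  have hm : Measurable fun η =>
      ENNReal.ofReal (b * c.μ * ‖(P.epochSteps β₀ x ξ η k (Y η) j).val.1 - P.yStar x ξ‖ ^ 2) :=
    (((((hP.measurable_epochSteps β₀ k j measurable_const measurable_const measurable_id
      hY).fst).sub_const _).norm.pow_const 2).const_mul _).ennreal_ofReal
  refine (add_le_add_left (hP.stepError_succ_le hβ x ξ k hY hYk j) _).trans ?_
  rw [stepError, ← lintegral_ofReal_mul_norm_sq (by positivity : 0 ≤ b * c.μ), add_right_comm,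
    ← lintegral_add_right _ hm]
  gcongr with η
  set r := ‖(P.epochSteps β₀ x ξ η k (Y η) j).val.1 - P.yStar x ξ‖ with hr
  rw [← ofReal_norm, ← hr, ← ENNReal.ofReal_pow (norm_nonneg _)]
  -- The small stepsize lets one of the two copies of bμ absorb b²Lg1²; the other copy stays on the
  -- left-hand side.
  have h1 : b * (b * (c.Lg1 : ℝ) ^ 2) ≤ b * c.μ := by gcongr
  have h2 : c.μ * r ≤ c.Lg1 * r := by
    have h3 := hP.norm_mean2g_sub_le x x (P.epochSteps β₀ x ξ η k (Y η) j).val.1 (P.yStar x ξ) ξ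
    rw [sub_self, norm_zero, zero_add] at h3
    exact (hP.norm_sub_le_of_mean2g x ξ _ _).trans h3
  have h4 : (c.μ * r) ^ 2 ≤ (c.Lg1 * r) ^ 2 := by gcongr
  have h5 := mul_le_mul_of_nonneg_left h4 (sq_nonneg b)
  -- By μr ≤ Lg1·r the expression dominates ((1 - bμ)r)².
  have h7 : 0 ≤ (1 - 2 * b * c.μ + b ^ 2 * (c.Lg1 : ℝ) ^ 2) * r ^ 2 := by
    nlinarith [sq_nonneg ((1 - b * c.μ) * r)]
  rw [← ENNReal.ofReal_add h7 (by positivity)]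
  apply ENNReal.ofReal_le_ofReal
  have h6 := mul_le_mul_of_nonneg_right h1 (sq_nonneg r)
  change (1 - 2 * b * c.μ + b ^ 2 * (c.Lg1 : ℝ) ^ 2) * r ^ 2 + b * c.μ * r ^ 2 ≤ r ^ 2
  linarith

end Regular

end Problem

end CSBO
end

noncomputable section

namespace CSBO

/-! ### Averaging over an epoch and the rate of EpochSGD -/

/-- Convexity of the squared norm, via Cauchy–Schwarz; the factor n on the left avoids a division in
`ENNReal`. -/
lemma mul_enorm_smul_sum_sub_sq_le {V : Type*} [NormedAddCommGroup V] [InnerProductSpace ℝ V]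
    {n : ℕ} (hn : 0 < n) (u : ℕ → V) (v : V) {r : ℝ} (hr : r = ((n : ℝ))⁻¹) :
    (n : ℝ≥0∞) * ‖r • ∑ j ∈ Finset.range n, u j - v‖ₑ ^ 2 ≤
      ∑ j ∈ Finset.range n, ‖u j - v‖ₑ ^ 2 := by
  have hn' : (0 : ℝ) < n := by exact_mod_cast hn
  have e : r • ∑ j ∈ Finset.range n, u j - v = r • ∑ j ∈ Finset.range n, (u j - v) := by
    rw [Finset.sum_sub_distrib, smul_sub, Finset.sum_const, Finset.card_range,
      ← Nat.cast_smul_eq_nsmul ℝ, smul_smul, hr, inv_mul_cancel₀ hn'.ne', one_smul]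
  have hconv : ∀ v : V, ‖v‖ₑ ^ 2 = ENNReal.ofReal (‖v‖ ^ 2) := fun v => by
    rw [ENNReal.ofReal_pow (norm_nonneg _), ofReal_norm]
  simp_rw [hconv]
  rw [← ENNReal.ofReal_sum_of_nonneg fun _ _ => sq_nonneg _, ← ENNReal.ofReal_natCast,
    ← ENNReal.ofReal_mul hn'.le]
  apply ENNReal.ofReal_le_ofReal
  rw [e, norm_smul, mul_pow, hr, Real.norm_of_nonneg (by positivity)]
  have h1 : ‖∑ j ∈ Finset.range n, (u j - v)‖ ^ 2 ≤ (∑ j ∈ Finset.range n, ‖u j - v‖) ^ 2 := by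
    gcongr; exact norm_sum_le _ _
  have h2 := sq_sum_le_card_mul_sum_sq (s := Finset.range n) (f := fun j => ‖u j - v‖)
  rw [Finset.card_range] at h2
  calc (n : ℝ) * ((n : ℝ)⁻¹ ^ 2 * ‖∑ j ∈ Finset.range n, (u j - v)‖ ^ 2)
      ≤ n * ((n : ℝ)⁻¹ ^ 2 * (n * ∑ j ∈ Finset.range n, ‖u j - v‖ ^ 2)) := by
        gcongr; exact h1.trans h2
    _ = _ := by field_simp

/-- A recursion with contraction factor `1/4` and geometric noise from some index on. -/
lemma exists_geometric_bound (A D : ℝ≥0) (M D' : ℕ → ℝ≥0) (k₀ : ℕ) :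
    ∃ R : ℝ≥0, ∀ a : ℕ → ℝ≥0∞, a 0 ≤ A → (∀ k, a (k + 1) ≤ M k * a k + D' k) →
      (∀ k ≥ k₀, 4 * a (k + 1) ≤ a k + D * (2 : ℝ≥0∞)⁻¹ ^ k) →
      ∀ k, a k ≤ R * (2 : ℝ≥0∞)⁻¹ ^ k := by
  -- For each single index the crude recursion gives a bound independent of the sequence a.
  have h1 : ∀ k, ∃ r : ℝ≥0, ∀ a : ℕ → ℝ≥0∞, a 0 ≤ A → (∀ k, a (k + 1) ≤ M k * a k + D' k) →
      a k ≤ r := by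
    intro k
    induction k with
    | zero => exact ⟨A, fun a h _ => h⟩
    | succ k ih =>
      obtain ⟨r, hr⟩ := ih
      refine ⟨M k * r + D' k, fun a h0 h => (h k).trans ?_⟩
      push_cast
      gcongr
      exact hr a h0 h
  choose r hr using h1
  -- The sum dominates a_k 2^k for all k ≤ k₀; the summand D serves the induction beyond k₀.
  refine ⟨D + ∑ k ∈ Finset.range (k₀ + 1), r k * 2 ^ k, fun a h0 h h4 k => ?_⟩
  set R : ℝ≥0 := D + ∑ k ∈ Finset.range (k₀ + 1), r k * 2 ^ k
  have hinv : ∀ k : ℕ, (2 : ℝ≥0∞) ^ k * (2 : ℝ≥0∞)⁻¹ ^ k = 1 := fun k => by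
    rw [← mul_pow, ENNReal.mul_inv_cancel two_ne_zero ENNReal.ofNat_ne_top, one_pow]
  have hsmall : ∀ k ≤ k₀, a k ≤ R * (2 : ℝ≥0∞)⁻¹ ^ k := by
    intro k hk
    have h5 : r k * 2 ^ k ≤ R :=
      (Finset.single_le_sum (f := fun k => r k * 2 ^ k) (fun _ _ => zero_le)
        (Finset.mem_range.mpr (by omega))).trans le_add_self
    calc a k ≤ r k := hr k a h0 h
      _ = (r k * 2 ^ k : ℝ≥0) * (2 : ℝ≥0∞)⁻¹ ^ k := by
        push_cast; rw [mul_assoc, hinv, mul_one]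
      _ ≤ _ := by gcongr
  rcases le_total k k₀ with hk | hk
  · exact hsmall k hk
  · induction k, hk using Nat.le_induction with
    | base => exact hsmall k₀ le_rfl
    | succ k hk ih =>
      have hD : (D : ℝ≥0∞) ≤ R := by exact_mod_cast le_self_add
      -- R 2^(-k) for the old error plus R 2^(-k) for the noise is exactly 4 R 2^(-(k+1)).
      have h6 : 4 * a (k + 1) ≤ 4 * (R * (2 : ℝ≥0∞)⁻¹ ^ (k + 1)) := by
        calc 4 * a (k + 1) ≤ a k + D * (2 : ℝ≥0∞)⁻¹ ^ k := h4 k hk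
          _ ≤ R * (2 : ℝ≥0∞)⁻¹ ^ k + R * (2 : ℝ≥0∞)⁻¹ ^ k := by gcongr
          _ = 2 * (2 * (2 : ℝ≥0∞)⁻¹) * (R * (2 : ℝ≥0∞)⁻¹ ^ k) := by
            rw [ENNReal.mul_inv_cancel two_ne_zero ENNReal.ofNat_ne_top]; ring
          _ = _ := by ring
      exact (ENNReal.mul_le_mul_iff_right (by norm_num) (by norm_num)).mp h6

namespace Problem.Regular

variable {dx dy : ℕ} {Ξ H : Type*} [MeasurableSpace Ξ] [MeasurableSpace H]
  {P : Problem dx dy Ξ H} {c : Constants} {y₀ : E dx → E dy}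

/-- The mean squared error of the initial iterate `y_(k+1)^0` of epoch `k + 1`. -/
def epochError (P : Problem dx dy Ξ H) (β₀ : ℝ) (y₀ : E dx → E dy) (x : E dx) (ξ : Ξ)
    (k : ℕ) : ℝ≥0∞ :=
  ∫⁻ η, ‖(P.epochSGD β₀ x ξ η (y₀ x) k).val.2 - P.yStar x ξ‖ₑ ^ 2 ∂P.etaLaw ξ

lemma measurable_epochStart (hP : P.Regular c y₀) {β₀ : ℝ} (x : E dx) (ξ : Ξ) (k : ℕ) :
    Measurable fun η => (P.epochSGD β₀ x ξ η (y₀ x) k).val.2 :=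
  (hP.measurable_epochSGD β₀ k measurable_const measurable_const measurable_id
    measurable_const).snd

/-- The start of the next epoch is the average of the 2^(k+1) iterates of epoch k + 1, the final
iterate excluded. -/
lemma epochError_succ_le (hP : P.Regular c y₀) {β₀ : ℝ} (x : E dx) (ξ : Ξ) (k : ℕ) :
    ((2 ^ (k + 1) : ℕ) : ℝ≥0∞) * epochError P β₀ y₀ x ξ (k + 1) ≤
      ∑ j ∈ Finset.range (2 ^ (k + 1)),
        stepError P β₀ x ξ (k + 1) (fun η => (P.epochSGD β₀ x ξ η (y₀ x) k).val.2) j := by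
  have hm : ∀ j, Measurable fun η => ‖(P.epochSteps β₀ x ξ η (k + 1)
      (P.epochSGD β₀ x ξ η (y₀ x) k).val.2 j).val.1 - P.yStar x ξ‖ₑ ^ 2 := fun j =>
    ((hP.measurable_epochSteps β₀ (k + 1) j measurable_const measurable_const measurable_id
      (hP.measurable_epochStart x ξ k)).fst.sub_const _).enorm.pow_const 2
  unfold stepError
  rw [← lintegral_finsetSum _ fun j _ => hm j, epochError,
    ← lintegral_const_mul' _ _ (ENNReal.natCast_ne_top _)]
  refine lintegral_mono fun η => ?_
  rw [epochSGD_val_succ]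
  simp only [epochSteps_sum]
  exact mul_enorm_smul_sum_sub_sq_le (by positivity) _ _ (by push_cast; rw [inv_pow])

lemma epochStart_update {β₀ : ℝ} (x : E dx) (ξ : Ξ) (k : ℕ) (η : EtaIdx → H) (j : ℕ) (e : H) :
    (P.epochSGD β₀ x ξ (Function.update η (.epoch (k + 1) j) e) (y₀ x) k).val.2 =
      (P.epochSGD β₀ x ξ η (y₀ x) k).val.2 := by
  rw [P.epochSGD_congr β₀ x ξ (y₀ x) (η' := η)]
  intro i hi l
  refine Function.update_of_ne ?_ _ _
  rw [ne_eq, EtaIdx.epoch.injEq]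
  omega

/-- A crude growth bound without any stepsize restriction, for the finitely many early epochs. -/
lemma epochError_succ_le_mul (hP : P.Regular c y₀) {β₀ : ℝ} (x : E dx) (ξ : Ξ) (k : ℕ)
    (hβ : 0 ≤ β₀) :
    epochError P β₀ y₀ x ξ (k + 1) ≤
      ENNReal.ofReal (1 + β₀ ^ 2 * c.Lg1 ^ 2) ^ 2 ^ (k + 1) *
        (epochError P β₀ y₀ x ξ k + (2 ^ (k + 1) : ℕ) * ENNReal.ofReal (β₀ ^ 2 * c.σg ^ 2)) := by
  set M := ENNReal.ofReal (1 + β₀ ^ 2 * c.Lg1 ^ 2)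
  set D := ENNReal.ofReal (β₀ ^ 2 * c.σg ^ 2)
  set Y := fun η => (P.epochSGD β₀ x ξ η (y₀ x) k).val.2 with hY
  have hM : 1 ≤ M := by
    rw [← ENNReal.ofReal_one]
    exact ENNReal.ofReal_le_ofReal (by have := sq_nonneg (β₀ * c.Lg1); nlinarith)
  have h : ∀ j, stepError P β₀ x ξ (k + 1) Y j ≤
      M ^ j * (epochError P β₀ y₀ x ξ k + j * D) := by
    intro j
    induction j with
    | zero => simp [stepError, epochError, epochSteps, Counted.pure, Y]
    | succ j ih =>
      calc _ ≤ M * stepError P β₀ x ξ (k + 1) Y j + D :=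
            hP.stepError_succ_le_mul hβ x ξ (k + 1) (hP.measurable_epochStart x ξ k)
              (epochStart_update x ξ k) j
        _ ≤ M * (M ^ j * (epochError P β₀ y₀ x ξ k + j * D)) + M ^ (j + 1) * D := by
            gcongr
            exact le_mul_of_one_le_left zero_le (one_le_pow₀ hM)
        _ = _ := by push_cast; ring
  have h2 := (hP.epochError_succ_le (β₀ := β₀) x ξ k).trans (Finset.sum_le_sum fun j hj =>
    (h j).trans (show M ^ j * (epochError P β₀ y₀ x ξ k + j * D) ≤ M ^ 2 ^ (k + 1) *
      (epochError P β₀ y₀ x ξ k + (2 ^ (k + 1) : ℕ) * D) by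
        have := (Finset.mem_range.mp hj).le
        gcongr))
  rw [Finset.sum_const, Finset.card_range, nsmul_eq_mul] at h2
  exact (ENNReal.mul_le_mul_iff_right (by simp) (ENNReal.natCast_ne_top _)).mp h2

/-- Summing the small-step inequality over the epoch gives bμ Σ err_j ≤ err_start + 2^(k+1) b²σ².
With 2^(k+1) b = β₀ and β₀μ ≥ 4, the left side exceeds four times the averaged error, and the noise
is β₀bσ², of order 2^(-k). -/
lemma four_mul_epochError_succ_le (hP : P.Regular c y₀) {β₀ : ℝ} (x : E dx) (ξ : Ξ) (k : ℕ)
    (hβ : 4 / c.μ ≤ β₀)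
    (hk : β₀ * (2 : ℝ)⁻¹ ^ (k + 1) * c.Lg1 ^ 2 ≤ c.μ) :
    4 * epochError P β₀ y₀ x ξ (k + 1) ≤ epochError P β₀ y₀ x ξ k +
      ENNReal.ofReal (β₀ ^ 2 * c.σg ^ 2) * (2 : ℝ≥0∞)⁻¹ ^ k := by
  have hμ := c.μ_pos
  have hβ0 : 0 ≤ β₀ := (by positivity : 0 ≤ 4 / c.μ).trans hβ
  set Y := fun η => (P.epochSGD β₀ x ξ η (y₀ x) k).val.2 with hY
  set b := β₀ * (2 : ℝ)⁻¹ ^ (k + 1) with hb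
  have h : ∀ n : ℕ, stepError P β₀ x ξ (k + 1) Y n + ENNReal.ofReal (b * c.μ) *
      ∑ j ∈ Finset.range n, stepError P β₀ x ξ (k + 1) Y j ≤
      epochError P β₀ y₀ x ξ k + n * ENNReal.ofReal (b ^ 2 * c.σg ^ 2) := by
    intro n
    induction n with
    | zero => simp [stepError, epochError, epochSteps, Counted.pure, Y]
    | succ n ih =>
      rw [Finset.sum_range_succ]
      calc _ = stepError P β₀ x ξ (k + 1) Y (n + 1) +
              ENNReal.ofReal (b * c.μ) * stepError P β₀ x ξ (k + 1) Y n +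
            ENNReal.ofReal (b * c.μ) *
              ∑ j ∈ Finset.range n, stepError P β₀ x ξ (k + 1) Y j := by ring
        _ ≤ stepError P β₀ x ξ (k + 1) Y n + ENNReal.ofReal (b ^ 2 * c.σg ^ 2) +
            ENNReal.ofReal (b * c.μ) *
              ∑ j ∈ Finset.range n, stepError P β₀ x ξ (k + 1) Y j := by
            refine add_le_add_left ?_ _
            exact hP.stepError_succ_add_le hβ0 x ξ (k + 1) hk (hP.measurable_epochStart x ξ k)
              (epochStart_update x ξ k) n
        _ = stepError P β₀ x ξ (k + 1) Y n + ENNReal.ofReal (b * c.μ) *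
              ∑ j ∈ Finset.range n, stepError P β₀ x ξ (k + 1) Y j +
            ENNReal.ofReal (b ^ 2 * c.σg ^ 2) := by ring
        _ ≤ _ := add_le_add_left ih _
        _ = _ := by push_cast; ring
  have h2pos : (0 : ℝ) < 2 ^ (k + 1) := by positivity
  have hcast : ((2 ^ (k + 1) : ℕ) : ℝ≥0∞) = ENNReal.ofReal (2 ^ (k + 1)) := by
    rw [← ENNReal.ofReal_natCast]; push_cast; rfl
  have hbn : b * 2 ^ (k + 1) = β₀ := by
    rw [hb, mul_assoc, ← mul_pow]; norm_num
  calc 4 * epochError P β₀ y₀ x ξ (k + 1)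
      ≤ ENNReal.ofReal (b * c.μ) *
          (((2 ^ (k + 1) : ℕ) : ℝ≥0∞) * epochError P β₀ y₀ x ξ (k + 1)) := by
        rw [← mul_assoc, hcast, ← ENNReal.ofReal_mul (by positivity)]
        gcongr
        rw [show b * c.μ * 2 ^ (k + 1) = β₀ * c.μ by rw [← hbn]; ring,
          show (4 : ℝ≥0∞) = ENNReal.ofReal 4 by simp]
        apply ENNReal.ofReal_le_ofReal
        rwa [div_le_iff₀ hμ] at hβ
    _ ≤ ENNReal.ofReal (b * c.μ) *
          ∑ j ∈ Finset.range (2 ^ (k + 1)), stepError P β₀ x ξ (k + 1) Y j := by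
        gcongr
        exact hP.epochError_succ_le x ξ k
    _ ≤ _ := le_add_self.trans (h (2 ^ (k + 1)))
    _ ≤ _ := by
        refine add_le_add_right ?_ _
        rw [hcast, ← ENNReal.ofReal_mul h2pos.le,
          show (2 : ℝ≥0∞)⁻¹ = ENNReal.ofReal 2⁻¹ by
            rw [ENNReal.ofReal_inv_of_pos two_pos]; simp,
          ← ENNReal.ofReal_pow (by norm_num), ← ENNReal.ofReal_mul (by positivity)]
        apply ENNReal.ofReal_le_ofReal
        have e : 2 ^ (k + 1) * (b ^ 2 * (c.σg : ℝ) ^ 2) =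
            β₀ ^ 2 * (c.σg : ℝ) ^ 2 * (2 : ℝ)⁻¹ ^ (k + 1) := by
          rw [show 2 ^ (k + 1) * (b ^ 2 * (c.σg : ℝ) ^ 2) =
            (b * 2 ^ (k + 1)) * b * (c.σg : ℝ) ^ 2 by ring, hbn, hb]
          ring
        rw [e]
        gcongr _ * ?_
        exact pow_le_pow_of_le_one (by norm_num) (by norm_num) (Nat.le_succ k)

/-- EpochSGD converges at rate `2^(-k)`, with constants that do not depend on the problem. -/
theorem _root_.CSBO.exists_epochError_bound (c : Constants) {β₀ : ℝ} (hβ : 4 / c.μ ≤ β₀) :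
    ∃ R : ℝ≥0, ∀ {dx dy : ℕ} {Ξ : Type*} {H : Type*} [MeasurableSpace Ξ] [MeasurableSpace H]
      {P : Problem dx dy Ξ H} {y₀ : E dx → E dy}, P.Regular c y₀ → ∀ x ξ k,
      epochError P β₀ y₀ x ξ k ≤ R * (2 : ℝ≥0∞)⁻¹ ^ k := by
  have hμ := c.μ_pos
  have hβ0 : 0 ≤ β₀ := (by positivity : 0 ≤ 4 / c.μ).trans hβ
  -- The threshold beyond which stepsizes are small depends only on β₀, μ and Lg1, so R can be
  -- chosen before the problem.
  obtain ⟨k₀, hk₀⟩ : ∃ k₀ : ℕ, ∀ k ≥ k₀, β₀ * (2 : ℝ)⁻¹ ^ (k + 1) * c.Lg1 ^ 2 ≤ c.μ := by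
    have ht : Filter.Tendsto (fun k : ℕ => β₀ * (2 : ℝ)⁻¹ ^ (k + 1) * (c.Lg1 : ℝ) ^ 2)
        Filter.atTop (nhds (β₀ * 0 * (c.Lg1 : ℝ) ^ 2)) :=
      (((tendsto_pow_atTop_nhds_zero_of_lt_one (by norm_num) (by norm_num)).comp
        (Filter.tendsto_add_atTop_nat 1)).const_mul β₀).mul_const _
    rw [mul_zero, zero_mul] at ht
    obtain ⟨k₀, h⟩ := Filter.eventually_atTop.mp (ht.eventually_le_const hμ)
    exact ⟨k₀, h⟩
  set M := Real.toNNReal (1 + β₀ ^ 2 * c.Lg1 ^ 2)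
  set D := Real.toNNReal (β₀ ^ 2 * c.σg ^ 2)
  obtain ⟨R, hR⟩ := exists_geometric_bound (Real.toNNReal ((c.Lg0 / c.μ) ^ 2)) D
    (fun k => M ^ 2 ^ (k + 1)) (fun k => M ^ 2 ^ (k + 1) * (2 ^ (k + 1) * D)) k₀
  refine ⟨R, fun {dx dy Ξ H} _ _ {P y₀} hP x ξ => hR _ ?_ (fun k => ?_) fun k hk => ?_⟩
  · simp only [epochError, epochSGD, Counted.pure, lintegral_const, measure_univ, mul_one]
    rw [← ofReal_norm, ← ENNReal.ofReal_pow (norm_nonneg _)]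
    apply ENNReal.ofReal_le_ofReal
    gcongr
    exact hP.norm_init_sub_yStar_le x ξ
  · refine (hP.epochError_succ_le_mul x ξ k hβ0).trans_eq ?_
    push_cast
    rw [mul_add]
    rfl
  · exact hP.four_mul_epochError_succ_le x ξ k hβ (hk₀ k hk)

end Problem.Regular

end CSBO
end

noncomputable section

namespace CSBO

/-! ### Constants of the Neumann series and of the gradient components -/

namespace Constants

/-- The contraction factor of the Neumann series. -/
def ρ (c : Constants) : ℝ := √(1 - min c.μ c.Lg1 / (2 * c.Lg1))

lemma ρ_nonneg (c : Constants) : 0 ≤ c.ρ := Real.sqrt_nonneg _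

lemma ρ_lt_one (c : Constants) : c.ρ < 1 := by
  have h1 := c.μ_pos
  have h2 : (0 : ℝ) < c.Lg1 := c.Lg1_pos
  rw [ρ, Real.sqrt_lt' one_pos, one_pow]
  have : 0 < min c.μ c.Lg1 / (2 * c.Lg1) := by have := lt_min h1 h2; positivity
  linarith

/-- A constant in the Lipschitz constant of the gradient components. -/
def compLip (c : Constants) : ℝ :=
  c.Lf1 + c.Lg2 * c.Lf0 / (2 * c.Lg1) + (c.Lf1 + c.Lg2 * c.Lf0 / (2 * c.Lg1)) / 2

lemma compLip_nonneg (c : Constants) : 0 ≤ c.compLip := by unfold compLip; positivity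

end Constants

namespace Problem

variable {dx dy : ℕ} {Ξ H : Type*} [MeasurableSpace Ξ] [MeasurableSpace H]

lemma neumann_val_succ (P : Problem dx dy Ξ H) (L : ℝ) (x : E dx) (y : E dy) (ξ : Ξ)
    (η : EtaIdx → H) (n : ℕ) (r : E dy) :
    (P.neumann L x y ξ η (n + 1) r).val =
      (P.neumann L x y ξ η n
        (r - (1 / (2 * L)) • P.hess22g x y (η (.neumann (n + 1))) ξ r)).val := rfl

lemma component_val (P : Problem dx dy Ξ H) (L : ℝ) (N : ℕ+) (x : E dx) (y : E dy) (ξ : Ξ)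
    (η : EtaIdx → H) (n : ℕ) :
    (P.component L N x y ξ η n).val = P.grad1f x y (η .dprime) ξ -
      P.hess12g x y (η .prime) ξ ((((N : ℕ) : ℝ) / (2 * L)) •
        (P.neumann L x y ξ η n (P.grad2f x y (η .dprime) ξ)).val) := rfl

lemma neumann_congr (P : Problem dx dy Ξ H) (L : ℝ) (x : E dx) (y : E dy) (ξ : Ξ)
    {η η' : EtaIdx → H} {n : ℕ} (h : ∀ i ≤ n, η (.neumann i) = η' (.neumann i)) (r : E dy) :
    P.neumann L x y ξ η n r = P.neumann L x y ξ η' n r := by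
  induction n generalizing r with
  | zero => rfl
  | succ n ih =>
    rw [neumann, neumann, h (n + 1) le_rfl]
    congr 1
    funext v
    exact ih (fun i hi => h i (by omega)) _

namespace Regular

variable {P : Problem dx dy Ξ H} {c : Constants} {y₀ : E dx → E dy}

/-! ### The Neumann product -/

/-- Along a random product only nonexpansiveness is used; the rate `c.ρ` is kept for the mean
factor. -/
lemma norm_neumann_factor_le (hP : P.Regular c y₀) (x : E dx) (y : E dy) (η : H) (ξ : Ξ)
    (r : E dy) :
    ‖r - (1 / (2 * (c.Lg1 : ℝ))) • P.hess22g x y η ξ r‖ ≤ ‖r‖ :=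
  (norm_sub_smul_apply_le c.Lg1_pos c.μ_pos (hP.hess22g_symm x y η ξ)
    (hP.hess22g_coercive x y η ξ) (hP.norm_hess22g_le x y η ξ) r).trans
    (mul_le_of_le_one_left (norm_nonneg _) c.ρ_lt_one.le)

lemma norm_neumann_le (hP : P.Regular c y₀) (x : E dx) (y : E dy) (ξ : Ξ) (η : EtaIdx → H)
    (n : ℕ) (r : E dy) : ‖(P.neumann c.Lg1 x y ξ η n r).val‖ ≤ ‖r‖ := by
  induction n generalizing r with
  | zero => exact le_rfl
  | succ n ih =>
    rw [neumann_val_succ]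
    exact (ih _).trans (hP.norm_neumann_factor_le x y _ ξ r)

/-- Factors are exchanged one at a time. Each exchange costs Lg2‖y - y'‖‖r'‖/(2Lg1), and the other
factors do not expand, so the growth is linear in n. -/
lemma norm_neumann_sub_le (hP : P.Regular c y₀) (x : E dx) (y y' : E dy) (ξ : Ξ)
    (η : EtaIdx → H) (n : ℕ) (r r' : E dy) :
    ‖(P.neumann c.Lg1 x y ξ η n r).val - (P.neumann c.Lg1 x y' ξ η n r').val‖ ≤
      ‖r - r'‖ + n * (1 / (2 * (c.Lg1 : ℝ)) * (c.Lg2 * ‖y - y'‖ * ‖r'‖)) := by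
  induction n generalizing r r' with
  | zero => simp [neumann, Counted.pure]
  | succ n ih =>
    rw [neumann_val_succ, neumann_val_succ]
    set e := η (.neumann (n + 1))
    refine (ih _ _).trans ?_
    have h1 : r - (1 / (2 * (c.Lg1 : ℝ))) • P.hess22g x y e ξ r -
        (r' - (1 / (2 * (c.Lg1 : ℝ))) • P.hess22g x y' e ξ r') =
        (r - r' - (1 / (2 * (c.Lg1 : ℝ))) • P.hess22g x y e ξ (r - r')) -
          (1 / (2 * (c.Lg1 : ℝ))) • (P.hess22g x y e ξ - P.hess22g x y' e ξ) r' := by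
      simp only [map_sub, sub_apply, smul_sub]; abel
    have h2 : ‖(1 / (2 * (c.Lg1 : ℝ))) • (P.hess22g x y e ξ - P.hess22g x y' e ξ) r'‖ ≤
        1 / (2 * (c.Lg1 : ℝ)) * (c.Lg2 * ‖y - y'‖ * ‖r'‖) := by
      rw [norm_smul, Real.norm_of_nonneg (by positivity)]
      gcongr
      refine ContinuousLinearMap.le_of_opNorm_le _ ?_ _
      simpa using hP.norm_hess22g_sub_le x x y y' e ξ
    have h3 := hP.norm_neumann_factor_le x y' e ξ r'
    have h4 := hP.norm_neumann_factor_le x y e ξ (r - r')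
    rw [h1]
    have h5 : (n : ℝ) * (1 / (2 * (c.Lg1 : ℝ)) * (c.Lg2 * ‖y - y'‖ *
        ‖r' - (1 / (2 * (c.Lg1 : ℝ))) • P.hess22g x y' e ξ r'‖)) ≤
        n * (1 / (2 * (c.Lg1 : ℝ)) * (c.Lg2 * ‖y - y'‖ * ‖r'‖)) := by gcongr
    have h6 := norm_sub_le (r - r' - (1 / (2 * (c.Lg1 : ℝ))) • P.hess22g x y e ξ (r - r'))
      ((1 / (2 * (c.Lg1 : ℝ))) • (P.hess22g x y e ξ - P.hess22g x y' e ξ) r')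
    rw [Nat.cast_succ]
    linarith

lemma measurable_neumann (hP : P.Regular c y₀) (L : ℝ) (n : ℕ) {Ω : Type*}
    [MeasurableSpace Ω] {X : Ω → E dx} {Z : Ω → Ξ} {η : Ω → EtaIdx → H} {Y R : Ω → E dy}
    (hX : Measurable X) (hZ : Measurable Z) (hη : Measurable η) (hY : Measurable Y)
    (hR : Measurable R) :
    Measurable fun ω => (P.neumann L (X ω) (Y ω) (Z ω) (η ω) n (R ω)).val := by
  induction n generalizing R with
  | zero => exact hR
  | succ n ih =>
    simp_rw [neumann_val_succ]
    refine ih ?_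
    have h : Measurable fun ω => P.hess22g (X ω) (Y ω) (η ω (.neumann (n + 1))) (Z ω) (R ω) :=
      hP.measurable_hess22g_apply.comp (((hX.prodMk hY).prodMk hR).prodMk
        (hZ.prodMk ((measurable_pi_apply _).comp hη)))
    exact hR.sub (h.const_smul (1 / (2 * L)))

lemma measurable_component (hP : P.Regular c y₀) (L : ℝ) (N : ℕ+) (n : ℕ) {Ω : Type*}
    [MeasurableSpace Ω] {X : Ω → E dx} {Z : Ω → Ξ} {η : Ω → EtaIdx → H} {Y : Ω → E dy}
    (hX : Measurable X) (hZ : Measurable Z) (hη : Measurable η) (hY : Measurable Y) :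
    Measurable fun ω => (P.component L N (X ω) (Y ω) (Z ω) (η ω) n).val := by
  simp_rw [component_val]
  have h1 : Measurable fun ω => P.grad1f (X ω) (Y ω) (η ω .dprime) (Z ω) :=
    hP.measurable_grad1f.comp ((hX.prodMk hY).prodMk
      (hZ.prodMk ((measurable_pi_apply _).comp hη)))
  have h2 : Measurable fun ω => P.grad2f (X ω) (Y ω) (η ω .dprime) (Z ω) :=
    hP.measurable_grad2f.comp ((hX.prodMk hY).prodMk
      (hZ.prodMk ((measurable_pi_apply _).comp hη)))
  have h3 := (hP.measurable_neumann L n hX hZ hη hY h2).const_smul (((N : ℕ) : ℝ) / (2 * L))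
  exact h1.sub (hP.measurable_hess12g_apply.comp (((hX.prodMk hY).prodMk h3).prodMk
    (hZ.prodMk ((measurable_pi_apply _).comp hη))))

lemma norm_component_le (hP : P.Regular c y₀) (N : ℕ+) (x : E dx) (y : E dy) (ξ : Ξ)
    (η : EtaIdx → H) (n : ℕ) :
    ‖(P.component c.Lg1 N x y ξ η n).val‖ ≤ 2 * c.Lf0 * (N : ℕ) := by
  have hL : (0 : ℝ) < c.Lg1 := c.Lg1_pos
  have hN : (1 : ℝ) ≤ (N : ℕ) := by exact_mod_cast N.pos
  rw [component_val]
  have h2 : ‖P.hess12g x y (η .prime) ξ ((((N : ℕ) : ℝ) / (2 * c.Lg1)) •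
      (P.neumann c.Lg1 x y ξ η n (P.grad2f x y (η .dprime) ξ)).val)‖ ≤
      c.Lg1 * (((N : ℕ) : ℝ) / (2 * c.Lg1) * c.Lf0) := by
    refine ContinuousLinearMap.le_of_opNorm_le_of_le _ (hP.norm_hess12g_le _ _ _ _) ?_
    rw [norm_smul, Real.norm_of_nonneg (by positivity)]
    gcongr
    exact (hP.norm_neumann_le _ _ _ _ _ _).trans (hP.norm_grad2f_le _ _ _ _)
  have h3 : (c.Lg1 : ℝ) * (((N : ℕ) : ℝ) / (2 * c.Lg1) * c.Lf0) = (N : ℕ) * c.Lf0 / 2 := by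
    field_simp
  have h4 : (c.Lf0 : ℝ) * 1 ≤ c.Lf0 * (N : ℕ) := by gcongr
  have := hP.norm_grad1f_le x y (η .dprime) ξ
  refine (norm_sub_le _ _).trans ?_
  have h5 : (0 : ℝ) ≤ c.Lf0 * (N : ℕ) := by positivity
  linarith

/-- One power of N is the prefactor N/(2Lg1), the other is the number n < N of Neumann factors that
change with y. -/
lemma norm_component_sub_le (hP : P.Regular c y₀) (N : ℕ+) (x : E dx) (y y' : E dy) (ξ : Ξ)
    (η : EtaIdx → H) {n : ℕ} (hn : n < N) :
    ‖(P.component c.Lg1 N x y ξ η n).val - (P.component c.Lg1 N x y' ξ η n).val‖ ≤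
      c.compLip * (N : ℕ) ^ 2 * ‖y - y'‖ := by
  have hL : (0 : ℝ) < c.Lg1 := c.Lg1_pos
  have hN : (1 : ℝ) ≤ (N : ℕ) := by exact_mod_cast N.pos
  have hn' : (n : ℝ) ≤ (N : ℕ) := by exact_mod_cast hn.le
  rw [component_val, component_val]
  set t := ((N : ℕ) : ℝ) / (2 * c.Lg1) with ht
  set δ := ‖y - y'‖
  set b := P.grad2f x y (η .dprime) ξ
  set b' := P.grad2f x y' (η .dprime) ξ
  set w := (P.neumann c.Lg1 x y ξ η n b).val
  set w' := (P.neumann c.Lg1 x y' ξ η n b').val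
  set B := P.hess12g x y (η .prime) ξ
  set B' := P.hess12g x y' (η .prime) ξ
  have ha : ‖P.grad1f x y (η .dprime) ξ - P.grad1f x y' (η .dprime) ξ‖ ≤ c.Lf1 * δ := by
    simpa using hP.norm_grad1f_sub_le x x y y' (η .dprime) ξ
  have hb : ‖b - b'‖ ≤ c.Lf1 * δ := by simpa using hP.norm_grad2f_sub_le x x y y' (η .dprime) ξ
  have hB : ‖B - B'‖ ≤ c.Lg2 * δ := by simpa using hP.norm_hess12g_sub_le x x y y' (η .prime) ξ
  have hb' : ‖b'‖ ≤ c.Lf0 := hP.norm_grad2f_le _ _ _ _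
  have hw' : ‖w‖ ≤ c.Lf0 := (hP.norm_neumann_le _ _ _ _ _ _).trans (hP.norm_grad2f_le _ _ _ _)
  have hw : ‖w - w'‖ ≤ c.Lf1 * δ + (N : ℕ) * (1 / (2 * (c.Lg1 : ℝ)) * (c.Lg2 * δ * c.Lf0)) :=
    (hP.norm_neumann_sub_le x y y' ξ η n b b').trans (by gcongr)
  have e : P.grad1f x y (η .dprime) ξ - B (t • w) - (P.grad1f x y' (η .dprime) ξ - B' (t • w')) =
      (P.grad1f x y (η .dprime) ξ - P.grad1f x y' (η .dprime) ξ) -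
        ((B - B') (t • w) + B' (t • (w - w'))) := by
    simp only [sub_apply, map_sub, smul_sub]; abel
  have h1 : ‖(B - B') (t • w)‖ ≤ c.Lg2 * δ * (t * c.Lf0) := by
    refine ContinuousLinearMap.le_of_opNorm_le_of_le _ hB ?_
    rw [norm_smul, Real.norm_of_nonneg (by positivity)]
    gcongr
  have h2 : ‖B' (t • (w - w'))‖ ≤ c.Lg1 * (t * (c.Lf1 * δ +
      (N : ℕ) * (1 / (2 * (c.Lg1 : ℝ)) * (c.Lg2 * δ * c.Lf0)))) := by
    refine ContinuousLinearMap.le_of_opNorm_le_of_le _ (hP.norm_hess12g_le _ _ _ _) ?_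
    rw [norm_smul, Real.norm_of_nonneg (by positivity)]
    gcongr
  rw [e]
  refine (norm_sub_le _ _).trans ?_
  have h3 : ‖(B - B') (t • w) + B' (t • (w - w'))‖ ≤ _ := (norm_add_le _ _).trans (add_le_add h1 h2)
  refine (add_le_add ha h3).trans ?_
  set Nr := ((N : ℕ) : ℝ)
  have hNN : Nr ≤ Nr ^ 2 := by nlinarith
  have e1 : c.Lf1 * δ ≤ c.Lf1 * δ * Nr ^ 2 := le_mul_of_one_le_right (by positivity) (by nlinarith)
  have e2 : c.Lg2 * δ * (t * c.Lf0) ≤ c.Lg2 * c.Lf0 / (2 * c.Lg1) * δ * Nr ^ 2 := by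
    calc c.Lg2 * δ * (t * c.Lf0) = c.Lg2 * c.Lf0 / (2 * c.Lg1) * δ * Nr := by rw [ht]; ring
      _ ≤ _ := by gcongr
  have e3 : c.Lg1 * (t * (c.Lf1 * δ + Nr * (1 / (2 * (c.Lg1 : ℝ)) * (c.Lg2 * δ * c.Lf0)))) ≤
      (c.Lf1 + c.Lg2 * c.Lf0 / (2 * c.Lg1)) / 2 * δ * Nr ^ 2 := by
    have e4 : c.Lg1 * (t * (c.Lf1 * δ + Nr * (1 / (2 * (c.Lg1 : ℝ)) * (c.Lg2 * δ * c.Lf0)))) =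
        c.Lf1 / 2 * δ * Nr + c.Lg2 * c.Lf0 / (2 * c.Lg1) / 2 * δ * Nr ^ 2 := by
      rw [ht]; field_simp
    have e5 : c.Lf1 / 2 * δ * Nr ≤ c.Lf1 / 2 * δ * Nr ^ 2 := by gcongr
    rw [e4]
    linarith
  unfold Constants.compLip
  linarith

/-! ### Conditional expectation of a component -/

/-- The mean Neumann factor. -/
def meanFactor (P : Problem dx dy Ξ H) (L : ℝ) (x : E dx) (y : E dy) (ξ : Ξ) : E dy →L[ℝ] E dy :=
  1 - (1 / (2 * L)) • P.mean22g x y ξ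

lemma meanFactor_apply (L : ℝ) (x : E dx) (y : E dy) (ξ : Ξ) (v : E dy) :
    meanFactor P L x y ξ v = v - (1 / (2 * L)) • P.mean22g x y ξ v := rfl

/-- The factor n + 1 acts first and its sample is independent of the others: integrating these first
leaves a fixed linear map, which commutes with the last integral. -/
lemma integral_neumann (hP : P.Regular c y₀) (x : E dx) (y : E dy) (ξ : Ξ) (n : ℕ) (r : E dy) :
    ∫ η, (P.neumann c.Lg1 x y ξ η n r).val ∂P.etaLaw ξ = (meanFactor P c.Lg1 x y ξ ^ n) r := by
  change ∫ η, _ ∂(Measure.infinitePi fun _ : EtaIdx => P.lawEta ξ) = _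
  induction n generalizing r with
  | zero => simp [neumann, Counted.pure]
  | succ n ih =>
    have hm : Measurable fun η : EtaIdx → H => (P.neumann c.Lg1 x y ξ η (n + 1) r).val :=
      hP.measurable_neumann c.Lg1 (n + 1) measurable_const measurable_const measurable_id
        measurable_const measurable_const
    rw [integral_eq_integral_update (P.lawEta ξ) (.neumann (n + 1)) hm
      (fun η => hP.norm_neumann_le x y ξ η (n + 1) r)]
    have h1 : ∀ e, ∫ η, (P.neumann c.Lg1 x y ξ (Function.update η (.neumann (n + 1)) e)
        (n + 1) r).val ∂(Measure.infinitePi fun _ : EtaIdx => P.lawEta ξ) =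
        (meanFactor P c.Lg1 x y ξ ^ n)
          (r - (1 / (2 * (c.Lg1 : ℝ))) • P.hess22g x y e ξ r) := by
      intro e
      rw [← ih]
      refine integral_congr_ae (ae_of_all _ fun η => ?_)
      simp only [neumann_val_succ, Function.update_self]
      rw [P.neumann_congr c.Lg1 x y ξ (η' := η)]
      intro i hi
      refine Function.update_of_ne ?_ _ _
      rw [ne_eq, EtaIdx.neumann.injEq]
      omega
    simp_rw [h1]
    have hi : Integrable (fun e => P.hess22g x y e ξ r) (P.lawEta ξ) :=
      (hP.integrable_hess22g x y ξ).apply_continuousLinearMap r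
    have hs : Integrable (fun e => (1 / (2 * (c.Lg1 : ℝ))) • P.hess22g x y e ξ r) (P.lawEta ξ) :=
      hi.smul (1 / (2 * (c.Lg1 : ℝ)))
    have hd : Integrable (fun e => r - (1 / (2 * (c.Lg1 : ℝ))) • P.hess22g x y e ξ r)
      (P.lawEta ξ) := (integrable_const r).sub hs
    rw [ContinuousLinearMap.integral_comp_comm _ hd,
      integral_sub (integrable_const r) hs, integral_smul, pow_succ,
      mul_apply_eq_comp, meanFactor_apply, hP.mean22g_apply]
    simp

lemma integral_neumann_grad2f (hP : P.Regular c y₀) (x : E dx) (y : E dy) (ξ : Ξ) (n : ℕ) :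
    ∫ η, (P.neumann c.Lg1 x y ξ η n (P.grad2f x y (η .dprime) ξ)).val ∂P.etaLaw ξ =
      (meanFactor P c.Lg1 x y ξ ^ n) (P.mean2f x y ξ) := by
  have hm2 : Measurable fun η : EtaIdx → H => P.grad2f x y (η .dprime) ξ :=
    hP.measurable_grad2f.comp ((measurable_const (a := (x, y))).prodMk
      ((measurable_const (a := ξ)).prodMk (measurable_pi_apply EtaIdx.dprime)))
  have hm : Measurable fun η : EtaIdx → H =>
      (P.neumann c.Lg1 x y ξ η n (P.grad2f x y (η .dprime) ξ)).val :=
    hP.measurable_neumann c.Lg1 n measurable_const measurable_const measurable_id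
      measurable_const hm2
  change ∫ η, _ ∂(Measure.infinitePi fun _ : EtaIdx => P.lawEta ξ) = _
  rw [integral_eq_integral_update (P.lawEta ξ) .dprime hm
    (fun η => (hP.norm_neumann_le x y ξ η n _).trans (hP.norm_grad2f_le _ _ _ _))]
  have h1 : ∀ e, ∫ η, (P.neumann c.Lg1 x y ξ (Function.update η .dprime e) n
      (P.grad2f x y (Function.update η .dprime e .dprime) ξ)).val
        ∂(Measure.infinitePi fun _ : EtaIdx => P.lawEta ξ) =
      (meanFactor P c.Lg1 x y ξ ^ n) (P.grad2f x y e ξ) := by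
    intro e
    rw [← hP.integral_neumann]
    refine integral_congr_ae (ae_of_all _ fun η => ?_)
    simp only [Function.update_self]
    rw [P.neumann_congr c.Lg1 x y ξ (η' := η)]
    intro i _
    exact Function.update_of_ne (by simp) _ _
  simp_rw [h1]
  exact ContinuousLinearMap.integral_comp_comm _ (hP.integrable_grad2f x y ξ)

lemma integral_eval_etaLaw {V : Type*} [NormedAddCommGroup V] [NormedSpace ℝ V]
    (P : Problem dx dy Ξ H) (ξ : Ξ) (i : EtaIdx) {u : H → V}
    (hu : AEStronglyMeasurable u (P.lawEta ξ)) :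
    ∫ η, u (η i) ∂P.etaLaw ξ = ∫ e, u e ∂P.lawEta ξ := by
  have h := measurePreserving_eval_infinitePi (fun _ : EtaIdx => P.lawEta ξ) i
  rw [← h.map_eq] at hu ⊢
  rw [integral_map h.measurable.aemeasurable hu]
  rfl

lemma measurable_eta_grad1f (hP : P.Regular c y₀) (x : E dx) (y : E dy) (ξ : Ξ) (i : EtaIdx) :
    Measurable fun η : EtaIdx → H => P.grad1f x y (η i) ξ :=
  hP.measurable_grad1f.comp ((measurable_const (a := (x, y))).prodMk
    ((measurable_const (a := ξ)).prodMk (measurable_pi_apply i)))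

lemma measurable_eta_grad2f (hP : P.Regular c y₀) (x : E dx) (y : E dy) (ξ : Ξ) (i : EtaIdx) :
    Measurable fun η : EtaIdx → H => P.grad2f x y (η i) ξ :=
  hP.measurable_grad2f.comp ((measurable_const (a := (x, y))).prodMk
    ((measurable_const (a := ξ)).prodMk (measurable_pi_apply i)))

lemma measurable_eta_hess12g (hP : P.Regular c y₀) (x : E dx) (y : E dy) (ξ : Ξ) (i : EtaIdx)
    {w : (EtaIdx → H) → E dy} (hw : Measurable w) :
    Measurable fun η : EtaIdx → H => P.hess12g x y (η i) ξ (w η) :=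
  hP.measurable_hess12g_apply.comp (((measurable_const (a := (x, y))).prodMk hw).prodMk
    ((measurable_const (a := ξ)).prodMk (measurable_pi_apply i)))

/-- `η'` is independent of the Neumann product. -/
lemma integral_hess12g_of_update (hP : P.Regular c y₀) (x : E dx) (y : E dy) (ξ : Ξ)
    {w : (EtaIdx → H) → E dy} (hw : Measurable w) {C : ℝ} (hwb : ∀ η, ‖w η‖ ≤ C)
    (hwu : ∀ η e, w (Function.update η .prime e) = w η) :
    ∫ η, P.hess12g x y (η .prime) ξ (w η) ∂P.etaLaw ξ =
      P.mean12g x y ξ (∫ η, w η ∂P.etaLaw ξ) := by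
  have hwi : Integrable w (P.etaLaw ξ) :=
    Integrable.of_bound hw.aestronglyMeasurable _ (ae_of_all _ hwb)
  have hBb : ∀ η : EtaIdx → H, ‖P.hess12g x y (η .prime) ξ (w η)‖ ≤ c.Lg1 * C := fun η =>
    ContinuousLinearMap.le_of_opNorm_le_of_le _ (hP.norm_hess12g_le _ _ _ _) (hwb η)
  change ∫ η, _ ∂(Measure.infinitePi fun _ : EtaIdx => P.lawEta ξ) = _
  rw [integral_eq_integral_update (P.lawEta ξ) .prime
    (hP.measurable_eta_hess12g x y ξ .prime hw) hBb, hP.mean12g_apply]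
  refine integral_congr_ae (ae_of_all _ fun e => ?_)
  simp only [Function.update_self, hwu]
  exact ContinuousLinearMap.integral_comp_comm _ hwi

/-- η', η'' and the Neumann samples are independent, so every factor is replaced by its conditional
mean. Sharing η'' between ∇₁f and ∇₂f is harmless, since they occur in different summands. -/
lemma integral_component (hP : P.Regular c y₀) (N : ℕ+) (x : E dx) (y : E dy) (ξ : Ξ) (n : ℕ) :
    ∫ η, (P.component c.Lg1 N x y ξ η n).val ∂P.etaLaw ξ = P.mean1f x y ξ -
      P.mean12g x y ξ ((((N : ℕ) : ℝ) / (2 * c.Lg1)) •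
        (meanFactor P c.Lg1 x y ξ ^ n) (P.mean2f x y ξ)) := by
  have hL : (0 : ℝ) < c.Lg1 := c.Lg1_pos
  have ht : 0 ≤ ((N : ℕ) : ℝ) / (2 * c.Lg1) := by positivity
  generalize hteq : ((N : ℕ) : ℝ) / (2 * c.Lg1) = t at ht
  have hw : Measurable fun η : EtaIdx → H =>
      t • (P.neumann c.Lg1 x y ξ η n (P.grad2f x y (η .dprime) ξ)).val :=
    (hP.measurable_neumann c.Lg1 n measurable_const measurable_const measurable_id
      measurable_const (hP.measurable_eta_grad2f x y ξ .dprime)).const_smul t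
  have hwb : ∀ η : EtaIdx → H,
      ‖t • (P.neumann c.Lg1 x y ξ η n (P.grad2f x y (η .dprime) ξ)).val‖ ≤ t * c.Lf0 := by
    intro η
    rw [norm_smul, Real.norm_of_nonneg ht]
    gcongr
    exact (hP.norm_neumann_le x y ξ η n _).trans (hP.norm_grad2f_le _ _ _ _)
  have hwu : ∀ (η : EtaIdx → H) e, t • (P.neumann c.Lg1 x y ξ (Function.update η .prime e) n
      (P.grad2f x y (Function.update η .prime e .dprime) ξ)).val =
      t • (P.neumann c.Lg1 x y ξ η n (P.grad2f x y (η .dprime) ξ)).val := by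
    intro η e
    rw [P.neumann_congr c.Lg1 x y ξ (η' := η), Function.update_of_ne (by simp)]
    intro i _
    exact Function.update_of_ne (by simp) _ _
  have hBi : Integrable (fun η : EtaIdx → H => P.hess12g x y (η .prime) ξ
      (t • (P.neumann c.Lg1 x y ξ η n (P.grad2f x y (η .dprime) ξ)).val)) (P.etaLaw ξ) :=
    Integrable.of_bound (hP.measurable_eta_hess12g x y ξ .prime hw).aestronglyMeasurable
      (c.Lg1 * (t * c.Lf0)) (ae_of_all _ fun η =>
        ContinuousLinearMap.le_of_opNorm_le_of_le _ (hP.norm_hess12g_le _ _ _ _) (hwb η))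
  have hai : Integrable (fun η : EtaIdx → H => P.grad1f x y (η .dprime) ξ) (P.etaLaw ξ) :=
    Integrable.of_bound (hP.measurable_eta_grad1f x y ξ .dprime).aestronglyMeasurable _
      (ae_of_all _ fun η => hP.norm_grad1f_le _ _ _ _)
  simp_rw [component_val, hteq]
  rw [integral_sub hai hBi, hP.integral_hess12g_of_update x y ξ hw hwb hwu, integral_smul,
    hP.integral_neumann_grad2f,
    integral_eval_etaLaw P ξ .dprime (hP.integrable_grad1f x y ξ).aestronglyMeasurable]
  rfl

lemma norm_meanFactor_pow_le (hP : P.Regular c y₀) (x : E dx) (y : E dy) (ξ : Ξ) (n : ℕ)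
    (v : E dy) : ‖(meanFactor P c.Lg1 x y ξ ^ n) v‖ ≤ c.ρ ^ n * ‖v‖ := by
  induction n generalizing v with
  | zero => simp
  | succ n ih =>
    rw [pow_succ, mul_apply_eq_comp, pow_succ, mul_assoc]
    refine (ih _).trans (mul_le_mul_of_nonneg_left ?_ (pow_nonneg c.ρ_nonneg n))
    rw [meanFactor_apply]
    exact norm_sub_smul_apply_le c.Lg1_pos c.μ_pos (hP.mean22g_symm x y ξ)
      (hP.mean22g_coercive x y ξ) (hP.norm_mean22g_le x y ξ) v

/-- With M = I - A/(2L), the geometric sum gives (1/2L) Σ_{n<N} Mⁿ = A⁻¹(I - M^N). Averaging over N̂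
cancels the prefactor N and produces exactly this sum, so only A⁻¹M^N remains as error. -/
lemma norm_mean_component_sub_hyper_le (hP : P.Regular c y₀) (N : ℕ+) (x : E dx) (ξ : Ξ) :
    ‖((N : ℕ) : ℝ)⁻¹ • ∑ n ∈ Finset.range N,
        ∫ η, (P.component c.Lg1 N x (P.yStar x ξ) ξ η n).val ∂P.etaLaw ξ - hyper P x ξ‖ ≤
      c.Lg1 * (1 / c.μ * (c.ρ ^ (N : ℕ) * c.Lf0)) := by
  have hμ := c.μ_pos
  have hL : (0 : ℝ) < c.Lg1 := c.Lg1_pos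
  have hN : (0 : ℝ) < (N : ℕ) := by exact_mod_cast N.pos
  simp_rw [hP.integral_component]
  set y := P.yStar x ξ with hy
  set M := meanFactor P c.Lg1 x y ξ with hM
  set b := P.mean2f x y ξ
  set B := P.mean12g x y ξ
  set a := P.mean1f x y ξ
  set A := P.mean22g x y ξ with hA
  have hgeom : (1 / (2 * (c.Lg1 : ℝ))) • A (∑ n ∈ Finset.range N, (M ^ n) b) = b - (M ^ (N : ℕ)) b := by
    have h1 := congrArg (fun T : E dy →L[ℝ] E dy => T b) (mul_neg_geom_sum M (N : ℕ))
    have h2 : (1 : E dy →L[ℝ] E dy) - M = (1 / (2 * (c.Lg1 : ℝ))) • A := by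
      rw [hM, meanFactor, sub_sub_cancel]
    have h3 : (∑ i ∈ Finset.range N, M ^ i) b = ∑ i ∈ Finset.range N, (M ^ i) b :=
      map_sum (ContinuousLinearMap.apply ℝ (E dy) b) _ _
    rw [h2] at h1
    rw [← h3]
    exact h1
  have hinv : (1 / (2 * (c.Lg1 : ℝ))) • ∑ n ∈ Finset.range N, (M ^ n) b =
      invHess P x ξ b - invHess P x ξ ((M ^ (N : ℕ)) b) := by
    rw [← map_sub, ← hgeom, map_smul, hA, hy, hP.invHess_mean22g]
  have hc : ((N : ℕ) : ℝ)⁻¹ * (((N : ℕ) : ℝ) / (2 * c.Lg1)) = 1 / (2 * c.Lg1) := by field_simp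
  have hsum : ((N : ℕ) : ℝ)⁻¹ • ∑ n ∈ Finset.range N,
      (a - B ((((N : ℕ) : ℝ) / (2 * c.Lg1)) • (M ^ n) b)) =
      a - B (invHess P x ξ b - invHess P x ξ ((M ^ (N : ℕ)) b)) := by
    rw [← hinv, Finset.sum_sub_distrib, ← map_sum, ← Finset.smul_sum, Finset.sum_const,
      Finset.card_range, smul_sub, ← Nat.cast_smul_eq_nsmul ℝ, smul_smul, inv_mul_cancel₀ hN.ne',
      one_smul, ← map_smul, smul_smul, hc]
  rw [hsum, hyper]
  have e : a - B (invHess P x ξ b - invHess P x ξ ((M ^ (N : ℕ)) b)) - (a - B (invHess P x ξ b)) =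
      B (invHess P x ξ ((M ^ (N : ℕ)) b)) := by
    rw [map_sub]; abel
  rw [e]
  refine ContinuousLinearMap.le_of_opNorm_le_of_le _ (hP.norm_mean12g_le _ _ _)
    (ContinuousLinearMap.le_of_opNorm_le_of_le _ (hP.norm_invHess_le _ _)
      ((hP.norm_meanFactor_pow_le _ _ _ _ _).trans ?_))
  have := pow_nonneg c.ρ_nonneg N
  gcongr
  exact hP.norm_mean2f_le _ _ _

end Regular

end Problem

end CSBO
end

noncomputable section

namespace CSBO

lemma enorm_integral_sq_le {Ω V : Type*} [MeasurableSpace Ω] [NormedAddCommGroup V]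
    [NormedSpace ℝ V] {ν : Measure Ω} [IsProbabilityMeasure ν] {f : Ω → V}
    (hf : AEStronglyMeasurable f ν) : ‖∫ ω, f ω ∂ν‖ₑ ^ 2 ≤ ∫⁻ ω, ‖f ω‖ₑ ^ 2 ∂ν := by
  have h := eLpNorm_le_eLpNorm_of_exponent_le (μ := ν) (one_le_two : (1 : ℝ≥0∞) ≤ 2) hf
  rw [eLpNorm_one_eq_lintegral_enorm,
    eLpNorm_eq_lintegral_rpow_enorm_toReal two_ne_zero ENNReal.ofNat_ne_top] at h
  calc ‖∫ ω, f ω ∂ν‖ₑ ^ 2 ≤ ((∫⁻ ω, ‖f ω‖ₑ ^ (2 : ℝ≥0∞).toReal ∂ν) ^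
        (1 / (2 : ℝ≥0∞).toReal)) ^ 2 := by
        gcongr
        exact (enorm_integral_le_lintegral_enorm f).trans h
    _ = _ := by
        rw [← ENNReal.rpow_natCast, ← ENNReal.rpow_mul]
        simp

lemma sum_Icc_sub_pred {V : Type*} [AddCommGroup V] (a : ℕ → V) (K : ℕ) :
    ∑ k ∈ Finset.Icc 1 K, (a k - a (k - 1)) = a K - a 0 := by
  induction K with
  | zero => simp
  | succ K ih => rw [Finset.sum_Icc_succ_top (by omega), ih]; simp

/-! ### The distributions of `N̂` and `k̂` -/

lemma geomWeight_sum_pos (K : ℕ+) : 0 < ∑ j ∈ Finset.Icc 1 (K : ℕ), (2 : ℝ)⁻¹ ^ j :=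
  Finset.sum_pos (fun _ _ => by positivity) ⟨1, by simp [Nat.one_le_iff_ne_zero]⟩

lemma geomWeight_pos (K : ℕ+) (k : ℕ) : 0 < geomWeight K k :=
  div_pos (by positivity) (geomWeight_sum_pos K)

lemma sum_geomWeight (K : ℕ+) : ∑ k ∈ Finset.Icc 1 (K : ℕ), geomWeight K k = 1 := by
  unfold geomWeight
  rw [← Finset.sum_div, div_self (geomWeight_sum_pos K).ne']

lemma sum_Icc_half_pow (K : ℕ) : ∑ j ∈ Finset.Icc 1 K, (2 : ℝ)⁻¹ ^ j = 1 - (2 : ℝ)⁻¹ ^ K := by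
  induction K with
  | zero => simp
  | succ K ih => rw [Finset.sum_Icc_succ_top (by omega), ih]; ring

/-- The normalizer 1 - 2^(-K) lies in [1/2, 1), so p_k is between 2^(-k) and 2·2^(-k). The lower
bound controls the second moment, the upper bound the expected cost. -/
lemma half_pow_le_geomWeight (K : ℕ+) (k : ℕ) : (2 : ℝ)⁻¹ ^ k ≤ geomWeight K k := by
  rw [geomWeight, le_div_iff₀ (geomWeight_sum_pos K), sum_Icc_half_pow]
  exact mul_le_of_le_one_right (by positivity) (by linarith [show (0 : ℝ) < 2⁻¹ ^ (K : ℕ) by positivity])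

lemma geomWeight_le (K : ℕ+) (k : ℕ) : geomWeight K k ≤ 2 * (2 : ℝ)⁻¹ ^ k := by
  rw [geomWeight, div_le_iff₀ (geomWeight_sum_pos K), sum_Icc_half_pow]
  have h : (2 : ℝ)⁻¹ ^ (K : ℕ) ≤ 2⁻¹ ^ 1 :=
    pow_le_pow_of_le_one (by norm_num) (by norm_num) K.pos
  have h2 : (0 : ℝ) < 2⁻¹ ^ k := by positivity
  nlinarith

lemma ae_unif_lt (N : ℕ+) : ∀ᵐ n ∂unif N, n < (N : ℕ) := by
  rw [ae_iff, unif, Measure.coe_finsetSum, Finset.sum_apply]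
  refine Finset.sum_eq_zero fun n hn => ?_
  simp [Finset.mem_range.mp hn]

lemma ae_geom_mem (K : ℕ+) : ∀ᵐ k ∂geom K, k ∈ Finset.Icc 1 (K : ℕ) := by
  rw [ae_iff, geom, Measure.coe_finsetSum, Finset.sum_apply]
  refine Finset.sum_eq_zero fun k hk => ?_
  rw [Measure.smul_apply, Measure.dirac_apply' _ (MeasurableSet.of_discrete)]
  simp [Finset.mem_Icc.mp hk]

lemma lintegral_geom (K : ℕ+) (φ : ℕ → ℝ≥0∞) :
    ∫⁻ k, φ k ∂geom K = ∑ k ∈ Finset.Icc 1 (K : ℕ), ENNReal.ofReal (geomWeight K k) * φ k := by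
  simp [geom, lintegral_finsetSum_measure]

lemma integral_unif {V : Type*} [NormedAddCommGroup V] [NormedSpace ℝ V] [CompleteSpace V]
    (N : ℕ+) (φ : ℕ → V) :
    ∫ n, φ n ∂unif N = ((N : ℕ) : ℝ)⁻¹ • ∑ n ∈ Finset.range N, φ n := by
  rw [unif, integral_finsetSum_measure, Finset.smul_sum]
  · simp [integral_smul_measure]
  · intro n _
    refine Integrable.smul_measure ?_ (by simp)
    exact integrable_dirac (by simp)

lemma integral_geom {V : Type*} [NormedAddCommGroup V] [NormedSpace ℝ V] [CompleteSpace V]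
    (K : ℕ+) (φ : ℕ → V) :
    ∫ k, φ k ∂geom K = ∑ k ∈ Finset.Icc 1 (K : ℕ), geomWeight K k • φ k := by
  rw [geom, integral_finsetSum_measure]
  · simp [integral_smul_measure, (geomWeight_pos K _).le]
  · intro n _
    refine Integrable.smul_measure ?_ (by simp)
    exact integrable_dirac (by simp)

namespace Problem

variable {dx dy : ℕ} {Ξ H : Type*} [MeasurableSpace Ξ] [MeasurableSpace H]

/-- The law of `ξ` and the samples of `η`. -/
def sampleLaw (P : Problem dx dy Ξ H) : Measure (Ξ × (EtaIdx → H)) := P.lawXi ⊗ₘ P.etaLaw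

instance (P : Problem dx dy Ξ H) : IsProbabilityMeasure P.sampleLaw := by
  unfold sampleLaw; infer_instance

lemma tapeLaw_eq (P : Problem dx dy Ξ H) (N K : ℕ+) :
    P.tapeLaw N K = P.sampleLaw.prod ((unif N).prod (geom K)) := rfl

lemma ae_tapeLaw (P : Problem dx dy Ξ H) (N K : ℕ+) :
    ∀ᵐ ω ∂P.tapeLaw N K, ω.2.1 < (N : ℕ) ∧ ω.2.2 ∈ Finset.Icc 1 (K : ℕ) := by
  rw [tapeLaw_eq]
  have h1 : ∀ᵐ q ∂(unif N).prod (geom K), q.1 < (N : ℕ) :=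
    Measure.quasiMeasurePreserving_fst.ae (ae_unif_lt N)
  have h2 : ∀ᵐ q ∂(unif N).prod (geom K), q.2 ∈ Finset.Icc 1 (K : ℕ) :=
    Measure.quasiMeasurePreserving_snd.ae (ae_geom_mem K)
  exact Measure.quasiMeasurePreserving_snd.ae (h1.and h2)

lemma lintegral_tapeLaw (P : Problem dx dy Ξ H) (N K : ℕ+) {Φ : Tape Ξ H → ℝ≥0∞}
    (hΦ : Measurable Φ) :
    ∫⁻ ω, Φ ω ∂P.tapeLaw N K = ∑ n ∈ Finset.range N, ((N : ℕ) : ℝ≥0∞)⁻¹ *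
      ∑ k ∈ Finset.Icc 1 (K : ℕ), ENNReal.ofReal (geomWeight K k) *
        ∫⁻ ω, Φ (ω, (n, k)) ∂P.sampleLaw := by
  rw [tapeLaw_eq, lintegral_prod_symm _ hΦ.aemeasurable,
    lintegral_prod _ Measurable.of_discrete.aemeasurable, lintegral_unif]
  simp_rw [lintegral_geom]

lemma integral_tapeLaw {V : Type*} [NormedAddCommGroup V] [NormedSpace ℝ V] [CompleteSpace V]
    (P : Problem dx dy Ξ H) (N K : ℕ+) {Φ : Tape Ξ H → V} (hΦ : Integrable Φ (P.tapeLaw N K)) :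
    ∫ ω, Φ ω ∂P.tapeLaw N K = ((N : ℕ) : ℝ)⁻¹ • ∑ n ∈ Finset.range N,
      ∑ k ∈ Finset.Icc 1 (K : ℕ), geomWeight K k • ∫ ω, Φ (ω, (n, k)) ∂P.sampleLaw := by
  rw [tapeLaw_eq] at hΦ ⊢
  rw [integral_prod_symm _ hΦ, integral_prod _ hΦ.integral_prod_right, integral_unif]
  simp_rw [integral_geom]

/-! ### The gradient estimators -/

/-- For k = 0 the subtraction truncates, and both sides are the initial iterate. -/
lemma epochSGD_fst (P : Problem dx dy Ξ H) (β₀ : ℝ) (x : E dx) (ξ : Ξ) (η : EtaIdx → H) (y : E dy)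
    (k : ℕ) : (P.epochSGD β₀ x ξ η y k).val.1 = (P.epochSGD β₀ x ξ η y (k - 1)).val.2 := by
  cases k <;> rfl

/-- The component with `n` Neumann factors at the iterate `y_(k+1)^0`. -/
def levelComp (P : Problem dx dy Ξ H) (L β₀ : ℝ) (y₀ : E dx → E dy) (N : ℕ+) (x : E dx) (n k : ℕ)
    (ω : Ξ × (EtaIdx → H)) : E dx :=
  (P.component L N x (P.epochSGD β₀ x ω.1 ω.2 (y₀ x) k).val.2 ω.1 ω.2 n).val

lemma dlsgd_val (P : Problem dx dy Ξ H) (L β₀ : ℝ) (y₀ : E dx → E dy) (N K : ℕ+) (x : E dx)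
    (ω : Tape Ξ H) :
    (P.dlsgd L β₀ y₀ N K x ω).val = P.levelComp L β₀ y₀ N x ω.2.1 K ω.1 := rfl

lemma rtmlmc_val (P : Problem dx dy Ξ H) (L β₀ : ℝ) (y₀ : E dx → E dy) (N K : ℕ+) (x : E dx)
    (ω : Tape Ξ H) :
    (P.rtmlmc L β₀ y₀ N K x ω).val = P.levelComp L β₀ y₀ N x ω.2.1 0 ω.1 +
      (geomWeight K ω.2.2)⁻¹ • (P.levelComp L β₀ y₀ N x ω.2.1 ω.2.2 ω.1 -
        P.levelComp L β₀ y₀ N x ω.2.1 (ω.2.2 - 1) ω.1) := by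
  have h : (P.rtmlmc L β₀ y₀ N K x ω).val = P.levelComp L β₀ y₀ N x ω.2.1 0 ω.1 +
      (geomWeight K ω.2.2)⁻¹ • (P.levelComp L β₀ y₀ N x ω.2.1 ω.2.2 ω.1 -
        (P.component L N x (P.epochSGD β₀ x ω.1.1 ω.1.2 (y₀ x) ω.2.2).val.1
          ω.1.1 ω.1.2 ω.2.1).val) := rfl
  rw [h, epochSGD_fst]
  rfl

namespace Regular

variable {P : Problem dx dy Ξ H} {c : Constants} {y₀ : E dx → E dy}

lemma measurable_levelComp (hP : P.Regular c y₀) (L β₀ : ℝ) (N : ℕ+) (n k : ℕ) :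
    Measurable fun q : E dx × (Ξ × (EtaIdx → H)) => P.levelComp L β₀ y₀ N q.1 n k q.2 :=
  hP.measurable_component L N n measurable_fst measurable_snd.fst measurable_snd.snd
    (hP.measurable_epochSGD β₀ k measurable_fst measurable_snd.fst measurable_snd.snd
      (hP.y₀_measurable.comp measurable_fst)).snd

/-- N̂ and k̂ take countably many values, so measurability is checked for each pair of values. -/
lemma measurable_of_tape {V : Type*} [MeasurableSpace V] {Φ : E dx → Tape Ξ H → V}
    (h : ∀ n k, Measurable fun q : E dx × (Ξ × (EtaIdx → H)) => Φ q.1 (q.2, (n, k))) :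
    Measurable fun q : E dx × Tape Ξ H => Φ q.1 q.2 := by
  have h1 : Measurable fun q : (E dx × (Ξ × (EtaIdx → H))) × (ℕ × ℕ) => Φ q.1.1 (q.1.2, q.2) :=
    measurable_from_prod_countable_left fun nk => h nk.1 nk.2
  exact h1.comp ((measurable_fst.prodMk measurable_snd.fst).prodMk measurable_snd.snd)

lemma measurable_dlsgd (hP : P.Regular c y₀) (L β₀ : ℝ) (N K : ℕ+) :
    Measurable fun q : E dx × Tape Ξ H => (P.dlsgd L β₀ y₀ N K q.1 q.2).val :=
  measurable_of_tape (Φ := fun x ω => (P.dlsgd L β₀ y₀ N K x ω).val) fun n _ => hP.measurable_levelComp L β₀ N n K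

lemma measurable_rtmlmc (hP : P.Regular c y₀) (L β₀ : ℝ) (N K : ℕ+) :
    Measurable fun q : E dx × Tape Ξ H => (P.rtmlmc L β₀ y₀ N K q.1 q.2).val := by
  refine measurable_of_tape (Φ := fun x ω => (P.rtmlmc L β₀ y₀ N K x ω).val) fun n k => ?_
  simp_rw [rtmlmc_val]
  exact (hP.measurable_levelComp L β₀ N n 0).add
    (((hP.measurable_levelComp L β₀ N n k).sub
      (hP.measurable_levelComp L β₀ N n (k - 1))).const_smul (geomWeight K k)⁻¹)

lemma norm_levelComp_le (hP : P.Regular c y₀) (β₀ : ℝ) (N : ℕ+) (x : E dx) (n k : ℕ)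
    (ω : Ξ × (EtaIdx → H)) : ‖P.levelComp c.Lg1 β₀ y₀ N x n k ω‖ ≤ 2 * c.Lf0 * (N : ℕ) :=
  hP.norm_component_le N x _ ω.1 ω.2 n

lemma integrable_levelComp (hP : P.Regular c y₀) (β₀ : ℝ) (N : ℕ+) (x : E dx) (n k : ℕ) :
    Integrable (P.levelComp c.Lg1 β₀ y₀ N x n k) P.sampleLaw :=
  Integrable.of_bound ((hP.measurable_levelComp c.Lg1 β₀ N n k).comp
    measurable_prodMk_left).aestronglyMeasurable _ (ae_of_all _ (hP.norm_levelComp_le β₀ N x n k))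

lemma lintegral_sampleLaw_le {Φ : Ξ × (EtaIdx → H) → ℝ≥0∞} (hΦ : Measurable Φ) {r : ℝ≥0∞}
    (h : ∀ ξ, ∫⁻ η, Φ (ξ, η) ∂P.etaLaw ξ ≤ r) : ∫⁻ ω, Φ ω ∂P.sampleLaw ≤ r := by
  rw [sampleLaw, Measure.lintegral_compProd hΦ]
  exact (lintegral_mono h).trans_eq (by simp)

lemma measurable_epochStart_sub (hP : P.Regular c y₀) (β₀ : ℝ) (x : E dx) (k : ℕ) :
    Measurable fun ω : Ξ × (EtaIdx → H) =>
      (P.epochSGD β₀ x ω.1 ω.2 (y₀ x) k).val.2 - P.yStar x ω.1 :=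
  (hP.measurable_epochSGD β₀ k measurable_const measurable_fst measurable_snd
    measurable_const).snd.sub ((hP.measurable_yStar x).comp measurable_fst)

/-! ### Second moments of the two estimators -/

section Moments

variable {β₀ : ℝ} {R : ℝ≥0}

lemma lintegral_epochStart_sub_sq_le (hP : P.Regular c y₀)
    (hR : ∀ x ξ k, epochError P β₀ y₀ x ξ k ≤ R * (2 : ℝ≥0∞)⁻¹ ^ k) (x : E dx) (k : ℕ) :
    ∫⁻ ω, ‖(P.epochSGD β₀ x ω.1 ω.2 (y₀ x) k).val.2 - P.yStar x ω.1‖ₑ ^ 2 ∂P.sampleLaw ≤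
      R * (2 : ℝ≥0∞)⁻¹ ^ k :=
  lintegral_sampleLaw_le ((hP.measurable_epochStart_sub β₀ x k).enorm.pow_const 2)
    fun ξ => hR x ξ k

/-- Two consecutive levels are close in mean square. -/
lemma lintegral_levelComp_sub_sq_le (hP : P.Regular c y₀)
    (hR : ∀ x ξ k, epochError P β₀ y₀ x ξ k ≤ R * (2 : ℝ≥0∞)⁻¹ ^ k) (N : ℕ+) (x : E dx)
    {n : ℕ} (hn : n < N) (k : ℕ) :
    ∫⁻ ω, ‖P.levelComp c.Lg1 β₀ y₀ N x n (k + 1) ω - P.levelComp c.Lg1 β₀ y₀ N x n k ω‖ₑ ^ 2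
        ∂P.sampleLaw ≤
      ENNReal.ofReal (6 * (c.compLip * (N : ℕ) ^ 2) ^ 2 * R * (2 : ℝ)⁻¹ ^ (k + 1)) := by
  set C := c.compLip * ((N : ℕ) : ℝ) ^ 2
  have hC : 0 ≤ C := mul_nonneg c.compLip_nonneg (by positivity)
  set u : ℕ → Ξ × (EtaIdx → H) → E dy := fun k ω =>
    (P.epochSGD β₀ x ω.1 ω.2 (y₀ x) k).val.2 - P.yStar x ω.1
  have hu : ∀ k, Measurable (u k) := fun k => hP.measurable_epochStart_sub β₀ x k
  have hconv : ∀ {d : ℕ} (v : E d), ‖v‖ₑ ^ 2 = ENNReal.ofReal (‖v‖ ^ 2) := fun v => by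
    rw [ENNReal.ofReal_pow (norm_nonneg _), ofReal_norm]
  -- Both iterates are compared with y*. The errors add to R(2^(-(k+1)) + 2^(-k)) = 3R 2^(-(k+1)),
  -- which with the factor 2 from the square of a sum gives 6.
  calc _ ≤ ∫⁻ ω, (ENNReal.ofReal (2 * C ^ 2) * ‖u (k + 1) ω‖ₑ ^ 2 +
        ENNReal.ofReal (2 * C ^ 2) * ‖u k ω‖ₑ ^ 2) ∂P.sampleLaw := by
        refine lintegral_mono fun ω => ?_
        have h1 := hP.norm_component_sub_le N x (P.epochSGD β₀ x ω.1 ω.2 (y₀ x) (k + 1)).val.2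
          (P.epochSGD β₀ x ω.1 ω.2 (y₀ x) k).val.2 ω.1 ω.2 hn
        have e : (P.epochSGD β₀ x ω.1 ω.2 (y₀ x) (k + 1)).val.2 -
          (P.epochSGD β₀ x ω.1 ω.2 (y₀ x) k).val.2 = u (k + 1) ω - u k ω := by
          simp only [u]; abel
        rw [e] at h1
        rw [hconv, hconv, hconv, ← ENNReal.ofReal_mul (by positivity),
          ← ENNReal.ofReal_mul (by positivity),
          ← ENNReal.ofReal_add (by positivity) (by positivity)]
        apply ENNReal.ofReal_le_ofReal
        have h2 := norm_sub_le (u (k + 1) ω) (u k ω)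
        have h3 : ‖P.levelComp c.Lg1 β₀ y₀ N x n (k + 1) ω -
            P.levelComp c.Lg1 β₀ y₀ N x n k ω‖ ^ 2 ≤ (C * (‖u (k + 1) ω‖ + ‖u k ω‖)) ^ 2 := by
          gcongr
          exact h1.trans (mul_le_mul_of_nonneg_left h2 hC)
        have h4 := mul_nonneg (sq_nonneg C) (sq_nonneg (‖u (k + 1) ω‖ - ‖u k ω‖))
        linarith
    _ = ENNReal.ofReal (2 * C ^ 2) * ∫⁻ ω, ‖u (k + 1) ω‖ₑ ^ 2 ∂P.sampleLaw +
        ENNReal.ofReal (2 * C ^ 2) * ∫⁻ ω, ‖u k ω‖ₑ ^ 2 ∂P.sampleLaw := by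
        rw [lintegral_add_right _ (((hu k).enorm.pow_const 2).const_mul _),
          lintegral_const_mul _ ((hu _).enorm.pow_const 2),
          lintegral_const_mul _ ((hu _).enorm.pow_const 2)]
    _ ≤ ENNReal.ofReal (2 * C ^ 2) * (R * (2 : ℝ≥0∞)⁻¹ ^ (k + 1)) +
        ENNReal.ofReal (2 * C ^ 2) * (R * (2 : ℝ≥0∞)⁻¹ ^ k) := by
        gcongr
        · exact hP.lintegral_epochStart_sub_sq_le hR x (k + 1)
        · exact hP.lintegral_epochStart_sub_sq_le hR x k
    _ = _ := by
        rw [show (2 : ℝ≥0∞)⁻¹ = ENNReal.ofReal 2⁻¹ by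
            rw [ENNReal.ofReal_inv_of_pos two_pos]; simp, ← ENNReal.ofReal_coe_nnreal (p := R),
          ← ENNReal.ofReal_pow (by norm_num), ← ENNReal.ofReal_pow (by norm_num),
          ← ENNReal.ofReal_mul (by positivity), ← ENNReal.ofReal_mul (by positivity),
          ← ENNReal.ofReal_mul (by positivity), ← ENNReal.ofReal_mul (by positivity),
          ← ENNReal.ofReal_add (by positivity) (by positivity)]
        congr 1
        ring

lemma lintegral_dlsgd_sq_le (hP : P.Regular c y₀) (N K : ℕ+) (x : E dx) :
    ∫⁻ ω, ‖(P.dlsgd c.Lg1 β₀ y₀ N K x ω).val‖ₑ ^ 2 ∂P.tapeLaw N K ≤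
      ENNReal.ofReal ((2 * c.Lf0 * (N : ℕ)) ^ 2) := by
  refine (lintegral_mono fun ω => ?_).trans_eq
    ((lintegral_const _).trans (by rw [measure_univ, mul_one]))
  rw [← ofReal_norm, ← ENNReal.ofReal_pow (norm_nonneg _)]
  apply ENNReal.ofReal_le_ofReal
  gcongr
  exact hP.norm_levelComp_le β₀ N x _ _ _

/-- A level drawn with probability p_k and weighted by p_k⁻¹ contributes p_k⁻¹ times the mean square
of its level difference, a multiple of 2^(-k). As p_k⁻¹ 2^(-k) ≤ 1, all K levels contribute equally;
12 is 6 times the 2 from splitting the square. -/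
lemma lintegral_rtmlmc_sq_le (hP : P.Regular c y₀)
    (hR : ∀ x ξ k, epochError P β₀ y₀ x ξ k ≤ R * (2 : ℝ≥0∞)⁻¹ ^ k) (N K : ℕ+) (x : E dx) :
    ∫⁻ ω, ‖(P.rtmlmc c.Lg1 β₀ y₀ N K x ω).val‖ₑ ^ 2 ∂P.tapeLaw N K ≤
      ENNReal.ofReal (2 * (2 * c.Lf0 * (N : ℕ)) ^ 2 +
        12 * (c.compLip * (N : ℕ) ^ 2) ^ 2 * R * (K : ℕ)) := by
  set C := c.compLip * ((N : ℕ) : ℝ) ^ 2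
  set D := 2 * (c.Lf0 : ℝ) * (N : ℕ)
  have hm : Measurable fun ω : Tape Ξ H => ‖(P.rtmlmc c.Lg1 β₀ y₀ N K x ω).val‖ₑ ^ 2 :=
    ((hP.measurable_rtmlmc c.Lg1 β₀ N K).comp measurable_prodMk_left).enorm.pow_const 2
  have hconv : ∀ {d : ℕ} (v : E d), ‖v‖ₑ ^ 2 = ENNReal.ofReal (‖v‖ ^ 2) := fun v => by
    rw [ENNReal.ofReal_pow (norm_nonneg _), ofReal_norm]
  have hterm : ∀ n ∈ Finset.range N, ∀ k ∈ Finset.Icc 1 (K : ℕ),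
      ENNReal.ofReal (geomWeight K k) *
        ∫⁻ ω, ‖(P.rtmlmc c.Lg1 β₀ y₀ N K x (ω, (n, k))).val‖ₑ ^ 2 ∂P.sampleLaw ≤
      ENNReal.ofReal (geomWeight K k * (2 * D ^ 2) + 12 * C ^ 2 * R) := by
    intro n hn k hk
    obtain ⟨k, rfl⟩ : ∃ j, k = j + 1 := ⟨k - 1, by have := (Finset.mem_Icc.mp hk).1; omega⟩
    have hw := geomWeight_pos K (k + 1)
    set w := geomWeight K (k + 1) with hwdef
    have hdm : Measurable fun ω => ‖P.levelComp c.Lg1 β₀ y₀ N x n (k + 1) ω -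
        P.levelComp c.Lg1 β₀ y₀ N x n k ω‖ₑ ^ 2 :=
      ((((hP.measurable_levelComp c.Lg1 β₀ N n (k + 1)).comp measurable_prodMk_left).sub
        ((hP.measurable_levelComp c.Lg1 β₀ N n k).comp measurable_prodMk_left)).enorm.pow_const 2)
    have h1 : ∫⁻ ω, ‖(P.rtmlmc c.Lg1 β₀ y₀ N K x (ω, (n, k + 1))).val‖ₑ ^ 2 ∂P.sampleLaw ≤
        ENNReal.ofReal (2 * D ^ 2) + ENNReal.ofReal (2 * w⁻¹ ^ 2) *
          ENNReal.ofReal (6 * C ^ 2 * R * (2 : ℝ)⁻¹ ^ (k + 1)) := by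
      calc _ ≤ ∫⁻ ω, (ENNReal.ofReal (2 * D ^ 2) + ENNReal.ofReal (2 * w⁻¹ ^ 2) *
            ‖P.levelComp c.Lg1 β₀ y₀ N x n (k + 1) ω -
              P.levelComp c.Lg1 β₀ y₀ N x n k ω‖ₑ ^ 2) ∂P.sampleLaw := by
            refine lintegral_mono fun ω => ?_
            rw [rtmlmc_val, hconv, hconv, ← ENNReal.ofReal_mul (by positivity),
              ← ENNReal.ofReal_add (by positivity) (by positivity)]
            apply ENNReal.ofReal_le_ofReal
            simp only [Nat.add_sub_cancel, ← hwdef]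
            set a := P.levelComp c.Lg1 β₀ y₀ N x n 0 ω
            set b := P.levelComp c.Lg1 β₀ y₀ N x n (k + 1) ω - P.levelComp c.Lg1 β₀ y₀ N x n k ω
            have ha : ‖a‖ ^ 2 ≤ D ^ 2 := by
              gcongr; exact hP.norm_levelComp_le β₀ N x n 0 ω
            have hab : ‖a + w⁻¹ • b‖ ≤ ‖a‖ + w⁻¹ * ‖b‖ := by
              refine (norm_add_le _ _).trans_eq ?_
              rw [norm_smul, Real.norm_of_nonneg (by positivity)]
            have hab2 : ‖a + w⁻¹ • b‖ ^ 2 ≤ (‖a‖ + w⁻¹ * ‖b‖) ^ 2 := by gcongr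
            linarith [sq_nonneg (‖a‖ - w⁻¹ * ‖b‖)]
        _ = ENNReal.ofReal (2 * D ^ 2) + ENNReal.ofReal (2 * w⁻¹ ^ 2) *
            ∫⁻ ω, ‖P.levelComp c.Lg1 β₀ y₀ N x n (k + 1) ω -
              P.levelComp c.Lg1 β₀ y₀ N x n k ω‖ₑ ^ 2 ∂P.sampleLaw := by
            rw [lintegral_add_left measurable_const, lintegral_const, measure_univ, mul_one,
              lintegral_const_mul _ hdm]
        _ ≤ _ := by
            gcongr
            exact hP.lintegral_levelComp_sub_sq_le hR N x (Finset.mem_range.mp hn) k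
    refine (mul_le_mul_right h1 _).trans ?_
    rw [← ENNReal.ofReal_mul (by positivity), ← ENNReal.ofReal_add (by positivity) (by positivity),
      ← ENNReal.ofReal_mul hw.le]
    apply ENNReal.ofReal_le_ofReal
    have h2 : w⁻¹ * (2 : ℝ)⁻¹ ^ (k + 1) ≤ 1 := by
      rw [inv_mul_le_iff₀ hw, mul_one]; exact half_pow_le_geomWeight K (k + 1)
    have h3 : w * (2 * w⁻¹ ^ 2 * (6 * C ^ 2 * R * (2 : ℝ)⁻¹ ^ (k + 1))) =
        12 * C ^ 2 * R * (w⁻¹ * (2 : ℝ)⁻¹ ^ (k + 1)) := by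
      field_simp; ring
    have h4 : 12 * C ^ 2 * R * (w⁻¹ * (2 : ℝ)⁻¹ ^ (k + 1)) ≤ 12 * C ^ 2 * R * 1 := by gcongr
    rw [mul_add, h3]
    linarith
  rw [P.lintegral_tapeLaw N K hm]
  have hsum : ∀ n ∈ Finset.range N, ((N : ℕ) : ℝ≥0∞)⁻¹ * ∑ k ∈ Finset.Icc 1 (K : ℕ),
      ENNReal.ofReal (geomWeight K k) *
        ∫⁻ ω, ‖(P.rtmlmc c.Lg1 β₀ y₀ N K x (ω, (n, k))).val‖ₑ ^ 2 ∂P.sampleLaw ≤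
      ((N : ℕ) : ℝ≥0∞)⁻¹ * ENNReal.ofReal (2 * D ^ 2 + 12 * C ^ 2 * R * (K : ℕ)) := by
    intro n hn
    gcongr
    refine (Finset.sum_le_sum (hterm n hn)).trans_eq ?_
    rw [← ENNReal.ofReal_sum_of_nonneg fun k _ => by
      have := (geomWeight_pos K k).le
      positivity]
    congr 1
    rw [Finset.sum_add_distrib, ← Finset.sum_mul, sum_geomWeight, one_mul, Finset.sum_const,
      Nat.card_Icc, nsmul_eq_mul]
    simp
    ring
  refine (Finset.sum_le_sum hsum).trans_eq ?_
  rw [Finset.sum_const, Finset.card_range, nsmul_eq_mul, ← mul_assoc,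
    ENNReal.mul_inv_cancel (by simp) (by simp), one_mul]

end Moments

end Regular

end Problem

end CSBO
end

noncomputable section

namespace CSBO

namespace Problem

variable {dx dy : ℕ} {Ξ H : Type*} [MeasurableSpace Ξ] [MeasurableSpace H]

/-! ### Bias of the gradient estimators -/

/-- The component with `n` Neumann factors at the lower-level solution. -/
def starComp (P : Problem dx dy Ξ H) (L : ℝ) (N : ℕ+) (x : E dx) (n : ℕ)
    (ω : Ξ × (EtaIdx → H)) : E dx :=
  (P.component L N x (P.yStar x ω.1) ω.1 ω.2 n).val

namespace Regular

variable {P : Problem dx dy Ξ H} {c : Constants} {y₀ : E dx → E dy} {β₀ : ℝ} {R : ℝ≥0}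

lemma integrable_starComp (hP : P.Regular c y₀) (N : ℕ+) (x : E dx) (n : ℕ) :
    Integrable (P.starComp c.Lg1 N x n) P.sampleLaw :=
  Integrable.of_bound (hP.measurable_component c.Lg1 N n measurable_const measurable_fst
    measurable_snd ((hP.measurable_yStar x).comp measurable_fst)).aestronglyMeasurable _
    (ae_of_all _ fun ω => hP.norm_component_le N x _ ω.1 ω.2 n)

/-- By Jensen the bias is at most the root mean square of the Lipschitz bound. The condition on b is
squared to avoid square roots. -/
lemma norm_integral_levelComp_sub_starComp_le (hP : P.Regular c y₀)
    (hR : ∀ x ξ k, epochError P β₀ y₀ x ξ k ≤ R * (2 : ℝ≥0∞)⁻¹ ^ k) (N : ℕ+) (x : E dx)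
    {n : ℕ} (hn : n < N) (k : ℕ) {b : ℝ} (hb : 0 ≤ b)
    (hbk : (c.compLip * (N : ℕ) ^ 2) ^ 2 * R * (2 : ℝ)⁻¹ ^ k ≤ b ^ 2) :
    ‖∫ ω, P.levelComp c.Lg1 β₀ y₀ N x n k ω ∂P.sampleLaw -
      ∫ ω, P.starComp c.Lg1 N x n ω ∂P.sampleLaw‖ ≤ b := by
  set C := c.compLip * ((N : ℕ) : ℝ) ^ 2
  have hC : 0 ≤ C := mul_nonneg c.compLip_nonneg (by positivity)
  have hi := (hP.integrable_levelComp β₀ N x n k).sub (hP.integrable_starComp N x n)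
  have h1 := enorm_integral_sq_le hi.aestronglyMeasurable
  have hconv : ∀ {d : ℕ} (v : E d), ‖v‖ₑ ^ 2 = ENNReal.ofReal (‖v‖ ^ 2) := fun v => by
    rw [ENNReal.ofReal_pow (norm_nonneg _), ofReal_norm]
  have h2 : ∫⁻ ω, ‖(P.levelComp c.Lg1 β₀ y₀ N x n k - P.starComp c.Lg1 N x n) ω‖ₑ ^ 2
      ∂P.sampleLaw ≤ ENNReal.ofReal (b ^ 2) := by
    calc _ ≤ ∫⁻ ω, ENNReal.ofReal (C ^ 2) *
          ‖(P.epochSGD β₀ x ω.1 ω.2 (y₀ x) k).val.2 - P.yStar x ω.1‖ₑ ^ 2 ∂P.sampleLaw := by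
          refine lintegral_mono fun ω => ?_
          rw [hconv, hconv, ← ENNReal.ofReal_mul (by positivity), ← mul_pow]
          apply ENNReal.ofReal_le_ofReal
          gcongr
          exact hP.norm_component_sub_le N x _ _ ω.1 ω.2 hn
      _ = ENNReal.ofReal (C ^ 2) * ∫⁻ ω,
          ‖(P.epochSGD β₀ x ω.1 ω.2 (y₀ x) k).val.2 - P.yStar x ω.1‖ₑ ^ 2 ∂P.sampleLaw :=
          lintegral_const_mul _ ((hP.measurable_epochStart_sub β₀ x k).enorm.pow_const 2)
      _ ≤ ENNReal.ofReal (C ^ 2) * (R * (2 : ℝ≥0∞)⁻¹ ^ k) := by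
          gcongr
          exact hP.lintegral_epochStart_sub_sq_le hR x k
      _ = ENNReal.ofReal (C ^ 2 * R * (2 : ℝ)⁻¹ ^ k) := by
          rw [show (2 : ℝ≥0∞)⁻¹ = ENNReal.ofReal 2⁻¹ by
              rw [ENNReal.ofReal_inv_of_pos two_pos]; simp, ← ENNReal.ofReal_coe_nnreal (p := R),
            ← ENNReal.ofReal_pow (by norm_num), ← ENNReal.ofReal_mul (by positivity),
            ← ENNReal.ofReal_mul (by positivity), mul_assoc]
      _ ≤ _ := ENNReal.ofReal_le_ofReal hbk
  have h3 := h1.trans h2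
  rw [hconv, ENNReal.ofReal_le_ofReal_iff (by positivity), sq_le_sq₀ (norm_nonneg _) hb] at h3
  rw [← integral_sub (hP.integrable_levelComp β₀ N x n k) (hP.integrable_starComp N x n)]
  exact h3

/-- At y* itself only the truncation of the Neumann series is left, with a bound uniform in ξ that
survives integration. -/
lemma norm_mean_starComp_sub_gradient_le (hP : P.Regular c y₀) (N : ℕ+) (x : E dx) :
    ‖((N : ℕ) : ℝ)⁻¹ • ∑ n ∈ Finset.range N, ∫ ω, P.starComp c.Lg1 N x n ω ∂P.sampleLaw -
      gradient P.F x‖ ≤ c.Lg1 * (1 / c.μ * (c.ρ ^ (N : ℕ) * c.Lf0)) := by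
  have h1 : ∀ n, Integrable (fun ξ => ∫ η, P.starComp c.Lg1 N x n (ξ, η) ∂P.etaLaw ξ)
      P.lawXi := fun n =>
    Integrable.integral_compProd (κ := Kernel.const Unit P.lawXi)
      (η := Kernel.prodMkLeft Unit P.etaLaw) (a := ()) (hP.integrable_starComp N x n)
  have h2 : ∀ n, ∫ ω, P.starComp c.Lg1 N x n ω ∂P.sampleLaw =
      ∫ ξ, ∫ η, P.starComp c.Lg1 N x n (ξ, η) ∂P.etaLaw ξ ∂P.lawXi := fun n =>
    Measure.integral_compProd (hP.integrable_starComp N x n)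
  have h3 : Integrable (fun ξ => ∑ n ∈ Finset.range N,
      ∫ η, P.starComp c.Lg1 N x n (ξ, η) ∂P.etaLaw ξ) P.lawXi :=
    integrable_finsetSum _ fun n _ => h1 n
  have h4 : Integrable (fun ξ => ((N : ℕ) : ℝ)⁻¹ • ∑ n ∈ Finset.range N,
      ∫ η, P.starComp c.Lg1 N x n (ξ, η) ∂P.etaLaw ξ) P.lawXi := h3.smul (((N : ℕ) : ℝ)⁻¹)
  rw [hP.gradient_F]
  simp_rw [h2]
  rw [← integral_finsetSum _ fun n _ => h1 n, ← integral_smul]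
  exact norm_integral_sub_integral_le h4 (hP.integrable_hyper x)
    fun ξ => hP.norm_mean_component_sub_hyper_le N x ξ

/-- The bias of the component at level `k`, averaged over the number of Neumann factors. -/
lemma norm_mean_levelComp_sub_gradient_le (hP : P.Regular c y₀)
    (hR : ∀ x ξ k, epochError P β₀ y₀ x ξ k ≤ R * (2 : ℝ≥0∞)⁻¹ ^ k) (N : ℕ+) (x : E dx)
    (k : ℕ) {b : ℝ} (hb : 0 ≤ b)
    (hbk : (c.compLip * (N : ℕ) ^ 2) ^ 2 * R * (2 : ℝ)⁻¹ ^ k ≤ b ^ 2) :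
    ‖((N : ℕ) : ℝ)⁻¹ • ∑ n ∈ Finset.range N,
        ∫ ω, P.levelComp c.Lg1 β₀ y₀ N x n k ω ∂P.sampleLaw - gradient P.F x‖ ≤
      b + c.Lg1 * (1 / c.μ * (c.ρ ^ (N : ℕ) * c.Lf0)) := by
  have hN : (0 : ℝ) < (N : ℕ) := by exact_mod_cast N.pos
  refine (norm_sub_le_norm_sub_add_norm_sub _ (((N : ℕ) : ℝ)⁻¹ • ∑ n ∈ Finset.range N,
    ∫ ω, P.starComp c.Lg1 N x n ω ∂P.sampleLaw) _).trans
    (add_le_add ?_ (hP.norm_mean_starComp_sub_gradient_le N x))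
  rw [← smul_sub, ← Finset.sum_sub_distrib, norm_smul, Real.norm_of_nonneg (by positivity),
    inv_mul_le_iff₀ hN]
  refine (norm_sum_le_of_le _ fun n hn => hP.norm_integral_levelComp_sub_starComp_le hR N x
    (Finset.mem_range.mp hn) k hb hbk).trans_eq ?_
  simp

lemma integral_dlsgd (hP : P.Regular c y₀) (N K : ℕ+) (x : E dx) :
    ∫ ω, (P.dlsgd c.Lg1 β₀ y₀ N K x ω).val ∂P.tapeLaw N K = ((N : ℕ) : ℝ)⁻¹ •
      ∑ n ∈ Finset.range N, ∫ ω, P.levelComp c.Lg1 β₀ y₀ N x n K ω ∂P.sampleLaw := by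
  have hi : Integrable (fun ω => (P.dlsgd c.Lg1 β₀ y₀ N K x ω).val) (P.tapeLaw N K) :=
    Integrable.of_bound ((hP.measurable_dlsgd c.Lg1 β₀ N K).comp
      measurable_prodMk_left).aestronglyMeasurable _
      (ae_of_all _ fun ω => hP.norm_levelComp_le β₀ N x ω.2.1 K ω.1)
  rw [P.integral_tapeLaw N K hi]
  simp_rw [dlsgd_val, ← Finset.sum_smul, sum_geomWeight, one_smul]

lemma integrable_rtmlmc (hP : P.Regular c y₀) (N K : ℕ+) (x : E dx) :
    Integrable (fun ω => (P.rtmlmc c.Lg1 β₀ y₀ N K x ω).val) (P.tapeLaw N K) := by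
  have hD : ∀ n k ω, ‖P.levelComp c.Lg1 β₀ y₀ N x n k ω‖ ≤ 2 * c.Lf0 * (N : ℕ) :=
    fun n k ω => hP.norm_levelComp_le β₀ N x n k ω
  set D := 2 * (c.Lf0 : ℝ) * (N : ℕ)
  refine Integrable.of_bound ((hP.measurable_rtmlmc c.Lg1 β₀ N K).comp
      measurable_prodMk_left).aestronglyMeasurable (D + 2 ^ (K : ℕ) * (D + D)) ?_
  filter_upwards [P.ae_tapeLaw N K] with ω hω
  have hk := Finset.mem_Icc.mp hω.2
  have hw : (geomWeight K ω.2.2)⁻¹ ≤ 2 ^ (K : ℕ) := by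
    rw [inv_le_comm₀ (geomWeight_pos K _) (by positivity), ← inv_pow]
    exact (pow_le_pow_of_le_one (by norm_num) (by norm_num) hk.2).trans
      (half_pow_le_geomWeight K _)
  rw [rtmlmc_val]
  refine (norm_add_le _ _).trans (add_le_add (hD _ _ _) ?_)
  rw [norm_smul, Real.norm_of_nonneg (inv_nonneg.mpr (geomWeight_pos K _).le)]
  gcongr
  exact (norm_sub_le _ _).trans (add_le_add (hD _ _ _) (hD _ _ _))

/-- The RT-MLMC estimator has the same mean as the DL-SGD estimator. -/
lemma integral_rtmlmc (hP : P.Regular c y₀) (N K : ℕ+) (x : E dx) :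
    ∫ ω, (P.rtmlmc c.Lg1 β₀ y₀ N K x ω).val ∂P.tapeLaw N K = ((N : ℕ) : ℝ)⁻¹ •
      ∑ n ∈ Finset.range N, ∫ ω, P.levelComp c.Lg1 β₀ y₀ N x n K ω ∂P.sampleLaw := by
  rw [P.integral_tapeLaw N K (hP.integrable_rtmlmc N K x)]
  congr 1
  refine Finset.sum_congr rfl fun n _ => ?_
  have hi := fun k => hP.integrable_levelComp β₀ N x n k
  -- The weight p_k cancels p_k⁻¹, so that summing over k telescopes to level K minus level 0, and
  -- the first component restores level 0.
  have h1 : ∀ k, geomWeight K k • ∫ ω, (P.rtmlmc c.Lg1 β₀ y₀ N K x (ω, (n, k))).val ∂P.sampleLaw =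
      geomWeight K k • ∫ ω, P.levelComp c.Lg1 β₀ y₀ N x n 0 ω ∂P.sampleLaw +
      (∫ ω, P.levelComp c.Lg1 β₀ y₀ N x n k ω ∂P.sampleLaw -
        ∫ ω, P.levelComp c.Lg1 β₀ y₀ N x n (k - 1) ω ∂P.sampleLaw) := by
    intro k
    have hs : Integrable (fun ω => P.levelComp c.Lg1 β₀ y₀ N x n k ω -
        P.levelComp c.Lg1 β₀ y₀ N x n (k - 1) ω) P.sampleLaw := (hi k).sub (hi (k - 1))
    have hs' : Integrable (fun ω => (geomWeight K k)⁻¹ • (P.levelComp c.Lg1 β₀ y₀ N x n k ω -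
        P.levelComp c.Lg1 β₀ y₀ N x n (k - 1) ω)) P.sampleLaw := hs.smul (geomWeight K k)⁻¹
    simp_rw [rtmlmc_val]
    rw [integral_add (hi 0) hs', integral_smul, integral_sub (hi k) (hi (k - 1)), smul_add,
      smul_inv_smul₀ (geomWeight_pos K k).ne']
  simp_rw [h1]
  rw [Finset.sum_add_distrib, ← Finset.sum_smul, sum_geomWeight, one_smul,
    sum_Icc_sub_pred (fun k => ∫ ω, P.levelComp c.Lg1 β₀ y₀ N x n k ω ∂P.sampleLaw)]
  abel

end Regular

/-! ### Costs -/

@[simp] lemma cost_add_xi (a b : Cost) : (a + b).xi = a.xi + b.xi := rfl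
@[simp] lemma cost_add_eta (a b : Cost) : (a + b).eta = a.eta + b.eta := rfl
@[simp] lemma cost_add_gradF (a b : Cost) : (a + b).gradF = a.gradF + b.gradF := rfl
@[simp] lemma cost_add_gradG (a b : Cost) : (a + b).gradG = a.gradG + b.gradG := rfl
@[simp] lemma cost_zero : (0 : Cost) = ⟨0, 0, 0, 0⟩ := rfl

lemma cost_epochSteps (P : Problem dx dy Ξ H) (β₀ : ℝ) (x : E dx) (ξ : Ξ) (η : EtaIdx → H)
    (k : ℕ) (y : E dy) (j : ℕ) :
    (P.epochSteps β₀ x ξ η k y j).cost = ⟨0, j, 0, j⟩ := by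
  induction j with
  | zero => rfl
  | succ j ih =>
    ext <;> simp [epochSteps, Counted.bind, Counted.pure, Counted.sampleEta, Counted.evalG, ih]

/-- Epochs 1 to k take 2 + 4 + ⋯ + 2^k steps. -/
lemma cost_epochSGD (P : Problem dx dy Ξ H) (β₀ : ℝ) (x : E dx) (ξ : Ξ) (η : EtaIdx → H)
    (y : E dy) (k : ℕ) :
    (P.epochSGD β₀ x ξ η y k).cost = ⟨0, 2 ^ (k + 1) - 2, 0, 2 ^ (k + 1) - 2⟩ := by
  have h2 : ∀ k : ℕ, 2 ≤ 2 ^ (k + 1) := fun k => by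
    rw [pow_succ]; have := Nat.one_le_two_pow (n := k); omega
  induction k with
  | zero => rfl
  | succ k ih =>
    have := h2 k
    have e : 2 ^ (k + 1 + 1) = 2 * 2 ^ (k + 1) := by ring
    ext <;> simp [epochSGD, Counted.bind, Counted.pure, cost_epochSteps, ih] <;> omega

lemma cost_neumann (P : Problem dx dy Ξ H) (L : ℝ) (x : E dx) (y : E dy) (ξ : Ξ)
    (η : EtaIdx → H) (n : ℕ) (r : E dy) : (P.neumann L x y ξ η n r).cost = ⟨0, 0, 0, n⟩ := by
  induction n generalizing r with
  | zero => rfl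
  | succ n ih => ext <;> simp [neumann, Counted.bind, Counted.evalG, ih, add_comm]

lemma cost_component (P : Problem dx dy Ξ H) (L : ℝ) (N : ℕ+) (x : E dx) (y : E dy) (ξ : Ξ)
    (η : EtaIdx → H) (n : ℕ) : (P.component L N x y ξ η n).cost = ⟨0, 0, 1, n + 1⟩ := by
  ext <;> simp [component, Counted.bind, Counted.evalG, Counted.evalF, Counted.pure, cost_neumann]

lemma cost_dlsgd (P : Problem dx dy Ξ H) (L β₀ : ℝ) (y₀ : E dx → E dy) (N K : ℕ+) (x : E dx)
    (ω : Tape Ξ H) : (P.dlsgd L β₀ y₀ N K x ω).cost =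
      ⟨1, 2 ^ ((K : ℕ) + 1) + ω.2.1, 1, 2 ^ ((K : ℕ) + 1) - 1 + ω.2.1⟩ := by
  have h2 : 2 ≤ 2 ^ ((K : ℕ) + 1) := by
    rw [pow_succ]; have := Nat.one_le_two_pow (n := K); omega
  ext <;> simp [dlsgd, Counted.bind, Counted.sampleXi, Counted.sampleEta, cost_component,
    cost_epochSGD] <;> omega

/-- The three components share their N̂ + 2 samples, so only the derivative evaluations triple; in
the count of η the 2 extra samples offset the -2 of the epochs. -/
lemma cost_rtmlmc (P : Problem dx dy Ξ H) (L β₀ : ℝ) (y₀ : E dx → E dy) (N K : ℕ+) (x : E dx)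
    (ω : Tape Ξ H) : (P.rtmlmc L β₀ y₀ N K x ω).cost =
      ⟨1, 2 ^ (ω.2.2 + 1) + ω.2.1, 3, 2 ^ (ω.2.2 + 1) - 2 + 3 * (ω.2.1 + 1)⟩ := by
  have h2 : 2 ≤ 2 ^ (ω.2.2 + 1) := by
    rw [pow_succ]; have := Nat.one_le_two_pow (n := ω.2.2); omega
  ext <;> simp [rtmlmc, Counted.bind, Counted.sampleXi, Counted.sampleEta, Counted.pure,
    cost_component, cost_epochSGD] <;> omega

/-- A count of oracle calls is additive. -/
lemma count_sgd {α' : Type*} {v : E dx → α' → Counted (E dx)} {count : Cost → ℕ} {φ : α' → ℕ}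
    (h0 : count 0 = 0) (hadd : ∀ a b, count (a + b) = count a + count b)
    (hφ : ∀ x e, count (v x e).cost = φ e) (a : ℝ) (x₁ : E dx) (ω : ℕ → α') (t : ℕ) :
    count (sgd v a x₁ ω t).cost = ∑ s ∈ Finset.range t, φ (ω s) := by
  induction t with
  | zero => exact h0
  | succ t ih =>
    rw [Finset.sum_range_succ, ← ih, ← hφ (sgd v a x₁ ω t).val (ω t)]
    simp only [sgd, Counted.bind, Counted.pure, hadd, h0, add_zero]

/-- The expected total of a count is `T` times the expectation of one estimator. -/
lemma lintegral_count_totalCost {α' : Type*} [MeasurableSpace α'] {ρ : Measure α'}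
    [IsProbabilityMeasure ρ] {v : E dx → α' → Counted (E dx)} {count : Cost → ℕ} {φ : α' → ℕ}
    (h0 : count 0 = 0) (hadd : ∀ a b, count (a + b) = count a + count b)
    (hφ : ∀ x e, count (v x e).cost = φ e) (hφm : Measurable φ) (a : ℝ) (x₁ : E dx) (T : ℕ+) :
    ∫⁻ ω, (count (totalCost v a x₁ T ω) : ℝ≥0∞) ∂(Measure.infinitePi fun _ : ℕ => ρ).prod
      (unif T) = (T : ℕ) * ∫⁻ e, (φ e : ℝ≥0∞) ∂ρ := by
  have hm : Measurable fun e => (φ e : ℝ≥0∞) := Measurable.of_discrete.comp hφm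
  have h1 : ∀ ω : (ℕ → α') × ℕ, (count (totalCost v a x₁ T ω) : ℝ≥0∞) =
      ∑ s ∈ Finset.range T, (φ (ω.1 s) : ℝ≥0∞) := fun ω => by
    rw [totalCost, count_sgd h0 hadd hφ, Nat.cast_sum]
  simp_rw [h1]
  rw [lintegral_finsetSum (f := fun s (ω : (ℕ → α') × ℕ) => (φ (ω.1 s) : ℝ≥0∞)) _
    fun s _ => hm.comp ((measurable_pi_apply s).comp measurable_fst)]
  have h2 : ∀ s ∈ Finset.range T, ∫⁻ ω : (ℕ → α') × ℕ, (φ (ω.1 s) : ℝ≥0∞)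
      ∂(Measure.infinitePi fun _ : ℕ => ρ).prod (unif T) = ∫⁻ e, (φ e : ℝ≥0∞) ∂ρ := fun s _ =>
    ((measurePreserving_eval_infinitePi (fun _ : ℕ => ρ) s).comp
      measurePreserving_fst).lintegral_comp hm
  rw [Finset.sum_congr rfl h2]
  simp

/-- An almost sure bound on one estimator bounds the total count. -/
lemma ae_count_totalCost_le {α' : Type*} [MeasurableSpace α'] {ρ : Measure α'}
    [IsProbabilityMeasure ρ] {v : E dx → α' → Counted (E dx)} {count : Cost → ℕ} {φ : α' → ℕ}
    (h0 : count 0 = 0) (hadd : ∀ a b, count (a + b) = count a + count b)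
    (hφ : ∀ x e, count (v x e).cost = φ e) {M : ℕ} (hM : ∀ᵐ e ∂ρ, φ e ≤ M) (a : ℝ) (x₁ : E dx)
    (T : ℕ+) :
    ∀ᵐ ω ∂(Measure.infinitePi fun _ : ℕ => ρ).prod (unif T),
      count (totalCost v a x₁ T ω) ≤ (T : ℕ) * M := by
  have h1 : ∀ᵐ ω : (ℕ → α') × ℕ ∂(Measure.infinitePi fun _ : ℕ => ρ).prod (unif T),
      ∀ s, φ (ω.1 s) ≤ M := by
    rw [ae_all_iff]
    exact fun s => ((measurePreserving_eval_infinitePi (fun _ : ℕ => ρ) s).comp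
      measurePreserving_fst).quasiMeasurePreserving.ae hM
  filter_upwards [h1] with ω hω
  rw [totalCost, count_sgd h0 hadd hφ]
  exact (Finset.sum_le_sum fun s _ => hω s).trans_eq (by simp)

/-- The expected number of oracle calls of one RT-MLMC estimator. -/
lemma lintegral_tapeLaw_two_pow_le (P : Problem dx dy Ξ H) (N K : ℕ+) :
    ∫⁻ ω, ((2 ^ (ω.2.2 + 1) + 3 * ((N : ℕ) + 1) : ℕ) : ℝ≥0∞) ∂P.tapeLaw N K ≤
      ((4 * (K : ℕ) + 3 * ((N : ℕ) + 1) : ℕ) : ℝ≥0∞) := by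
  rw [P.lintegral_tapeLaw N K (by fun_prop)]
  have h1 : ∑ k ∈ Finset.Icc 1 (K : ℕ), ENNReal.ofReal (geomWeight K k) *
      ((2 ^ (k + 1) + 3 * ((N : ℕ) + 1) : ℕ) : ℝ≥0∞) ≤
      ((4 * (K : ℕ) + 3 * ((N : ℕ) + 1) : ℕ) : ℝ≥0∞) := by
    have e : ∀ m : ℕ, (m : ℝ≥0∞) = ENNReal.ofReal m := fun m => (ENNReal.ofReal_natCast m).symm
    simp_rw [e, ← ENNReal.ofReal_mul (geomWeight_pos K _).le]
    rw [← ENNReal.ofReal_sum_of_nonneg fun k _ =>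
      mul_nonneg (geomWeight_pos K k).le (Nat.cast_nonneg _)]
    apply ENNReal.ofReal_le_ofReal
    push_cast
    simp_rw [mul_add (geomWeight K _)]
    rw [Finset.sum_add_distrib, ← Finset.sum_mul, sum_geomWeight, one_mul]
    gcongr
    -- The probability of level k offsets its cost: p_k 2^(k+1) ≤ 4 for each of the K levels.
    refine (Finset.sum_le_sum (g := fun _ => (4 : ℝ)) fun k _ => ?_).trans_eq ?_
    · calc geomWeight K k * 2 ^ (k + 1) ≤ 2 * (2 : ℝ)⁻¹ ^ k * 2 ^ (k + 1) := by
            gcongr; exact geomWeight_le K k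
        _ = 4 := by rw [pow_succ, inv_pow]; field_simp; norm_num
    · simp [mul_comm]
  simp only [lintegral_const, measure_univ, mul_one]
  calc _ ≤ ∑ n ∈ Finset.range N, ((N : ℕ) : ℝ≥0∞)⁻¹ *
        ((4 * (K : ℕ) + 3 * ((N : ℕ) + 1) : ℕ) : ℝ≥0∞) := by
        gcongr
    _ = _ := by
        rw [Finset.sum_const, Finset.card_range, nsmul_eq_mul, ← mul_assoc,
          ENNReal.mul_inv_cancel (by simp) (by simp), one_mul]

/-- Expected complexity of the SGD framework with the RT-MLMC estimator. -/
lemma lintegral_count_rtmlmc_le (P : Problem dx dy Ξ H) (L β₀ : ℝ) (y₀ : E dx → E dy)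
    (N K T : ℕ+) (a : ℝ) (x₁ : E dx) {count : Cost → ℕ}
    (hc : count ∈ ({Cost.xi, Cost.eta, Cost.gradF, Cost.gradG} : Set (Cost → ℕ))) :
    ∫⁻ ω, (count (totalCost (P.rtmlmc L β₀ y₀ N K) a x₁ T ω) : ℝ≥0∞) ∂P.runLaw N K T ≤
      (((T : ℕ) * (4 * (K : ℕ) + 3 * ((N : ℕ) + 1)) : ℕ) : ℝ≥0∞) := by
  -- All four counts share the majorant 2^(k+1) + 3(N + 1).
  have key : ∀ (count : Cost → ℕ) (φ : ℕ → ℕ → ℕ), count 0 = 0 →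
      (∀ a b, count (a + b) = count a + count b) →
      (∀ x ω, count (P.rtmlmc L β₀ y₀ N K x ω).cost = φ ω.2.1 ω.2.2) →
      (∀ n k, n < (N : ℕ) → φ n k ≤ 2 ^ (k + 1) + 3 * ((N : ℕ) + 1)) →
      ∫⁻ ω, (count (totalCost (P.rtmlmc L β₀ y₀ N K) a x₁ T ω) : ℝ≥0∞) ∂P.runLaw N K T ≤
        (((T : ℕ) * (4 * (K : ℕ) + 3 * ((N : ℕ) + 1)) : ℕ) : ℝ≥0∞) := by
    intro count φ h0 hadd hφ hle
    rw [runLaw, lintegral_count_totalCost (φ := fun ω => φ ω.2.1 ω.2.2) h0 hadd hφ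
      ((Measurable.of_discrete (f := fun q : ℕ × ℕ => φ q.1 q.2)).comp measurable_snd),
      Nat.cast_mul]
    gcongr
    refine le_trans (lintegral_mono_ae ?_) (P.lintegral_tapeLaw_two_pow_le N K)
    filter_upwards [P.ae_tapeLaw N K] with ω hω
    exact_mod_cast hle _ _ hω.1
  rcases hc with rfl | rfl | rfl | rfl
  · exact key _ (fun _ _ => 1) rfl (fun _ _ => rfl) (fun x ω => by rw [cost_rtmlmc])
      fun n k _ => by have := Nat.one_le_two_pow (n := k + 1); omega
  · exact key _ (fun n k => 2 ^ (k + 1) + n) rfl (fun _ _ => rfl)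
      (fun x ω => by rw [cost_rtmlmc]) fun n k _ => by have := Nat.one_le_two_pow (n := k + 1); omega
  · exact key _ (fun _ _ => 3) rfl (fun _ _ => rfl) (fun x ω => by rw [cost_rtmlmc])
      fun n k _ => by have := Nat.one_le_two_pow (n := k + 1); omega
  · exact key _ (fun n k => 2 ^ (k + 1) - 2 + 3 * (n + 1)) rfl (fun _ _ => rfl)
      (fun x ω => by rw [cost_rtmlmc]) fun n k _ => by have := Nat.one_le_two_pow (n := k + 1); omega

/-- Almost sure complexity of the SGD framework with the DL-SGD estimator. -/
lemma ae_count_dlsgd_le (P : Problem dx dy Ξ H) (L β₀ : ℝ) (y₀ : E dx → E dy)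
    (N K T : ℕ+) (a : ℝ) (x₁ : E dx) : ∀ᵐ ω ∂P.runLaw N K T,
      (∀ count ∈ ({Cost.xi, Cost.gradF} : Set (Cost → ℕ)),
        count (totalCost (P.dlsgd L β₀ y₀ N K) a x₁ T ω) ≤ (T : ℕ)) ∧
      (∀ count ∈ ({Cost.eta, Cost.gradG} : Set (Cost → ℕ)),
        count (totalCost (P.dlsgd L β₀ y₀ N K) a x₁ T ω) ≤
          (T : ℕ) * (2 ^ ((K : ℕ) + 1) + (N : ℕ))) := by
  have hN : ∀ᵐ ω ∂P.tapeLaw N K, ω.2.1 ≤ (N : ℕ) :=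
    (P.ae_tapeLaw N K).mono fun ω hω => hω.1.le
  have h1 := ae_count_totalCost_le (ρ := P.tapeLaw N K) (v := P.dlsgd L β₀ y₀ N K)
    (count := Cost.xi) (φ := fun _ => 1) (M := 1) rfl (fun _ _ => rfl)
    (fun x ω => by rw [cost_dlsgd]) (ae_of_all _ fun _ => le_rfl) a x₁ T
  have h2 := ae_count_totalCost_le (ρ := P.tapeLaw N K) (v := P.dlsgd L β₀ y₀ N K)
    (count := Cost.gradF) (φ := fun _ => 1) (M := 1) rfl (fun _ _ => rfl)
    (fun x ω => by rw [cost_dlsgd]) (ae_of_all _ fun _ => le_rfl) a x₁ T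
  have h3 := ae_count_totalCost_le (ρ := P.tapeLaw N K) (v := P.dlsgd L β₀ y₀ N K)
    (count := Cost.eta) (φ := fun ω => 2 ^ ((K : ℕ) + 1) + ω.2.1)
    (M := 2 ^ ((K : ℕ) + 1) + (N : ℕ)) rfl (fun _ _ => rfl)
    (fun x ω => by rw [cost_dlsgd]) (hN.mono fun ω h => by gcongr) a x₁ T
  have h4 := ae_count_totalCost_le (ρ := P.tapeLaw N K) (v := P.dlsgd L β₀ y₀ N K)
    (count := Cost.gradG) (φ := fun ω => 2 ^ ((K : ℕ) + 1) - 1 + ω.2.1)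
    (M := 2 ^ ((K : ℕ) + 1) + (N : ℕ)) rfl (fun _ _ => rfl)
    (fun x ω => by rw [cost_dlsgd]) (hN.mono fun ω h => by gcongr; exact Nat.sub_le _ _) a x₁ T
  rw [runLaw]
  filter_upwards [h1, h2, h3, h4] with ω h1 h2 h3 h4
  refine ⟨?_, ?_⟩
  · rintro count (rfl | rfl)
    · simpa using h1
    · simpa using h2
  · rintro count (rfl | rfl)
    · exact h3
    · exact h4

end Problem

end CSBO
end

noncomputable section

namespace CSBO

/-! ### Choice of the parameters -/

/-- Every accuracy is comparable to a power of `1 / 2` with logarithmic exponent. -/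
lemma exists_dyadic_level {ε : ℝ} (h0 : 0 < ε) (h1 : ε ≤ 1 / 2) :
    ∃ j : ℕ, 1 ≤ j ∧ (2 : ℝ)⁻¹ ^ j ≤ ε ∧ (2 : ℝ) ^ j ≤ 2 * (1 / ε) ∧
      (j : ℝ) ≤ 4 * Real.log (1 / ε) := by
  -- 2^(-(n+1)) < ε ≤ 2^(-n); the level is j = n + 1.
  obtain ⟨n, hn1, hn2⟩ := exists_nat_pow_near_of_lt_one (y := (2 : ℝ)⁻¹) h0
    (by linarith : ε ≤ 1) (by norm_num) (by norm_num)
  have hpow : (2 : ℝ) ^ n ≤ 1 / ε := by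
    rw [le_div_iff₀ h0]
    calc (2 : ℝ) ^ n * ε ≤ 2 ^ n * 2⁻¹ ^ n := by gcongr
      _ = 1 := by rw [← mul_pow]; norm_num
  refine ⟨n + 1, by omega, hn1.le, ?_, ?_⟩
  · rw [pow_succ]; linarith
  · have hl := Real.log_two_gt_d9
    have h2 : Real.log 2 ≤ Real.log (1 / ε) :=
      Real.log_le_log two_pos (by rw [le_div_iff₀ h0]; linarith)
    have h3 : n * Real.log 2 ≤ Real.log (1 / ε) := by
      rw [← Real.log_pow]; exact Real.log_le_log (by positivity) hpow
    push_cast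
    nlinarith [(Nat.cast_nonneg n : (0 : ℝ) ≤ n)]

/-- Parameters for the accuracy `2^(-j)`. -/
lemma exists_parameters {ρ G A B R Λ Δ : ℝ} (hρ0 : 0 ≤ ρ) (hρ1 : ρ < 1) (hR : 0 ≤ R)
    (hΛ : 0 ≤ Λ) :
    ∃ D : ℝ, 1 ≤ D ∧ ∀ j : ℕ, 1 ≤ j → ∃ (N K T : ℕ+) (α W : ℝ),
      ((N : ℕ) : ℝ) ≤ D * j ∧ ((K : ℕ) : ℝ) ≤ D * j ∧ (2 : ℝ) ^ (K : ℕ) ≤ D * 4 ^ j * j ^ 4 ∧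
      0 < α ∧ α ≤ D * (2⁻¹ ^ j) ^ 2 ∧ ((T : ℕ) : ℝ) ≤ D * 16 ^ j * j ^ 5 ∧
      G * ρ ^ (N : ℕ) ≤ 2⁻¹ ^ j / 4 ∧
      (A * (N : ℕ) ^ 2) ^ 2 * R * 2⁻¹ ^ (K : ℕ) ≤ (2⁻¹ ^ j / 4) ^ 2 ∧
      0 ≤ W ∧ 2 * (B * (N : ℕ)) ^ 2 + 12 * (A * (N : ℕ) ^ 2) ^ 2 * R * (K : ℕ) ≤ W ∧
      2 * Δ / (α * (T : ℕ)) + (2⁻¹ ^ j / 2) ^ 2 + 2 * Λ * α * W ≤ (2⁻¹ ^ j) ^ 2 := by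
  set G' := max G 1
  have hG' : 1 ≤ G' := le_max_right _ _
  -- N = (m + 1)j makes G ρ^N at most 8^(-j).
  obtain ⟨m, hm⟩ := exists_pow_lt_of_lt_one (show (0 : ℝ) < 1 / (8 * G') by positivity) hρ1
  -- K = 2j + a + 4s with 2^s comparable to j: 2j supplies the accuracy squared, a absorbs the
  -- constants, and 4s absorbs the factor j⁴ of N⁴.
  obtain ⟨a, ha⟩ := pow_unbounded_of_one_lt (16 * A ^ 2 * (m + 1) ^ 4 * R) one_lt_two
  -- The second moment grows like N⁴K, hence like j⁵ since K ≤ (6 + a)j.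
  set W₀ := 2 * (B * (m + 1)) ^ 2 + 12 * A ^ 2 * (m + 1) ^ 4 * R * (6 + a) + 1 with hW₀_eq
  have hW₀ : 1 ≤ W₀ := le_add_of_nonneg_left (by positivity)
  clear_value W₀
  set Γ := 64 * |Δ| * (Λ + 1) * W₀ with hΓ_eq
  have hΓ : 0 ≤ Γ := by positivity
  clear_value Γ
  have ha0 : (0 : ℝ) < 2 ^ a := by positivity
  have hm0 : (0 : ℝ) ≤ m := by positivity
  have haa : (0 : ℝ) ≤ a := by positivity
  obtain ⟨D, hD1, hDm, hDa, hD2, hDΓ⟩ : ∃ D : ℝ, 1 ≤ D ∧ m + 1 ≤ D ∧ 6 + a ≤ D ∧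
      2 ^ a * 16 ≤ D ∧ Γ + 2 ≤ D :=
    ⟨(m + 1) + (6 + a) + 2 ^ a * 16 + (Γ + 2), by linarith, by linarith, by linarith,
      by linarith, by linarith⟩
  refine ⟨D, hD1, fun j hj => ?_⟩
  have hj1 : (1 : ℝ) ≤ j := by exact_mod_cast hj
  set e : ℝ := 2⁻¹ ^ j with he
  have he0 : 0 < e := by positivity
  clear_value e
  have he4 : e ^ 2 * 4 ^ j = 1 := by
    rw [he, ← pow_mul, mul_comm j, pow_mul, ← mul_pow]; norm_num
  have he16 : e ^ 4 * 16 ^ j = 1 := by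
    rw [he, ← pow_mul, mul_comm j, pow_mul, ← mul_pow]; norm_num
  -- The rounded-up binary logarithm, so that j ≤ 2^s ≤ 2j.
  set s := Nat.clog 2 j with hs_eq
  have hs1 : j ≤ 2 ^ s := Nat.le_pow_clog (by norm_num) j
  have hs2 : 2 ^ s ≤ 2 * j := by
    rcases Nat.eq_zero_or_pos s with h | h
    · rw [h]; omega
    · have h2 : 2 ^ (s - 1) < j := by
        have hj2 : 1 < j := by
          by_contra hcon
          have : j = 1 := by omega
          simp [hs_eq, this] at h
        exact Nat.pow_pred_clog_lt_self (by norm_num) hj2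
      obtain ⟨t, ht⟩ : ∃ t, s = t + 1 := ⟨s - 1, by omega⟩
      rw [ht] at h2 ⊢
      rw [Nat.add_sub_cancel] at h2
      rw [pow_succ]; omega
  have hs3 : s ≤ j := (Nat.clog_le_iff_le_pow (by norm_num)).mpr Nat.lt_two_pow_self.le
  clear_value s
  have hs1' : (j : ℝ) ≤ 2 ^ s := by exact_mod_cast hs1
  have hs2' : (2 : ℝ) ^ s ≤ 2 * j := by exact_mod_cast hs2
  have hs3' : (s : ℝ) ≤ j := by exact_mod_cast hs3
  set W := W₀ * (j : ℝ) ^ 5 with hW_eq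
  have hW : 0 < W := by positivity
  -- Makes 2ΛαW ≤ e²/4; Λ + 1 avoids division by zero.
  set α := e ^ 2 / (8 * (Λ + 1) * W) with hα_eq
  have hα : 0 < α := by positivity
  have hαe : 8 * (Λ + 1) * W * α = e ^ 2 := by
    rw [hα_eq]; field_simp
  clear_value W
  have hNval : (((m + 1) * j : ℕ) : ℝ) = (m + 1) * j := by push_cast; ring
  have hKval : ((2 * j + a + 4 * s : ℕ) : ℝ) = 2 * j + a + 4 * s := by push_cast; ring
  have hKle : ((2 * j + a + 4 * s : ℕ) : ℝ) ≤ (6 + a) * j := by rw [hKval]; nlinarith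
  -- Makes 2Δ/(αT) ≤ e²/4; the absolute value dispenses with the sign of Δ, and T = T₀ + 1 is
  -- positive even for Δ = 0.
  set T₀ := ⌈8 * |Δ| / (α * e ^ 2)⌉₊
  have hΔα : 8 * |Δ| / (α * e ^ 2) = Γ * 16 ^ j * j ^ 5 := by
    rw [div_eq_iff (by positivity)]
    have : Γ * 16 ^ j * (j : ℝ) ^ 5 * (α * e ^ 2) =
        8 * |Δ| * (8 * (Λ + 1) * W * α) * e ^ 2 * 16 ^ j := by rw [hΓ_eq, hW_eq]; ring
    rw [this, hαe]
    linear_combination (-8 * |Δ|) * he16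
  have hTle : ((T₀ + 1 : ℕ) : ℝ) ≤ Γ * 16 ^ j * j ^ 5 + 2 := by
    have : (T₀ : ℝ) ≤ 8 * |Δ| / (α * e ^ 2) + 1 := (Nat.ceil_lt_add_one (by positivity)).le
    rw [hΔα] at this
    push_cast
    linarith
  refine ⟨⟨(m + 1) * j, by positivity⟩, ⟨2 * j + a + 4 * s, by omega⟩, ⟨T₀ + 1, by omega⟩, α, W,
    ?_, ?_, ?_, hα, ?_, ?_, ?_, ?_, hW.le, ?_, ?_⟩ <;> try simp only [PNat.mk_coe]
  · rw [hNval]; gcongr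
  · refine hKle.trans ?_
    gcongr
  · calc (2 : ℝ) ^ (2 * j + a + 4 * s) = 2 ^ a * 4 ^ j * (2 ^ s) ^ 4 := by
          rw [pow_add, pow_add, pow_mul, mul_comm 4 s, pow_mul (2 : ℝ) s 4]; norm_num; ring
      _ ≤ 2 ^ a * 4 ^ j * (2 * j) ^ 4 := by gcongr
      _ = (2 ^ a * 16) * 4 ^ j * j ^ 4 := by ring
      _ ≤ D * 4 ^ j * j ^ 4 := by gcongr
  · have h1 : 1 ≤ 8 * (Λ + 1) * W := by
      have hW1 : 1 ≤ W := hW_eq ▸ one_le_mul_of_one_le_of_one_le hW₀ (one_le_pow₀ hj1)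
      exact one_le_mul_of_one_le_of_one_le (by linarith) hW1
    calc α ≤ e ^ 2 := hα_eq ▸ div_le_self (by positivity) h1
      _ ≤ D * e ^ 2 := le_mul_of_one_le_left (by positivity) hD1
  · have h1 : (1 : ℝ) ≤ 16 ^ j * j ^ 5 :=
      one_le_mul_of_one_le_of_one_le (one_le_pow₀ (by norm_num)) (one_le_pow₀ hj1)
    have h2 : (Γ + 2) * (16 ^ j * (j : ℝ) ^ 5) ≤ D * (16 ^ j * (j : ℝ) ^ 5) := by
      gcongr
    linarith
  · rw [pow_mul]
    have h1 : ρ ^ (m + 1) ≤ 1 / (8 * G') :=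
      (pow_le_pow_of_le_one hρ0 hρ1.le (Nat.le_succ m)).trans hm.le
    -- As G' ≥ 1 and j ≥ 1, the constant can be raised to the power j and absorbed into the base.
    calc G * (ρ ^ (m + 1)) ^ j ≤ G' ^ j * (ρ ^ (m + 1)) ^ j := by
          gcongr
          exact (le_max_left _ _).trans (le_self_pow₀ hG' (by omega))
      _ = (G' * ρ ^ (m + 1)) ^ j := (mul_pow _ _ _).symm
      _ ≤ (1 / 8) ^ j := by
          gcongr
          calc G' * ρ ^ (m + 1) ≤ G' * (1 / (8 * G')) := by gcongr
            _ = 1 / 8 := by field_simp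
      _ = 2⁻¹ ^ j * (1 / 4) ^ j := by rw [← mul_pow]; norm_num
      _ ≤ 2⁻¹ ^ j * (1 / 4) ^ 1 := by
          gcongr 2⁻¹ ^ j * ?_
          exact pow_le_pow_of_le_one (by norm_num) (by norm_num) hj
      _ = e / 4 := by rw [pow_one, he]; ring
  · have h1 : (2 : ℝ)⁻¹ ^ (2 * j + a + 4 * s) * (2 ^ a * (2 ^ s) ^ 4) = e ^ 2 := by
      rw [he, pow_add, pow_add, ← pow_mul, ← pow_mul, mul_comm j, mul_comm s]
      simp only [inv_pow]
      field_simp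
    rw [hNval]
    calc (A * ((m + 1) * (j : ℝ)) ^ 2) ^ 2 * R * 2⁻¹ ^ (2 * j + a + 4 * s)
        = (16 * A ^ 2 * (m + 1) ^ 4 * R) * (j : ℝ) ^ 4 * 2⁻¹ ^ (2 * j + a + 4 * s) / 16 := by ring
      _ ≤ 2 ^ a * (2 ^ s) ^ 4 * 2⁻¹ ^ (2 * j + a + 4 * s) / 16 := by gcongr
      _ = (e / 4) ^ 2 := by linear_combination h1 / 16
  · rw [hNval]
    have hjj : (j : ℝ) ^ 2 ≤ j ^ 5 := pow_le_pow_right₀ hj1 (by norm_num)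
    calc 2 * (B * ((m + 1) * (j : ℝ))) ^ 2 + 12 * (A * ((m + 1) * (j : ℝ)) ^ 2) ^ 2 * R *
          ((2 * j + a + 4 * s : ℕ) : ℝ)
        ≤ 2 * (B * ((m + 1) * (j : ℝ))) ^ 2 + 12 * (A * ((m + 1) * (j : ℝ)) ^ 2) ^ 2 * R *
          ((6 + a) * j) := by gcongr
      _ = 2 * (B * (m + 1)) ^ 2 * (j : ℝ) ^ 2 +
          12 * A ^ 2 * (m + 1) ^ 4 * R * (6 + a) * (j : ℝ) ^ 5 := by ring
      _ ≤ 2 * (B * (m + 1)) ^ 2 * (j : ℝ) ^ 5 +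
          12 * A ^ 2 * (m + 1) ^ 4 * R * (6 + a) * (j : ℝ) ^ 5 := by gcongr
      _ ≤ W := by
          rw [hW_eq, hW₀_eq]
          linarith [show (0 : ℝ) ≤ (j : ℝ) ^ 5 by positivity]
  · have hT : 8 * |Δ| / (α * e ^ 2) ≤ ((T₀ + 1 : ℕ) : ℝ) :=
      (Nat.le_ceil _).trans (by push_cast; linarith)
    have hT0 : (0 : ℝ) < ((T₀ + 1 : ℕ) : ℝ) := by positivity
    have h1 : 2 * Δ / (α * ((T₀ + 1 : ℕ) : ℝ)) ≤ e ^ 2 / 4 := by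
      rw [div_le_iff₀ (by positivity)] at hT ⊢
      linarith [le_abs_self Δ]
    have h2 : 2 * Λ * α * W ≤ e ^ 2 / 4 := by
      rw [← hαe]; linarith [mul_pos hα hW]
    linarith [show (e / 2) ^ 2 = e ^ 2 / 4 by ring, sq_nonneg e]

end CSBO
end

noncomputable section

namespace CSBO

/-- The common conversion of a bound in terms of the dyadic level `j` into one in terms of `ε`. -/
lemma dyadic_bound_le {ε : ℝ} (h0 : 0 < ε) {j : ℕ} (hj : 1 ≤ j)
    (h2 : (2 : ℝ) ^ j ≤ 2 * (1 / ε)) (hl : (j : ℝ) ≤ 4 * Real.log (1 / ε)) {M : ℝ} (hM : 0 ≤ M)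
    (r : ℕ) {p : ℕ} (hp : p ≤ 9) :
    M * ((2 : ℝ) ^ j) ^ r * j ^ p ≤ M * 2 ^ r * 4 ^ 9 * (1 / ε) ^ r * Real.log (1 / ε) ^ 9 := by
  have hj1 : (1 : ℝ) ≤ j := by exact_mod_cast hj
  calc M * ((2 : ℝ) ^ j) ^ r * j ^ p ≤ M * (2 * (1 / ε)) ^ r * j ^ 9 := by
        gcongr
    _ ≤ M * (2 * (1 / ε)) ^ r * (4 * Real.log (1 / ε)) ^ 9 := by gcongr
    _ = _ := by ring

end CSBO

end

/-! ### The complexity theorem -/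

theorem theorem1 (c : CSBO.Constants) (Δ β₀ : ℝ) (hβ₀ : 4 / c.μ ≤ β₀) :
    ∃ (C : ℝ) (q : ℕ) (N K T : ℝ → ℕ+) (α : ℝ → ℝ),
      -- orders of the parameters
      (∀ ε : ℝ, 0 < ε → ε ≤ 1 / 2 →
        ((N ε : ℕ) : ℝ) ≤ C * Real.log (1 / ε) ∧
        ((K ε : ℕ) : ℝ) ≤ C * Real.log (1 / ε) ∧
        0 < α ε ∧ α ε ≤ C * ε ^ 2 ∧
        ((T ε : ℕ) : ℝ) ≤ C * (1 / ε) ^ 4 * Real.log (1 / ε) ^ q) ∧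
      ∀ (dx dy : ℕ) (Ξ : Type*) (H : Type*) [MeasurableSpace Ξ] [MeasurableSpace H]
        (P : CSBO.Problem dx dy Ξ H) (y₀ : CSBO.E dx → CSBO.E dy) (x₁ : CSBO.E dx),
        P.Regular c y₀ → (∀ x, P.F x₁ - P.F x ≤ Δ) →
        P.WellDefined ∧
        ∀ ε : ℝ, 0 < ε → ε ≤ 1 / 2 →
          -- RT-MLMC: stationarity and expected complexities
          (∫⁻ ω, ‖gradient P.F (CSBO.Problem.output
              (P.rtmlmc c.Lg1 β₀ y₀ (N ε) (K ε)) (α ε) x₁ ω)‖ₑ ^ 2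
            ∂P.runLaw (N ε) (K ε) (T ε) ≤ ENNReal.ofReal (ε ^ 2)) ∧
          (∀ count ∈ ({CSBO.Cost.xi, CSBO.Cost.eta, CSBO.Cost.gradF, CSBO.Cost.gradG} :
              Set (CSBO.Cost → ℕ)),
            ∫⁻ ω, (count (CSBO.Problem.totalCost
                (P.rtmlmc c.Lg1 β₀ y₀ (N ε) (K ε)) (α ε) x₁ (T ε) ω) : ENNReal)
              ∂P.runLaw (N ε) (K ε) (T ε)
              ≤ ENNReal.ofReal (C * (1 / ε) ^ 4 * Real.log (1 / ε) ^ q)) ∧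
          -- DL-SGD: stationarity and almost sure complexities
          (∫⁻ ω, ‖gradient P.F (CSBO.Problem.output
              (P.dlsgd c.Lg1 β₀ y₀ (N ε) (K ε)) (α ε) x₁ ω)‖ₑ ^ 2
            ∂P.runLaw (N ε) (K ε) (T ε) ≤ ENNReal.ofReal (ε ^ 2)) ∧
          (∀ᵐ ω ∂P.runLaw (N ε) (K ε) (T ε),
            (∀ count ∈ ({CSBO.Cost.xi, CSBO.Cost.gradF} : Set (CSBO.Cost → ℕ)),
              (count (CSBO.Problem.totalCost
                (P.dlsgd c.Lg1 β₀ y₀ (N ε) (K ε)) (α ε) x₁ (T ε) ω) : ℝ)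
                ≤ C * (1 / ε) ^ 4 * Real.log (1 / ε) ^ q) ∧
            (∀ count ∈ ({CSBO.Cost.eta, CSBO.Cost.gradG} : Set (CSBO.Cost → ℕ)),
              (count (CSBO.Problem.totalCost
                (P.dlsgd c.Lg1 β₀ y₀ (N ε) (K ε)) (α ε) x₁ (T ε) ω) : ℝ)
                ≤ C * (1 / ε) ^ 6 * Real.log (1 / ε) ^ q)) := by
  open CSBO CSBO.Problem in
  obtain ⟨R, hR⟩ := exists_epochError_bound c hβ₀
  obtain ⟨D, hD, hpar⟩ := exists_parameters (G := c.Lg1 * (1 / c.μ) * c.Lf0) (A := c.compLip)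
    (B := 2 * c.Lf0) (Δ := Δ) c.ρ_nonneg c.ρ_lt_one R.coe_nonneg c.LF_nonneg
  -- Outside (0, 1/2] the level 1 is a default, so that the parameters are functions on all of ℝ.
  have hlev : ∀ ε : ℝ, ∃ j : ℕ, 1 ≤ j ∧ (0 < ε → ε ≤ 1 / 2 → (2 : ℝ)⁻¹ ^ j ≤ ε ∧
      (2 : ℝ) ^ j ≤ 2 * (1 / ε) ∧ (j : ℝ) ≤ 4 * Real.log (1 / ε)) := by
    intro ε
    by_cases h : 0 < ε ∧ ε ≤ 1 / 2
    · obtain ⟨j, h1, h2⟩ := exists_dyadic_level h.1 h.2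
      exact ⟨j, h1, fun _ _ => h2⟩
    · exact ⟨1, le_rfl, fun h1 h2 => absurd ⟨h1, h2⟩ h⟩
  choose j hj hjε using hlev
  choose N K T α W hN hK hK2 hα0 hα hT hNb hKb hW0 hW hsum using fun ε => hpar (j ε) (hj ε)
  -- 64 = 2⁶ and 4⁹ come from converting 2^j and j for powers up to 6 and 9; 10D² is the largest
  -- cost prefactor, that of RT-MLMC. The exponent 9 is 5 from T plus 4 from 2^K.
  set C : ℝ := 64 * 4 ^ 9 * 10 * D ^ 2
  have hD0 : 0 ≤ D := by linarith
  have hDD : D ≤ D ^ 2 := le_self_pow₀ hD two_ne_zero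
  have hCD : D * 4 ≤ C := by simp only [C]; nlinarith
  have h16 : ∀ i : ℕ, (16 : ℝ) ^ i = ((2 : ℝ) ^ i) ^ 4 := fun i => by
    rw [← pow_mul, mul_comm, pow_mul]; norm_num
  have h4 : ∀ i : ℕ, (4 : ℝ) ^ i = ((2 : ℝ) ^ i) ^ 2 := fun i => by
    rw [← pow_mul, mul_comm, pow_mul]; norm_num
  have hconv : ∀ ε : ℝ, 0 < ε → ε ≤ 1 / 2 → ∀ (M : ℝ) (r p : ℕ), 0 ≤ M → M ≤ 10 * D ^ 2 →
      r ≤ 6 → p ≤ 9 → M * ((2 : ℝ) ^ j ε) ^ r * (j ε : ℝ) ^ p ≤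
        C * (1 / ε) ^ r * Real.log (1 / ε) ^ 9 := by
    intro ε h0 h1 M r p hM0 hM hr hp
    obtain ⟨-, h2, hl⟩ := hjε ε h0 h1
    have hlog : 0 ≤ Real.log (1 / ε) := by
      linarith [(Nat.cast_nonneg (j ε) : (0 : ℝ) ≤ j ε)]
    refine (dyadic_bound_le h0 (hj ε) h2 hl hM0 r hp).trans ?_
    have h3 : M * 2 ^ r * 4 ^ 9 ≤ C := by
      calc M * 2 ^ r * 4 ^ 9 ≤ 10 * D ^ 2 * 2 ^ 6 * 4 ^ 9 := by gcongr; norm_num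
        _ = C := by simp only [C]; ring
    gcongr
  refine ⟨C, 9, N, K, T, α, ?_, ?_⟩
  · intro ε h0 h1
    obtain ⟨he, h2, hl⟩ := hjε ε h0 h1
    have hlog : 0 ≤ Real.log (1 / ε) := by
      linarith [(Nat.cast_nonneg (j ε) : (0 : ℝ) ≤ j ε)]
    have hlin : D * j ε ≤ C * Real.log (1 / ε) := by
      calc D * j ε ≤ D * (4 * Real.log (1 / ε)) := by gcongr
        _ = D * 4 * Real.log (1 / ε) := by ring
        _ ≤ _ := by gcongr
    refine ⟨(hN ε).trans hlin, (hK ε).trans hlin, hα0 ε, (hα ε).trans ?_, (hT ε).trans ?_⟩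
    · have : D ≤ C := by linarith
      gcongr
    · rw [h16]
      exact hconv ε h0 h1 D 4 5 hD0 (by nlinarith) (by norm_num) (by norm_num)
  · intro dx dy Ξ H _ _ P y₀ x₁ hP hΔ
    have hwd := hP.wellDefined
    refine ⟨hwd, fun ε h0 h1 => ?_⟩
    obtain ⟨he, -, -⟩ := hjε ε h0 h1
    have hj1 : (1 : ℝ) ≤ j ε := by exact_mod_cast hj ε
    have hN1 : (1 : ℝ) ≤ (N ε : ℕ) := by exact_mod_cast (N ε).pos
    -- One quarter of the accuracy for the EpochSGD error and one for the Neumann truncation; both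
    -- estimators share this mean.
    have hbias : ∀ x, ‖((N ε : ℕ) : ℝ)⁻¹ • ∑ n ∈ Finset.range (N ε),
        ∫ ω, P.levelComp c.Lg1 β₀ y₀ (N ε) x n (K ε) ω ∂P.sampleLaw - gradient P.F x‖ ≤
        2⁻¹ ^ j ε / 2 := by
      intro x
      refine (hP.norm_mean_levelComp_sub_gradient_le (hR hP) (N ε) x (K ε)
        (b := 2⁻¹ ^ j ε / 4) (by positivity) (hKb ε)).trans ?_
      have := hNb ε
      have e : (c.Lg1 : ℝ) * (1 / c.μ * (c.ρ ^ (N ε : ℕ) * c.Lf0)) =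
        c.Lg1 * (1 / c.μ) * c.Lf0 * c.ρ ^ (N ε : ℕ) := by ring
      rw [e]
      linarith
    have hfin : ENNReal.ofReal (2 * Δ / (α ε * (T ε : ℕ)) + (2⁻¹ ^ j ε / 2) ^ 2 +
        2 * c.LF * α ε * W ε) ≤ ENNReal.ofReal (ε ^ 2) := by
      apply ENNReal.ofReal_le_ofReal
      refine (hsum ε).trans ?_
      gcongr
    have hRT2 : ∀ x, ∫⁻ ω, ‖(P.rtmlmc c.Lg1 β₀ y₀ (N ε) (K ε) x ω).val‖ₑ ^ 2
        ∂P.tapeLaw (N ε) (K ε) ≤ ENNReal.ofReal (W ε) := fun x =>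
      (hP.lintegral_rtmlmc_sq_le (hR hP) (N ε) (K ε) x).trans (ENNReal.ofReal_le_ofReal (hW ε))
    -- W was chosen for RT-MLMC; it also dominates the smaller second moment of DL-SGD, so one set
    -- of parameters serves both.
    have hDL2 : ∀ x, ∫⁻ ω, ‖(P.dlsgd c.Lg1 β₀ y₀ (N ε) (K ε) x ω).val‖ₑ ^ 2
        ∂P.tapeLaw (N ε) (K ε) ≤ ENNReal.ofReal (W ε) := fun x => by
      refine (hP.lintegral_dlsgd_sq_le (N ε) (K ε) x).trans (ENNReal.ofReal_le_ofReal ?_)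
      refine le_trans ?_ (hW ε)
      have h3 : 0 ≤ 12 * (c.compLip * ((N ε : ℕ) : ℝ) ^ 2) ^ 2 * R * (K ε : ℕ) := by positivity
      linarith [sq_nonneg (2 * (c.Lf0 : ℝ) * (N ε : ℕ))]
    refine ⟨?_, ?_, ?_, ?_⟩
    · exact (lintegral_gradient_output_le hwd.differentiable_F hP.norm_gradient_F_sub_le
        c.LF_nonneg hΔ (hP.measurable_rtmlmc c.Lg1 β₀ (N ε) (K ε)) (hα0 ε) (hW0 ε)
        (fun x => by rw [hP.integral_rtmlmc]; exact hbias x) hRT2 (T ε)).trans hfin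
    · intro count hc
      refine (P.lintegral_count_rtmlmc_le c.Lg1 β₀ y₀ (N ε) (K ε) (T ε) (α ε) x₁ hc).trans ?_
      rw [← ENNReal.ofReal_natCast]
      apply ENNReal.ofReal_le_ofReal
      push_cast
      calc (T ε : ℝ) * (4 * (K ε : ℝ) + 3 * ((N ε : ℝ) + 1))
          ≤ (D * 16 ^ j ε * (j ε) ^ 5) * (4 * (D * j ε) + 3 * (D * j ε + D * j ε)) := by
            gcongr
            · exact hT ε
            · exact hK ε
            · exact hN ε
            · exact hN1.trans (hN ε)
        _ = 10 * D ^ 2 * ((2 : ℝ) ^ j ε) ^ 4 * (j ε : ℝ) ^ 6 := by rw [h16]; ring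
        _ ≤ _ := hconv ε h0 h1 _ 4 6 (by positivity) le_rfl (by norm_num) (by norm_num)
    · exact (lintegral_gradient_output_le hwd.differentiable_F hP.norm_gradient_F_sub_le
        c.LF_nonneg hΔ (hP.measurable_dlsgd c.Lg1 β₀ (N ε) (K ε)) (hα0 ε) (hW0 ε)
        (fun x => by rw [hP.integral_dlsgd]; exact hbias x) hDL2 (T ε)).trans hfin
    · filter_upwards [P.ae_count_dlsgd_le c.Lg1 β₀ y₀ (N ε) (K ε) (T ε) (α ε) x₁] with ω hω
      refine ⟨fun count hc => ?_, fun count hc => ?_⟩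
      · refine (Nat.cast_le.mpr (hω.1 count hc)).trans ((hT ε).trans ?_)
        rw [h16]
        exact hconv ε h0 h1 D 4 5 hD0 (by nlinarith) (by norm_num) (by norm_num)
      · refine (Nat.cast_le.mpr (hω.2 count hc)).trans ?_
        push_cast
        calc (T ε : ℝ) * (2 ^ ((K ε : ℕ) + 1) + (N ε : ℝ))
            ≤ (D * 16 ^ j ε * (j ε) ^ 5) * (D * 4 ^ j ε * (j ε) ^ 4 * 2 + D * 4 ^ j ε * (j ε) ^ 4) := by
              gcongr
              · exact hT ε
              · rw [pow_succ]
                gcongr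
                exact hK2 ε
              · refine (hN ε).trans ?_
                have h5 : (j ε : ℝ) ≤ (j ε : ℝ) ^ 4 := le_self_pow₀ hj1 (by norm_num)
                have h6 : D ≤ D * 4 ^ j ε :=
                  le_mul_of_one_le_right hD0 (one_le_pow₀ (by norm_num))
                gcongr
          _ = 3 * D ^ 2 * ((2 : ℝ) ^ j ε) ^ 6 * (j ε : ℝ) ^ 9 := by rw [h16, h4]; ring
          _ ≤ _ := hconv ε h0 h1 _ 6 9 (by positivity) (by nlinarith) le_rfl le_rfl
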